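/- Let $\Bbbk$ be a field, let $V$ be a finite-dimensional $\Bbbk$-vector space with basis $(x_i)_{i}$, and let $c\in\mathrm{Aut}(V\otimes V)$ satisfy the braid equation. Write $c(x_i\otimes x_j)=\sum_{k,\ell}c_{ij}^{k\ell}\,x_k\otimes x_\ell$, and assume that $c$ is rigid, i.e. that the map $c^\flat:V^*\otimes V\to V\otimes V^*$, $c^\flat(f\otimes x)=\sum_i (f\otimes\mathrm{id})(c(x\otimes x_i))\otimes x_i^*$, is bijective. Let $A(c)$ be the FRT bialgebra: it is generated by $t_i^j$ with relations $\sum_{k,\ell}c_{ij}^{k\ell}t_k^rt_\ell^s=\sum_{k,\ell}t_i^kt_j^\ell c_{k\ell}^{rs}$, with $\Delta(t_i^j)=\sum_k t_i^k\otimes t_k^j$ and $\varepsilon(t_i^j)=\delta_{ij}$. Let $r$ be its canonical coquasitriangular form, determined by $r(t_i^k,t_j^\ell)=c_{ji}^{k\ell}$, $r(ab,d)=r(a,d_{(1)})r(b,d_{(2)})$ and $r(a,bd)=r(a_{(2)},b)\,r(a_{(1)},d)$. Let $B=\mathfrak B(V,c)$ be the Nichols algebra, the quotient of the tensor algebra $TV$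 by the ideal $\bigoplus_n\ker QS_n$, where $QS_n=\sum_{\sigma\in\mathbb S_n}\rho_n(M(\sigma))$ is the quantum symmetrizer ($M$ the Matsumoto section). It is a graded left $A(c)$-comodule algebra through the algebra map $\lambda:B\to A(c)\otimes B$ with $\lambda(x_i)=\sum_j t_i^j\otimes x_j$. Assume that $\dim_\Bbbk B<\infty$ and let $\mathrm{top}$ be the largest degree with $B^{\mathrm{top}}\neq0$. Then $B^{\mathrm{top}}=\Bbbk\mathfrak b$ is one-dimensional, and $B^{\mathrm{top}-1}$ has a basis $(\omega^j)_j$ with $x_i\omega^j=\delta_i^j\mathfrak b$ (where $B^{-1}=0$). Put $\lambda(\mathfrak b)=D\otimes\mathfrak b$ and $\lambda(\omega^j)=\sum_i T_i^j\otimes\omega^i$. The element $D\in A(c)$ is group-like; let $H(c)=A(c)[D^{-1}]$ be the bialgebra obtained by adjoining a two-sided inverse of $D$ (with $D^{-1}$ group-like), let $\iota:A(c)\to H(c)$ be the canonical map, and let $\mathcal J(a)=r(a_{(1)},D)\,a_{(2)}\,r^{-1}(a_{(3)},D)$ for $a\in A(c)$, where $r^{-1}$ is the convolution inverse of $r$.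 Suppose that $\iota$ is injective or that $$\sum_{k}\mathcal J(T_i^k)\,t_k^j=\delta_i^jD\quad\text{in }A(c)\text{ for all }i,j.$$ Then $H(c)$ has a unique coquasitriangular structure $r_H$ with $r_H(\iota a,\iota b)=r(a,b)$ for all $a,b\in A(c)$, and $B$ is a braided Hopf algebra in the category of left $H(c)$-comodules, braided by $m\otimes n\mapsto r_H(n_{(-1)},m_{(-1)})\,n_{(0)}\otimes m_{(0)}$. Precisely: with its algebra structure and the $H(c)$-coaction $(\iota\otimes\mathrm{id})\lambda$, $B$ has a comultiplication, in which the elements of $V$ are primitive, a counit and an antipode such that all structure maps are $H(c)$-colinear and the axioms of a Hopf algebra in that braided category hold. -/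

import Mathlib

open TensorProduct Module Coalgebra

namespace NicholsFRT

noncomputable section

section FRT

variable {k : Type*} [Field k] {ι : Type*} [Fintype ι]

/-- The relations `∑ c_{ij}^{pq} t_p^r t_q^s = ∑ t_i^p t_j^q c_{pq}^{rs}` of the FRT construction, in the
free algebra on the `t_i^j = (i, j)`; here `C i j p q` is `c_{ij}^{pq}`. -/
inductive FRTRel (C : ι → ι → ι → ι → k) :
    FreeAlgebra k (ι × ι) → FreeAlgebra k (ι × ι) → Prop
  | mk (i j r s : ι) : FRTRel C
      (∑ p, ∑ q, C i j p q • (FreeAlgebra.ι k (p, r) * FreeAlgebra.ι k (q, s)))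
      (∑ p, ∑ q, C p q r s • (FreeAlgebra.ι k (i, p) * FreeAlgebra.ι k (j, q)))

/-- The FRT construction `A(c)`, as an algebra. -/
def FRT (C : ι → ι → ι → ι → k) : Type _ := RingQuot (FRTRel C)

instance (C : ι → ι → ι → ι → k) : Ring (FRT C) := inferInstanceAs (Ring (RingQuot _))
instance (C : ι → ι → ι → ι → k) : Algebra k (FRT C) := inferInstanceAs (Algebra k (RingQuot _))

variable (C : ι → ι → ι → ι → k)

namespace FRT

/-- The quotient map from the free algebra on the `t_i^j`. -/
def mk : FreeAlgebra k (ι × ι) →ₐ[k] FRT C := RingQuot.mkAlgHom k (FRTRel C)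

/-- The generator `t_i^j` of `A(c)`. -/
def t (i j : ι) : FRT C := mk C (FreeAlgebra.ι k (i, j))

theorem rel (i j r s : ι) :
    ∑ p, ∑ q, C i j p q • (t C p r * t C q s) = ∑ p, ∑ q, C p q r s • (t C i p * t C j q) := by
  have h := RingQuot.mkAlgHom_rel k (FRTRel.mk (C := C) i j r s)
  simp only [map_sum, map_smul, map_mul] at h
  exact h

variable {C}

/-- The algebra map out of `A(c)` given by the images of the generators. -/
def lift {B : Type*} [Ring B] [Algebra k B] (f : ι → ι → B)
    (h : ∀ i j r s, ∑ p, ∑ q, C i j p q • (f p r * f q s) =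
      ∑ p, ∑ q, C p q r s • (f i p * f j q)) : FRT C →ₐ[k] B :=
  RingQuot.liftAlgHom k ⟨FreeAlgebra.lift k fun x => f x.1 x.2, by
    rintro _ _ ⟨i, j, r, s⟩
    simpa only [map_sum, map_smul, map_mul, FreeAlgebra.lift_ι_apply] using h i j r s⟩

@[simp] theorem lift_t {B : Type*} [Ring B] [Algebra k B] (f : ι → ι → B) (h) (i j : ι) :
    lift (C := C) f h (t C i j) = f i j := by
  simp only [lift, t, mk]
  erw [RingQuot.liftAlgHom_mkAlgHom_apply]
  simp

theorem algHom_ext {B : Type*} [Semiring B] [Algebra k B] {f g : FRT C →ₐ[k] B}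
    (h : ∀ i j, f (t C i j) = g (t C i j)) : f = g := by
  refine RingQuot.ringQuot_ext' _ f g (FreeAlgebra.hom_ext (funext fun x => ?_))
  exact h x.1 x.2

theorem induction {P : FRT C → Prop} (hs : ∀ s : k, P (algebraMap k _ s))
    (ht : ∀ i j, P (t C i j)) (hadd : ∀ a b, P a → P b → P (a + b))
    (hmul : ∀ a b, P a → P b → P (a * b)) (a : FRT C) : P a := by
  obtain ⟨a, rfl⟩ : ∃ b, mk C b = a := RingQuot.mkAlgHom_surjective k (FRTRel C) a
  induction a using FreeAlgebra.induction with
  | grade0 s => rw [AlgHom.commutes]; exact hs s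
  | grade1 x => exact ht x.1 x.2
  | add a b ha hb => rw [map_add]; exact hadd _ _ ha hb
  | mul a b ha hb => rw [map_mul]; exact hmul _ _ ha hb

variable (C)

/-- The comultiplication `t_i^j ↦ ∑_m t_i^m ⊗ t_m^j`. -/
def comulHom : FRT C →ₐ[k] FRT C ⊗[k] FRT C :=
  lift (fun i j => ∑ m, t C i m ⊗ₜ[k] t C m j) fun i j r s => by
    have e1 : ∀ p q, (∑ m, t C p m ⊗ₜ[k] t C m r) * (∑ m, t C q m ⊗ₜ[k] t C m s) =
        ∑ m, ∑ n, (t C p m * t C q n) ⊗ₜ[k] (t C m r * t C n s) := fun p q => by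
      simp only [Finset.sum_mul_sum, Algebra.TensorProduct.tmul_mul_tmul]
    have e2 : ∀ p q, (∑ m, t C i m ⊗ₜ[k] t C m p) * (∑ m, t C j m ⊗ₜ[k] t C m q) =
        ∑ m, ∑ n, (t C i m * t C j n) ⊗ₜ[k] (t C m p * t C n q) := fun p q => by
      simp only [Finset.sum_mul_sum, Algebra.TensorProduct.tmul_mul_tmul]
    simp only [e1, e2]
    calc _ = ∑ m, ∑ n, (∑ p, ∑ q, C i j p q • (t C p m * t C q n)) ⊗ₜ[k]
          (t C m r * t C n s) := by
          simp only [Finset.smul_sum, TensorProduct.sum_tmul, TensorProduct.smul_tmul']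
          rw [Finset.sum_congr rfl fun p _ => Finset.sum_comm]
          rw [Finset.sum_comm]
          refine Finset.sum_congr rfl fun m _ => ?_
          rw [Finset.sum_congr rfl fun p _ => Finset.sum_comm]
          rw [Finset.sum_comm]
      _ = ∑ m, ∑ n, (t C i m * t C j n) ⊗ₜ[k]
          (∑ p, ∑ q, C p q r s • (t C m p * t C n q)) := by
          simp only [rel C i j, TensorProduct.sum_tmul, TensorProduct.tmul_sum,
            ← TensorProduct.smul_tmul', TensorProduct.tmul_smul]
          calc _ = ∑ m, ∑ p, ∑ n, ∑ q, C p q m n • ((t C i p * t C j q) ⊗ₜ[k]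
                (t C m r * t C n s)) :=
                Finset.sum_congr rfl fun m _ => Finset.sum_comm
            _ = ∑ p, ∑ m, ∑ n, ∑ q, C p q m n • ((t C i p * t C j q) ⊗ₜ[k]
                (t C m r * t C n s)) := Finset.sum_comm
            _ = ∑ p, ∑ m, ∑ q, ∑ n, C p q m n • ((t C i p * t C j q) ⊗ₜ[k]
                (t C m r * t C n s)) :=
                Finset.sum_congr rfl fun p _ => Finset.sum_congr rfl fun m _ => Finset.sum_comm
            _ = ∑ p, ∑ q, ∑ m, ∑ n, C p q m n • ((t C i p * t C j q) ⊗ₜ[k]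
                (t C m r * t C n s)) := Finset.sum_congr rfl fun p _ => Finset.sum_comm
            _ = _ := Finset.sum_congr rfl fun p _ => Finset.sum_congr rfl fun q _ => by
                have h := congrArg (fun z => (t C i p * t C j q) ⊗ₜ[k] z) (rel C p q r s)
                simpa only [TensorProduct.tmul_sum, TensorProduct.tmul_smul] using h
      _ = _ := by
          simp only [Finset.smul_sum, TensorProduct.tmul_sum, TensorProduct.tmul_smul]
          symm
          rw [Finset.sum_congr rfl fun p _ => Finset.sum_comm]
          rw [Finset.sum_comm]
          refine Finset.sum_congr rfl fun m _ => ?_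
          rw [Finset.sum_congr rfl fun p _ => Finset.sum_comm]
          rw [Finset.sum_comm]

variable [DecidableEq ι]

/-- The counit `t_i^j ↦ δ_{ij}`. -/
def counitHom : FRT C →ₐ[k] k :=
  lift (fun i j => if i = j then 1 else 0) fun i j r s => by simp

instance : Bialgebra k (FRT C) :=
  Bialgebra.ofAlgHom (comulHom C) (counitHom C)
    (by
      refine algHom_ext fun i j => ?_
      simp only [comulHom, AlgHom.comp_apply, lift_t, map_sum, Algebra.TensorProduct.map_tmul,
        AlgHom.id_apply, TensorProduct.sum_tmul, TensorProduct.tmul_sum]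
      rw [Finset.sum_comm]
      rfl)
    (by
      refine algHom_ext fun i j => ?_
      simp [comulHom, counitHom, TensorProduct.ite_tmul])
    (by
      refine algHom_ext fun i j => ?_
      simp [comulHom, counitHom, TensorProduct.tmul_ite])

theorem comul_t (i j : ι) :
    comul (R := k) (t C i j) = ∑ m, t C i m ⊗ₜ[k] t C m j :=
  lift_t (C := C) _ _ i j

theorem counit_t (i j : ι) : counit (R := k) (t C i j) = if i = j then 1 else 0 :=
  lift_t (C := C) _ _ i j

end FRT
end FRT
end

noncomputable section

section Braided

variable {k : Type*} [Field k] {V : Type*} [AddCommGroup V] [Module k V]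

/-- The braid equation `(c ⊗ id)(id ⊗ c)(c ⊗ id) = (id ⊗ c)(c ⊗ id)(id ⊗ c)`. -/
def IsBraiding (c : V ⊗[k] V ≃ₗ[k] V ⊗[k] V) : Prop :=
  let c₁ : (V ⊗[k] V) ⊗[k] V →ₗ[k] (V ⊗[k] V) ⊗[k] V := c.toLinearMap.rTensor V
  let c₂ : (V ⊗[k] V) ⊗[k] V →ₗ[k] (V ⊗[k] V) ⊗[k] V :=
    (TensorProduct.assoc k V V V).symm.toLinearMap ∘ₗ c.toLinearMap.lTensor V ∘ₗ
      (TensorProduct.assoc k V V V).toLinearMap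
  c₁ ∘ₗ c₂ ∘ₗ c₁ = c₂ ∘ₗ c₁ ∘ₗ c₂

variable {ι : Type*} (e : Basis ι k V) (c : V ⊗[k] V ≃ₗ[k] V ⊗[k] V)

/-- The structure constants `c_{ij}^{pq}`: `c(x_i ⊗ x_j) = ∑ c_{ij}^{pq} x_p ⊗ x_q`. -/
def coef (i j p q : ι) : k := (e.tensorProduct e).repr (c (e i ⊗ₜ e j)) (p, q)

variable [Fintype ι]

theorem apply_basis (i j : ι) :
    c (e i ⊗ₜ e j) = ∑ p, ∑ q, coef e c i j p q • (e p ⊗ₜ[k] e q) := by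
  rw [← Fintype.sum_prod_type' (f := fun p q => coef e c i j p q • (e p ⊗ₜ[k] e q))]
  conv_lhs => rw [← (e.tensorProduct e).sum_repr (c (e i ⊗ₜ e j))]
  exact Finset.sum_congr rfl fun x _ => by rw [Basis.tensorProduct_apply']; rfl

/-- The map `c^♭ : V* ⊗ V → V ⊗ V*`, `f ⊗ x ↦ ∑_i (f ⊗ id)(c(x ⊗ x_i)) ⊗ x_i^*`. -/
def flat : Dual k V ⊗[k] V →ₗ[k] V ⊗[k] Dual k V :=
  TensorProduct.lift <| LinearMap.mk₂ k
    (fun f x => ∑ i, TensorProduct.lid k V (f.rTensor V (c (x ⊗ₜ e i))) ⊗ₜ[k] e.coord i)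
    (fun f g x => by
      simp [LinearMap.rTensor_add, TensorProduct.add_tmul, Finset.sum_add_distrib])
    (fun s f x => by
      simp [LinearMap.rTensor_smul, TensorProduct.smul_tmul', Finset.smul_sum])
    (fun f x y => by simp [TensorProduct.add_tmul, Finset.sum_add_distrib])
    (fun s f x => by
      simp [← TensorProduct.smul_tmul', Finset.smul_sum])

/-- The braiding `c` is rigid if `c^♭` is invertible. -/
def IsRigid : Prop := Function.Bijective (flat e c)

/-- The braid equation for an array `C i j p q = C_{ij}^{pq}` of structure constants. -/
def YB (C : ι → ι → ι → ι → k) : Prop := ∀ a i j r s b,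
  ∑ p, ∑ q, C i j p q * ∑ m, C a p r m * C m q s b =
    ∑ p, ∑ q, C p q r s * ∑ m, C a i p m * C m j q b

variable {c}

theorem coef_braid (hc : IsBraiding c) : YB (coef e c) := by
  intro a i j r s b
  classical
  have h := LinearMap.congr_fun hc.symm ((e a ⊗ₜ e i) ⊗ₜ e j)
  simp only [LinearMap.comp_apply, LinearEquiv.coe_coe, TensorProduct.assoc_tmul,
    LinearMap.lTensor_tmul, LinearMap.rTensor_tmul, apply_basis, map_sum, map_smul,
    TensorProduct.tmul_sum, TensorProduct.sum_tmul, TensorProduct.tmul_smul,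
    ← TensorProduct.smul_tmul', TensorProduct.assoc_symm_tmul, Finset.smul_sum, smul_smul] at h
  have h2 := congrArg (fun z => ((e.tensorProduct e).tensorProduct e).repr z ((r, s), b)) h
  simp only [map_sum, map_smul, Finsupp.finsetSum_apply, Finsupp.smul_apply,
    Basis.tensorProduct_repr_tmul_apply, Basis.repr_self, smul_eq_mul, Finsupp.single_apply,
    mul_ite, mul_one, mul_zero] at h2
  simp only [Finset.sum_ite_irrel, Finset.sum_const_zero, Finset.sum_ite_eq',
    Finset.mem_univ, if_true] at h2
  simp only [Finset.mul_sum]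
  refine Eq.trans ?_ (h2.trans ?_)
  · simp only [mul_assoc]
  · rw [Finset.sum_congr rfl fun p _ => Finset.sum_comm]
    exact Finset.sum_congr rfl fun p _ => Finset.sum_congr rfl fun q _ =>
      Finset.sum_congr rfl fun m _ => by ring

section Pairing

variable [DecidableEq ι] {C : ι → ι → ι → ι → k}

/-- The algebra map `a ↦ (r(a, t_j^q))_{j,q}` from `A(c)` to matrices, with
`r(t_i^p, t_j^q) = c_{ji}^{pq}`. -/
def leftRep (hC : YB C) : FRT C →ₐ[k] Matrix ι ι k :=
  FRT.lift (fun i p => Matrix.of fun j q => C j i p q) fun i j r s => by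
    ext a b
    simpa [Matrix.sum_apply, Matrix.mul_apply] using hC a i j r s b

theorem leftRep_t (hC : YB C) (i p j q : ι) : leftRep hC (FRT.t C i p) j q = C j i p q := by
  simp [leftRep]

/-- The linear form `r(-, t_j^q)` on `A(c)`. -/
def leftCoef (hC : YB C) (j q : ι) : FRT C →ₗ[k] k :=
  Matrix.entryLinearMap k k j q ∘ₗ (leftRep hC).toLinearMap

/-- The tensor square of the matrix representation `leftRep`. -/
def pairRep (hC : YB C) : FRT C →ₐ[k] Matrix (ι × ι) (ι × ι) k :=
  ((Algebra.TensorProduct.lid k k).toAlgHom.mapMatrix).comp <|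
  ((Matrix.kroneckerTMulAlgEquiv ι ι k k k k).toAlgHom.comp
    (Algebra.TensorProduct.map (leftRep hC) (leftRep hC))).comp (Bialgebra.comulAlgHom k (FRT C))

theorem pairRep_apply (hC : YB C) (a : FRT C) (l p s r : ι) :
    pairRep hC a (l, p) (s, r) =
      (WithConv.toConv (leftCoef hC l s) * WithConv.toConv (leftCoef hC p r)) a := by
  simp only [pairRep, LinearMap.convMul_apply, AlgHom.comp_apply, Bialgebra.comulAlgHom_apply]
  induction comul (R := k) a with
  | zero => simp
  | add x y hx hy => simp only [map_add, Matrix.add_apply, hx, hy]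
  | tmul x y => simp [leftCoef]

theorem pairRep_t (hC : YB C) (i j l p s r : ι) :
    pairRep hC (FRT.t C i j) (l, p) (s, r) = ∑ m, C l i m s * C p m j r := by
  rw [pairRep_apply, LinearMap.convMul_apply, FRT.comul_t]
  simp [leftCoef, leftRep_t]

/-- The structure constants as a matrix that commutes with `pairRep`. -/
def braidMat (C : ι → ι → ι → ι → k) : Matrix (ι × ι) (ι × ι) k :=
  Matrix.of fun x y => C x.2 x.1 y.2 y.1

theorem braidMat_comm (hC : YB C) (a : FRT C) :
    braidMat C * pairRep hC a = pairRep hC a * braidMat C := by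
  induction a using FRT.induction with
  | hs s => rw [AlgHom.commutes]; exact (Algebra.commutes _ _).symm
  | ht x y =>
    ext ⟨i, j⟩ ⟨s, r⟩
    simp only [Matrix.mul_apply, pairRep_t, braidMat, Fintype.sum_prod_type, Matrix.of_apply]
    have h := hC j i x y r s
    simp only [Finset.mul_sum, Finset.sum_mul] at h ⊢
    calc _ = ∑ p, ∑ q, ∑ m, C p q y r * (C j i p m * C m x q s) := by
          rw [Finset.sum_comm]
          refine Finset.sum_congr rfl fun p _ => ?_
          rw [Finset.sum_comm]
          exact Finset.sum_congr rfl fun q _ => Finset.sum_congr rfl fun m _ => by ring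
      _ = _ := h.symm
      _ = ∑ p, ∑ q, ∑ m, C i x m p * C j m y q * C q p r s := by
          rw [Finset.sum_comm]
          refine Finset.sum_congr rfl fun p _ => ?_
          rw [Finset.sum_comm]
          exact Finset.sum_congr rfl fun q _ => Finset.sum_congr rfl fun m _ => by ring
  | hadd a b ha hb => rw [map_add, mul_add, add_mul, ha, hb]
  | hmul a b ha hb => rw [map_mul, ← mul_assoc, ha, mul_assoc, hb, mul_assoc]

/-- The map `b ↦ r(-, b)`, an antihomomorphism from `A(c)` to the convolution algebra `A(c)^*`. -/
def rightRep (hC : YB C) : FRT C →ₐ[k] (WithConv (FRT C →ₗ[k] k))ᵐᵒᵖ :=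
  FRT.lift (fun j q => MulOpposite.op (WithConv.toConv (leftCoef hC j q))) fun i j r s => by
    simp only [← MulOpposite.op_mul, ← MulOpposite.op_smul, ← Finset.op_sum]
    refine congrArg MulOpposite.op (WithConv.ext (LinearMap.ext fun a => ?_))
    have h := congrFun (congrFun (braidMat_comm hC a) (j, i)) (s, r)
    simp only [Matrix.mul_apply, braidMat, Fintype.sum_prod_type, Matrix.of_apply,
      pairRep_apply] at h
    rw [Finset.sum_comm] at h
    simp only [WithConv.ofConv_sum, WithConv.ofConv_smul, LinearMap.sum_apply,
      LinearMap.smul_apply, smul_eq_mul]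
    refine h.trans ?_
    rw [Finset.sum_comm]
    exact Finset.sum_congr rfl fun p _ => Finset.sum_congr rfl fun q _ => mul_comm _ _

/-- The canonical coquasitriangular form `r` of `A(c)`, with `r(t_i^p, t_j^q) = c_{ji}^{pq}`,
`r(ab, d) = r(a, d₁) r(b, d₂)` and `r(a, bd) = r(a₂, b) r(a₁, d)`. -/
def universalForm (hC : YB C) : FRT C ⊗[k] FRT C →ₗ[k] k :=
  TensorProduct.lift <| LinearMap.flip
    { toFun := fun b => (rightRep hC b).unop.ofConv
      map_add' := fun a b => by simp
      map_smul' := fun s a => by simp }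

theorem universalForm_t (hC : YB C) (i p j q : ι) :
    universalForm hC (FRT.t C i p ⊗ₜ FRT.t C j q) = C j i p q := by
  simp [universalForm, rightRep, leftCoef, leftRep_t]

end Pairing

end Braided

section Localization

variable {k : Type*} [Field k] {A : Type*} [Ring A] 

/-- The relations of the algebra generated by the algebra `A` (the `some a`) and an inverse
(`none`) of `D`. -/
inductive LocRel [Algebra k A] (D : A) : FreeAlgebra k (Option A) → FreeAlgebra k (Option A) → Prop
  | add (a b : A) : LocRel D (FreeAlgebra.ι k (some (a + b)))
      (FreeAlgebra.ι k (some a) + FreeAlgebra.ι k (some b))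
  | mul (a b : A) : LocRel D (FreeAlgebra.ι k (some (a * b)))
      (FreeAlgebra.ι k (some a) * FreeAlgebra.ι k (some b))
  | scalar (s : k) : LocRel D (FreeAlgebra.ι k (some (algebraMap k A s)))
      (algebraMap k (FreeAlgebra k (Option A)) s)
  | mul_inv : LocRel D (FreeAlgebra.ι k (some D) * FreeAlgebra.ι k none) 1
  | inv_mul : LocRel D (FreeAlgebra.ι k none * FreeAlgebra.ι k (some D)) 1

variable [Bialgebra k A]

/-- The localization `A[D⁻¹]` of a bialgebra at a group-like element: the free product of `A` with
`k[x]`, modulo `xD = 1 = Dx`. It has the universal property for algebra maps inverting `D`. -/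
def Loc (D : GroupLike k A) : Type _ := RingQuot (LocRel (k := k) D.val)

instance (D : GroupLike k A) : Ring (Loc D) := inferInstanceAs (Ring (RingQuot _))
instance (D : GroupLike k A) : Algebra k (Loc D) := inferInstanceAs (Algebra k (RingQuot _))

namespace Loc

variable (D : GroupLike k A)

/-- The canonical map `A → A[D⁻¹]`. -/
def of : A →ₐ[k] Loc D where
  toFun a := RingQuot.mkAlgHom k (LocRel (k := k) D.val) (FreeAlgebra.ι k (some a))
  map_one' := by
    have h := RingQuot.mkAlgHom_rel k (LocRel.scalar (k := k) (D := D.val) 1)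
    simp only [map_one] at h
    exact h
  map_zero' := by
    have h := RingQuot.mkAlgHom_rel k (LocRel.scalar (k := k) (D := D.val) 0)
    simp only [map_zero] at h
    exact h
  map_add' a b := by
    have h := RingQuot.mkAlgHom_rel k (LocRel.add (k := k) (D := D.val) a b)
    simp only [map_add] at h
    exact h
  map_mul' a b := by
    have h := RingQuot.mkAlgHom_rel k (LocRel.mul (k := k) (D := D.val) a b)
    simp only [map_mul] at h
    exact h
  commutes' s := by
    have h := RingQuot.mkAlgHom_rel k (LocRel.scalar (k := k) (D := D.val) s)
    simp only [AlgHom.commutes] at h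
    exact h

/-- The element `D⁻¹`. -/
def inv : Loc D := RingQuot.mkAlgHom k (LocRel (k := k) D.val) (FreeAlgebra.ι k none)

theorem of_mul_inv : of D D.val * inv D = 1 := by
  have h := RingQuot.mkAlgHom_rel k (LocRel.mul_inv (k := k) (D := D.val))
  simp only [map_mul, map_one] at h
  exact h

theorem inv_mul_of : inv D * of D D.val = 1 := by
  have h := RingQuot.mkAlgHom_rel k (LocRel.inv_mul (k := k) (D := D.val))
  simp only [map_mul, map_one] at h
  exact h

variable {D} {B : Type*} [Ring B] [Algebra k B]

/-- The universal property of the localization. -/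
def lift (f : A →ₐ[k] B) (u : B) (h₁ : f D.val * u = 1) (h₂ : u * f D.val = 1) :
    Loc D →ₐ[k] B :=
  RingQuot.liftAlgHom k ⟨FreeAlgebra.lift k fun x => x.elim u f, by
    rintro _ _ (⟨a, b⟩ | ⟨a, b⟩ | s | _ | _) <;> simp [h₁, h₂]⟩

@[simp] theorem lift_of (f : A →ₐ[k] B) (u : B) (h₁ h₂) (a : A) :
    lift (D := D) f u h₁ h₂ (of D a) = f a := by
  simp only [lift, of]
  erw [RingQuot.liftAlgHom_mkAlgHom_apply]
  simp

@[simp] theorem lift_inv (f : A →ₐ[k] B) (u : B) (h₁ h₂) :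
    lift (D := D) f u h₁ h₂ (inv D) = u := by
  simp only [lift, inv]
  erw [RingQuot.liftAlgHom_mkAlgHom_apply]
  simp

theorem algHom_ext {f g : Loc D →ₐ[k] B} (h : ∀ a, f (of D a) = g (of D a)) : f = g := by
  have hinv : f (inv D) = g (inv D) := by
    refine left_inv_eq_right_inv (a := f (of D D.val)) ?_ ?_
    · rw [← map_mul, inv_mul_of, map_one]
    · rw [h, ← map_mul, of_mul_inv, map_one]
  refine RingQuot.ringQuot_ext' _ f g (FreeAlgebra.hom_ext (funext fun x => ?_))
  cases x with
  | none => exact hinv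
  | some a => exact h a

variable (D)

/-- The comultiplication of `A[D⁻¹]`; it extends that of `A`, and `D⁻¹` is group-like. -/
def comulHom : Loc D →ₐ[k] Loc D ⊗[k] Loc D :=
  lift ((Algebra.TensorProduct.map (of D) (of D)).comp (Bialgebra.comulAlgHom k A))
    (inv D ⊗ₜ inv D)
    (by simp [D.isGroupLikeElem_val.comul_eq_tmul_self, of_mul_inv, Algebra.TensorProduct.one_def])
    (by simp [D.isGroupLikeElem_val.comul_eq_tmul_self, inv_mul_of, Algebra.TensorProduct.one_def])

/-- The counit of `A[D⁻¹]`; it extends that of `A`. -/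
def counitHom : Loc D →ₐ[k] k :=
  lift (Bialgebra.counitAlgHom k A) 1
    (by simp [D.isGroupLikeElem_val.counit_eq_one])
    (by simp [D.isGroupLikeElem_val.counit_eq_one])

theorem comulHom_comp : (comulHom D).comp (of D) =
    (Algebra.TensorProduct.map (of D) (of D)).comp (Bialgebra.comulAlgHom k A) :=
  AlgHom.ext fun a => lift_of _ _ _ _ a

theorem counitHom_comp : (counitHom D).comp (of D) = Bialgebra.counitAlgHom k A :=
  AlgHom.ext fun a => lift_of _ _ _ _ a

instance : Bialgebra k (Loc D) :=
  Bialgebra.ofAlgHom (comulHom D) (counitHom D)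
    (by
      refine algHom_ext fun a => ?_
      have h1 : ∀ z : A ⊗[k] A, Algebra.TensorProduct.assoc k k k (Loc D) (Loc D) (Loc D)
          (Algebra.TensorProduct.map (comulHom D) (.id k _)
            (Algebra.TensorProduct.map (of D) (of D) z)) =
          TensorProduct.map (of D).toLinearMap (TensorProduct.map (of D).toLinearMap
            (of D).toLinearMap) (TensorProduct.assoc k A A A (comul.rTensor A z)) := by
        intro z
        induction z with
        | zero => simp
        | add x y hx hy => simp only [map_add, hx, hy]
        | tmul x y =>
          simp only [Algebra.TensorProduct.map_tmul, AlgHom.id_apply, LinearMap.rTensor_tmul]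
          rw [show comulHom D (of D x) = _ from DFunLike.congr_fun (comulHom_comp D) x]
          simp only [AlgHom.comp_apply, Bialgebra.comulAlgHom_apply]
          induction (comul (R := k) x) with
          | zero => simp
          | add u v hu hv => simp only [map_add, add_tmul, hu, hv]
          | tmul u v => simp
      have h2 : ∀ z : A ⊗[k] A, Algebra.TensorProduct.map (.id k _) (comulHom D)
            (Algebra.TensorProduct.map (of D) (of D) z) =
          TensorProduct.map (of D).toLinearMap (TensorProduct.map (of D).toLinearMap
            (of D).toLinearMap) (comul.lTensor A z) := by
        intro z
        induction z with
        | zero => simp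
        | add x y hx hy => simp only [map_add, hx, hy]
        | tmul x y =>
          simp only [Algebra.TensorProduct.map_tmul, AlgHom.id_apply, LinearMap.lTensor_tmul]
          rw [show comulHom D (of D y) = _ from DFunLike.congr_fun (comulHom_comp D) y]
          rfl
      have h0 : comulHom D (of D a) = _ := DFunLike.congr_fun (comulHom_comp D) a
      simp only [AlgHom.comp_apply, Bialgebra.comulAlgHom_apply] at h0
      simp only [AlgHom.comp_apply, h0, h2]
      refine (h1 _).trans ?_
      rw [Coalgebra.coassoc_apply])
    (by
      refine algHom_ext fun a => ?_
      have h1 : ∀ z : A ⊗[k] A, Algebra.TensorProduct.map (counitHom D) (.id k (Loc D))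
            (Algebra.TensorProduct.map (of D) (of D) z) =
          TensorProduct.map .id (of D).toLinearMap (counit.rTensor A z) := by
        intro z
        induction z with
        | zero => simp
        | add x y hx hy => simp only [map_add, hx, hy]
        | tmul x y =>
          have := DFunLike.congr_fun (counitHom_comp D) x
          simp only [AlgHom.comp_apply, Bialgebra.counitAlgHom_apply] at this
          simp [this]
      have h0 : comulHom D (of D a) = _ := DFunLike.congr_fun (comulHom_comp D) a
      simp only [AlgHom.comp_apply, Bialgebra.comulAlgHom_apply] at h0
      simp only [AlgHom.comp_apply, h0, h1, Coalgebra.rTensor_counit_comul]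
      simp)
    (by
      refine algHom_ext fun a => ?_
      have h1 : ∀ z : A ⊗[k] A, Algebra.TensorProduct.map (.id k (Loc D)) (counitHom D)
            (Algebra.TensorProduct.map (of D) (of D) z) =
          TensorProduct.map (of D).toLinearMap .id (counit.lTensor A z) := by
        intro z
        induction z with
        | zero => simp
        | add x y hx hy => simp only [map_add, hx, hy]
        | tmul x y =>
          have := DFunLike.congr_fun (counitHom_comp D) y
          simp only [AlgHom.comp_apply, Bialgebra.counitAlgHom_apply] at this
          simp [this]
      have h0 : comulHom D (of D a) = _ := DFunLike.congr_fun (comulHom_comp D) a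
      simp only [AlgHom.comp_apply, Bialgebra.comulAlgHom_apply] at h0
      simp only [AlgHom.comp_apply, h0, h1, Coalgebra.lTensor_counit_comul]
      simp)

theorem comul_of (a : A) : comul (R := k) (of D a) =
    TensorProduct.map (of D).toLinearMap (of D).toLinearMap (comul a) :=
  lift_of _ _ _ _ a

theorem counit_of (a : A) : counit (R := k) (of D a) = counit (R := k) a :=
  lift_of _ _ _ _ a

theorem comul_inv : comul (R := k) (inv D) = inv D ⊗ₜ[k] inv D := lift_inv _ _ _ _

theorem counit_inv : counit (R := k) (inv D) = 1 := lift_inv _ _ _ _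

end Loc
end Localization

section Coquasitriangular

variable {k : Type*} [Field k] {A : Type*} [Ring A] [Bialgebra k A]

/-- A coquasitriangular structure on a bialgebra: a convolution-invertible form `r` with
`r(ab, c) = r(a, c₁) r(b, c₂)`, `r(a, bc) = r(a₂, b) r(a₁, c)` and
`r(a₁, b₁) a₂ b₂ = b₁ a₁ r(a₂, b₂)`. -/
structure IsCoquasitriangular (r : A ⊗[k] A →ₗ[k] k) : Prop where
  isUnit : IsUnit (WithConv.toConv r)
  mul_left : ∀ a b c : A, r ((a * b) ⊗ₜ c) =
    LinearMap.mul' k k (TensorProduct.map (curry r a) (curry r b) (comul c))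
  mul_right : ∀ a b c : A, r (a ⊗ₜ (b * c)) =
    LinearMap.mul' k k (TensorProduct.map ((curry r).flip c) ((curry r).flip b) (comul a))
  quasicomm : ∀ a b : A,
    TensorProduct.lid k A (TensorProduct.map r (LinearMap.mul' k A)
      (comul (R := k) (a ⊗ₜ[k] b))) =
    TensorProduct.rid k A (TensorProduct.map
      (LinearMap.mul' k A ∘ₗ (TensorProduct.comm k A A).toLinearMap) r
      (comul (R := k) (a ⊗ₜ[k] b)))

/-- The convolution inverse `r⁻¹` of a convolution-invertible form `r`. -/
def convInv (r : A ⊗[k] A →ₗ[k] k) : A ⊗[k] A →ₗ[k] k :=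
  (Ring.inverse (WithConv.toConv r)).ofConv

/-- The map `a ↦ r(a₁, g) a₂ r⁻¹(a₃, g)`; for a group-like `g` in a coquasitriangular bialgebra it
is the automorphism `J_g` with `g a = J_g(a) g`. -/
def hayashi (r : A ⊗[k] A →ₗ[k] k) (g : A) : A →ₗ[k] A :=
  (TensorProduct.lid k A).toLinearMap ∘ₗ
    TensorProduct.map ((curry r).flip g)
      ((TensorProduct.rid k A).toLinearMap ∘ₗ
        TensorProduct.map LinearMap.id ((curry (convInv r)).flip g) ∘ₗ comul) ∘ₗ comul

end Coquasitriangular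

section Comodules

variable {k : Type*} [Field k] {H : Type*} [Ring H] [Bialgebra k H]
variable {M N P : Type*} [AddCommGroup M] [Module k M] [AddCommGroup N] [Module k N]

/-- Left comodule structures over a bialgebra. -/
structure IsCoaction (l : M →ₗ[k] H ⊗[k] M) : Prop where
  coassoc : TensorProduct.assoc k H H M ∘ₗ comul.rTensor M ∘ₗ l = l.lTensor H ∘ₗ l
  counit : TensorProduct.lid k M ∘ₗ counit.rTensor M ∘ₗ l = LinearMap.id

/-- The diagonal coaction `m ⊗ n ↦ m₍₋₁₎ n₍₋₁₎ ⊗ m₍₀₎ ⊗ n₍₀₎`. -/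
def tensorCoaction (l : M →ₗ[k] H ⊗[k] M) (l' : N →ₗ[k] H ⊗[k] N) :
    M ⊗[k] N →ₗ[k] H ⊗[k] (M ⊗[k] N) :=
  (LinearMap.mul' k H).rTensor (M ⊗[k] N) ∘ₗ
    (TensorProduct.tensorTensorTensorComm k H M H N).toLinearMap ∘ₗ TensorProduct.map l l'

/-- The unit comodule. -/
def trivialCoaction : k →ₗ[k] H ⊗[k] k := TensorProduct.mk k H k 1

/-- Comodule maps. -/
def IsColinear (l : M →ₗ[k] H ⊗[k] M) (l' : N →ₗ[k] H ⊗[k] N) (f : M →ₗ[k] N) : Prop :=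
  l' ∘ₗ f = f.lTensor H ∘ₗ l

/-- The braiding `m ⊗ n ↦ r(n₍₋₁₎, m₍₋₁₎) n₍₀₎ ⊗ m₍₀₎` of the category of left comodules over a
coquasitriangular bialgebra. -/
def comoduleBraiding (r : H ⊗[k] H →ₗ[k] k) (l : M →ₗ[k] H ⊗[k] M) (l' : N →ₗ[k] H ⊗[k] N) :
    M ⊗[k] N →ₗ[k] N ⊗[k] M :=
  (TensorProduct.lid k (N ⊗[k] M)).toLinearMap ∘ₗ r.rTensor (N ⊗[k] M) ∘ₗ
    (TensorProduct.tensorTensorTensorComm k H N H M).toLinearMap ∘ₗ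
    TensorProduct.map l' l ∘ₗ (TensorProduct.comm k M N).toLinearMap

variable {B : Type*} [Ring B] [Algebra k B]

/-- The algebra `B` with coaction `l`, comultiplication `Δ`, counit `ε` and antipode `S` is a Hopf
algebra in the braided category of left `H`-comodules: all structure maps are colinear, `Δ` and
`ε` form a coalgebra, they are algebra maps (for the product of `B ⊗ B` twisted by the comodule
braiding), and `S` is the convolution inverse of the identity. -/
structure IsBraidedHopfAlgebra (r : H ⊗[k] H →ₗ[k] k) (l : B →ₗ[k] H ⊗[k] B)
    (Δ : B →ₗ[k] B ⊗[k] B) (ε : B →ₗ[k] k) (S : B →ₗ[k] B) : Prop where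
  coaction : IsCoaction l
  mul_colinear : IsColinear (tensorCoaction l l) l (LinearMap.mul' k B)
  one_colinear : IsColinear trivialCoaction l (Algebra.linearMap k B)
  comul_colinear : IsColinear l (tensorCoaction l l) Δ
  counit_colinear : IsColinear l trivialCoaction ε
  antipode_colinear : IsColinear l l S
  coassoc : TensorProduct.assoc k B B B ∘ₗ Δ.rTensor B ∘ₗ Δ = Δ.lTensor B ∘ₗ Δ
  counit_left : TensorProduct.lid k B ∘ₗ ε.rTensor B ∘ₗ Δ = LinearMap.id
  counit_right : TensorProduct.rid k B ∘ₗ ε.lTensor B ∘ₗ Δ = LinearMap.id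
  comul_one : Δ 1 = 1 ⊗ₜ 1
  counit_one : ε 1 = 1
  counit_mul : ∀ a b, ε (a * b) = ε a * ε b
  comul_mul : Δ ∘ₗ LinearMap.mul' k B =
    TensorProduct.map (LinearMap.mul' k B) (LinearMap.mul' k B) ∘ₗ
    (TensorProduct.assoc k (B ⊗[k] B) B B).toLinearMap ∘ₗ
    ((TensorProduct.assoc k B B B).symm.toLinearMap ∘ₗ
      (comoduleBraiding r l l).lTensor B ∘ₗ
      (TensorProduct.assoc k B B B).toLinearMap).rTensor B ∘ₗ
    (TensorProduct.assoc k (B ⊗[k] B) B B).symm.toLinearMap ∘ₗ TensorProduct.map Δ Δ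
  antipode_left : LinearMap.mul' k B ∘ₗ S.rTensor B ∘ₗ Δ = Algebra.linearMap k B ∘ₗ ε
  antipode_right : LinearMap.mul' k B ∘ₗ S.lTensor B ∘ₗ Δ = Algebra.linearMap k B ∘ₗ ε

end Comodules

section Nichols

variable {k : Type*} [Field k] {V : Type*} [AddCommGroup V] [Module k V]
  {ι : Type*} (e : Basis ι k V) (c : V ⊗[k] V ≃ₗ[k] V ⊗[k] V)

section Symmetrizer

/-- The monomial `x_{i₁} ⋯ x_{iₙ}` in `TV`. -/
def word (w : List ι) : TensorAlgebra k V := (w.map fun i => TensorAlgebra.ι k (e i)).prod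

/-- The embedding of `V ⊗ V` in `TV`. -/
def mulTwo : V ⊗[k] V →ₗ[k] TensorAlgebra k V :=
  LinearMap.mul' k (TensorAlgebra k V) ∘ₗ
    TensorProduct.map (TensorAlgebra.ι k) (TensorAlgebra.ι k)

/-- The value of `id^{⊗ n} ⊗ c ⊗ id ⊗ ⋯` on a monomial (zero if the monomial is too short for `c` to
act at the places `n`, `n + 1`, counted from `0`). -/
def braidWord : ℕ → List ι → TensorAlgebra k V
  | 0, i :: j :: w => mulTwo (c (e i ⊗ₜ e j)) * word e w
  | n + 1, i :: w => TensorAlgebra.ι k (e i) * braidWord n w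
  | _, _ => 0

/-- The operator `id^{⊗ n} ⊗ c ⊗ id ⊗ ⋯` on `TV`; on `V^{⊗ d}` with `n + 2 ≤ d` it is `c_{n+1}`. -/
def braidAt (n : ℕ) : Module.End k (TensorAlgebra k V) :=
  e.tensorAlgebra.constr k fun w => braidWord e c n w.toList

/-- The product in the symmetric group of a word in the adjacent transpositions. -/
def permOfWord {m : ℕ} (L : List (Fin m)) : Equiv.Perm (Fin (m + 1)) :=
  (L.map fun i => Equiv.swap i.castSucc i.succ).prod

/-- `L` is a reduced (shortest) expression of `σ` in the adjacent transpositions. -/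
def IsReducedWord {m : ℕ} (σ : Equiv.Perm (Fin (m + 1))) (L : List (Fin m)) : Prop :=
  permOfWord L = σ ∧ ∀ L' : List (Fin m), permOfWord L' = σ → L.length ≤ L'.length

theorem exists_reducedWord {m : ℕ} (σ : Equiv.Perm (Fin (m + 1))) :
    ∃ L, IsReducedWord σ L := by
  classical
  have h : ∃ n, ∃ L : List (Fin m), permOfWord L = σ ∧ L.length = n := by
    have hσ : σ ∈ Submonoid.closure (Set.range fun i : Fin m => Equiv.swap i.castSucc i.succ) := by
      rw [Equiv.Perm.mclosure_swap_castSucc_succ]; trivial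
    suffices ∃ L : List (Fin m), permOfWord L = σ from this.elim fun L hL => ⟨_, L, hL, rfl⟩
    induction hσ using Submonoid.closure_induction with
    | mem x hx => obtain ⟨i, rfl⟩ := hx; exact ⟨[i], by simp [permOfWord]⟩
    | one => exact ⟨[], rfl⟩
    | mul x y _ _ hx hy =>
      obtain ⟨L, rfl⟩ := hx
      obtain ⟨L', rfl⟩ := hy
      exact ⟨L ++ L', by simp [permOfWord]⟩
  obtain ⟨L, hL, hlen⟩ := Nat.find_spec h
  exact ⟨L, hL, fun L' hL' => hlen ▸ Nat.find_min' h ⟨L', hL', rfl⟩⟩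

/-- A reduced expression of `σ`. By Matsumoto's theorem its image in the braid group does not depend
on the choice. -/
def reducedWord {m : ℕ} (σ : Equiv.Perm (Fin (m + 1))) : List (Fin m) :=
  (exists_reducedWord σ).choose

/-- The quantum symmetrizer `QS_{m+1} = ∑_σ ρ(M(σ))` on `V^{⊗ (m+1)} ⊆ TV`, where `M` is the Matsumoto
section. -/
def symmetrizer (m : ℕ) : Module.End k (TensorAlgebra k V) :=
  ∑ σ : Equiv.Perm (Fin (m + 1)), ((reducedWord σ).map fun i : Fin m => braidAt e c (i : ℕ)).prod

/-- The elements of the kernels of the `QS_n` on `V^{⊗ n}` are set to zero; `QS_1` is the identity. -/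
inductive NicholsRel : TensorAlgebra k V → TensorAlgebra k V → Prop
  | mk (m : ℕ) (f : TensorAlgebra k V)
      (hf : f ∈ LinearMap.range (TensorAlgebra.ι k : V →ₗ[k] TensorAlgebra k V) ^ (m + 1))
      (h : symmetrizer e c m f = 0) : NicholsRel f 0

/-- The Nichols algebra `B(V,c)`: the quotient of `TV` by the ideal of the kernels of the quantum
symmetrizers. -/
def Nichols : Type _ := RingQuot (NicholsRel e c)

instance : Ring (Nichols e c) := inferInstanceAs (Ring (RingQuot _))
instance : Algebra k (Nichols e c) := inferInstanceAs (Algebra k (RingQuot _))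

end Symmetrizer

namespace Nichols

/-- The quotient map `TV → B(V,c)`. -/
def mk : TensorAlgebra k V →ₐ[k] Nichols e c := RingQuot.mkAlgHom k (NicholsRel e c)

/-- The map `V → B(V,c)`. -/
def of : V →ₗ[k] Nichols e c := (mk e c).toLinearMap ∘ₗ TensorAlgebra.ι k

/-- The component of degree `n` of `B(V,c)`, spanned by the products of `n` elements of `V`. -/
def degree (n : ℕ) : Submodule k (Nichols e c) := LinearMap.range (of e c) ^ n

theorem algHom_ext {B : Type*} [Semiring B] [Algebra k B] {f g : Nichols e c →ₐ[k] B}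
    (h : ∀ i, f (of e c (e i)) = g (of e c (e i))) : f = g := by
  refine RingQuot.ringQuot_ext' _ f g (TensorAlgebra.hom_ext (e.ext fun i => ?_))
  exact h i

end Nichols

section Coaction

theorem tensorAlgebra_apply (w : List ι) : e.tensorAlgebra (FreeMonoid.ofList w) = word e w := by
  rw [Basis.tensorAlgebra, Basis.map_apply]
  have h : FreeAlgebra.basisFreeMonoid k ι (FreeMonoid.ofList w) =
      (w.map (FreeAlgebra.ι k)).prod := by
    have h1 : FreeAlgebra.equivMonoidAlgebraFreeMonoid.toAlgHom
        (w.map (FreeAlgebra.ι k)).prod = MonoidAlgebra.single (FreeMonoid.ofList w) 1 := by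
      induction w with
      | nil => simp; rfl
      | cons i w ih =>
        rw [List.map_cons, List.prod_cons, map_mul, ih]
        simp [FreeAlgebra.equivMonoidAlgebraFreeMonoid, FreeMonoid.ofList_cons]
    simp only [FreeAlgebra.basisFreeMonoid, Basis.map_apply]
    rw [LinearEquiv.symm_apply_eq]
    change _ = MonoidAlgebra.coeffLinearEquiv k
      (FreeAlgebra.equivMonoidAlgebraFreeMonoid.toAlgHom (w.map (FreeAlgebra.ι k)).prod)
    rw [h1]
    simp
  rw [h]
  have h2 := map_list_prod (TensorAlgebra.equivFreeAlgebra e).symm (w.map (FreeAlgebra.ι k))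
  refine h2.trans ?_
  simp [word, Function.comp_def]

theorem braidAt_word (n : ℕ) (w : List ι) : braidAt e c n (word e w) = braidWord e c n w := by
  rw [← tensorAlgebra_apply, braidAt, Basis.constr_basis, FreeMonoid.toList_ofList]

theorem linear_ext {M : Type*} [AddCommGroup M] [Module k M] {f g : TensorAlgebra k V →ₗ[k] M}
    (h : ∀ w, f (word e w) = g (word e w)) : f = g :=
  e.tensorAlgebra.ext fun w => by
    have := h w.toList
    rwa [← tensorAlgebra_apply, FreeMonoid.ofList_toList] at this

theorem braidAt_succ (n : ℕ) (i : ι) (x : TensorAlgebra k V) :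
    braidAt e c (n + 1) (TensorAlgebra.ι k (e i) * x) =
      TensorAlgebra.ι k (e i) * braidAt e c n x := by
  have : braidAt e c (n + 1) ∘ₗ LinearMap.mulLeft k (TensorAlgebra.ι k (e i)) =
      LinearMap.mulLeft k (TensorAlgebra.ι k (e i)) ∘ₗ braidAt e c n := by
    refine linear_ext e fun w => ?_
    have h : TensorAlgebra.ι k (e i) * word e w = word e (i :: w) := by simp [word]
    simp only [LinearMap.comp_apply, LinearMap.mulLeft_apply, h, braidAt_word, braidWord]
  exact LinearMap.congr_fun this x

theorem braidAt_zero (i j : ι) (x : TensorAlgebra k V) :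
    braidAt e c 0 (TensorAlgebra.ι k (e i) * (TensorAlgebra.ι k (e j) * x)) =
      mulTwo (c (e i ⊗ₜ e j)) * x := by
  have : braidAt e c 0 ∘ₗ LinearMap.mulLeft k (TensorAlgebra.ι k (e i)) ∘ₗ
      LinearMap.mulLeft k (TensorAlgebra.ι k (e j)) =
      LinearMap.mulLeft k (mulTwo (c (e i ⊗ₜ e j))) := by
    refine linear_ext e fun w => ?_
    have h : TensorAlgebra.ι k (e i) * (TensorAlgebra.ι k (e j) * word e w) =
      word e (i :: j :: w) := by simp [word]
    simp only [LinearMap.comp_apply, LinearMap.mulLeft_apply, h, braidAt_word, braidWord]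
  exact LinearMap.congr_fun this x

variable [Fintype ι]

/-- The algebra map `TV → A(c) ⊗ TV` with `x_i ↦ ∑_j t_i^j ⊗ x_j`. -/
def freeCoaction : TensorAlgebra k V →ₐ[k] FRT (coef e c) ⊗[k] TensorAlgebra k V :=
  TensorAlgebra.lift k (e.constr k fun i =>
    ∑ j, FRT.t (coef e c) i j ⊗ₜ[k] TensorAlgebra.ι k (e j))

theorem freeCoaction_ι (i : ι) : freeCoaction e c (TensorAlgebra.ι k (e i)) =
    ∑ j, FRT.t (coef e c) i j ⊗ₜ[k] TensorAlgebra.ι k (e j) := by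
  rw [freeCoaction, TensorAlgebra.lift_ι_apply, Basis.constr_basis]

theorem sum_comm₄ {M : Type*} [AddCommMonoid M] (F : ι → ι → ι → ι → M) :
    ∑ p, ∑ q, ∑ r, ∑ s, F p q r s = ∑ r, ∑ s, ∑ p, ∑ q, F p q r s := by
  rw [Finset.sum_congr rfl fun p _ => Finset.sum_comm, Finset.sum_comm]
  refine Finset.sum_congr rfl fun r _ => ?_
  rw [Finset.sum_congr rfl fun p _ => Finset.sum_comm, Finset.sum_comm]

theorem freeCoaction_braidWord (n : ℕ) (w : List ι) :
    freeCoaction e c (braidWord e c n w) =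
      (braidAt e c n).lTensor _ (freeCoaction e c (word e w)) := by
  induction n generalizing w with
  | zero =>
    match w with
    | [] =>
      have h : braidAt e c 0 1 = 0 := by
        have := braidAt_word e c 0 []
        simpa [word, braidWord] using this
      simp [braidWord, word, Algebra.TensorProduct.one_def, h]
    | [i] =>
      have h : ∀ j, braidAt e c 0 (TensorAlgebra.ι k (e j)) = 0 := fun j => by
        have := braidAt_word e c 0 [j]
        simpa [word, braidWord] using this
      simp [braidWord, word, freeCoaction_ι, h]
    | i :: j :: w =>
      have h1 : word e (i :: j :: w) =
          TensorAlgebra.ι k (e i) * (TensorAlgebra.ι k (e j) * word e w) := by simp [word]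
      have h2 : ∀ (a b : FRT (coef e c)) (p q : ι) (X : FRT (coef e c) ⊗[k] TensorAlgebra k V),
          (braidAt e c 0).lTensor _ ((a ⊗ₜ TensorAlgebra.ι k (e p)) *
            ((b ⊗ₜ TensorAlgebra.ι k (e q)) * X)) =
          ((a * b) ⊗ₜ mulTwo (c (e p ⊗ₜ e q))) * X := by
        intro a b p q X
        induction X with
        | zero => simp
        | add x y hx hy => simp only [mul_add, map_add, hx, hy]
        | tmul x y => simp [braidAt_zero, mul_assoc]
      rw [h1, map_mul (freeCoaction e c), map_mul (freeCoaction e c), freeCoaction_ι,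
        freeCoaction_ι]
      simp only [Finset.sum_mul, Finset.mul_sum, map_sum, h2]
      rw [← Finset.sum_comm]
      simp only [← Finset.sum_mul]
      rw [braidWord, map_mul]
      congr 1
      have h3 : ∀ p q, mulTwo (c (e p ⊗ₜ e q)) = ∑ r, ∑ s, coef e c p q r s •
          (TensorAlgebra.ι k (e r) * TensorAlgebra.ι k (e s)) := fun p q => by
        rw [apply_basis]; simp [mulTwo]
      simp only [h3, map_sum, map_smul, map_mul, freeCoaction_ι, TensorProduct.tmul_sum,
        TensorProduct.tmul_smul, Finset.sum_mul_sum, Algebra.TensorProduct.tmul_mul_tmul,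
        Finset.smul_sum]
      have h4 : ∀ r s : ι, ∑ p, ∑ q, coef e c i j p q •
          ((FRT.t (coef e c) p r * FRT.t (coef e c) q s) ⊗ₜ[k]
            (TensorAlgebra.ι k (e r) * TensorAlgebra.ι k (e s))) =
          ∑ p, ∑ q, coef e c p q r s •
          ((FRT.t (coef e c) i p * FRT.t (coef e c) j q) ⊗ₜ[k]
            (TensorAlgebra.ι k (e r) * TensorAlgebra.ι k (e s))) := fun r s => by
        have := congrArg (· ⊗ₜ[k] (TensorAlgebra.ι k (e r) * TensorAlgebra.ι k (e s)))
          (FRT.rel (coef e c) i j r s)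
        simpa only [TensorProduct.sum_tmul, TensorProduct.smul_tmul'] using this
      exact (sum_comm₄ _).trans ((Finset.sum_congr rfl fun r _ =>
        Finset.sum_congr rfl fun s _ => h4 r s).trans (sum_comm₄ _).symm)
  | succ n ih =>
    match w with
    | [] =>
      have h : braidAt e c (n + 1) 1 = 0 := by
        have := braidAt_word e c (n + 1) []
        simpa [word, braidWord] using this
      simp [braidWord, word, Algebra.TensorProduct.one_def, h]
    | i :: w =>
      have h1 : word e (i :: w) = TensorAlgebra.ι k (e i) * word e w := by simp [word]
      have h2 : ∀ (a : FRT (coef e c)) (p : ι) (X : FRT (coef e c) ⊗[k] TensorAlgebra k V),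
          (braidAt e c (n + 1)).lTensor _ ((a ⊗ₜ TensorAlgebra.ι k (e p)) * X) =
          (a ⊗ₜ TensorAlgebra.ι k (e p)) * (braidAt e c n).lTensor _ X := by
        intro a p X
        induction X with
        | zero => simp
        | add x y hx hy => simp only [mul_add, map_add, hx, hy]
        | tmul x y => simp [braidAt_succ]
      rw [h1, map_mul (freeCoaction e c), freeCoaction_ι, braidWord, map_mul, ih, freeCoaction_ι]
      simp only [Finset.sum_mul, map_sum, h2]

theorem freeCoaction_braidAt (n : ℕ) (x : TensorAlgebra k V) :
    freeCoaction e c (braidAt e c n x) = (braidAt e c n).lTensor _ (freeCoaction e c x) := by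
  have : (freeCoaction e c).toLinearMap ∘ₗ braidAt e c n =
      (braidAt e c n).lTensor _ ∘ₗ (freeCoaction e c).toLinearMap :=
    linear_ext e fun w => by
      simpa [braidAt_word] using freeCoaction_braidWord e c n w
  exact LinearMap.congr_fun this x

theorem freeCoaction_symmetrizer (m : ℕ) (x : TensorAlgebra k V) :
    freeCoaction e c (symmetrizer e c m x) =
      (symmetrizer e c m).lTensor _ (freeCoaction e c x) := by
  have h : ∀ (L : List (Fin m)) (x : TensorAlgebra k V),
      freeCoaction e c ((L.map fun i : Fin m => braidAt e c (i : ℕ)).prod x) =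
      ((L.map fun i : Fin m => braidAt e c (i : ℕ)).prod).lTensor _ (freeCoaction e c x) := by
    intro L
    induction L with
    | nil => intro x; simp [Module.End.one_eq_id]
    | cons i L ih =>
      intro x
      rw [List.map_cons, List.prod_cons, Module.End.mul_apply, freeCoaction_braidAt, ih,
        Module.End.mul_eq_comp (braidAt e c (i : ℕ)),
        LinearMap.lTensor_comp, LinearMap.comp_apply]
  simp only [symmetrizer, LinearMap.sum_apply, map_sum, h]
  rw [← LinearMap.sum_apply]
  congr 1
  exact (map_sum (LinearMap.lTensorHom (R := k) (FRT (coef e c))) _ _).symm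

/-- The map `φ ⊗ id : A ⊗ M → M` for a linear form `φ` on `A`. -/
def slice {A M : Type*} [AddCommGroup A] [Module k A] [AddCommGroup M] [Module k M]
    (φ : Dual k A) : A ⊗[k] M →ₗ[k] M := (TensorProduct.lid k M).toLinearMap ∘ₗ φ.rTensor M

theorem slice_tmul {A M : Type*} [AddCommGroup A] [Module k A] [AddCommGroup M] [Module k M]
    (φ : Dual k A) (a : A) (m : M) : slice φ (a ⊗ₜ[k] m) = φ a • m := by simp [slice]

theorem slice_lTensor {A M N : Type*} [AddCommGroup A] [Module k A] [AddCommGroup M] [Module k M]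
    [AddCommGroup N] [Module k N] (φ : Dual k A) (f : M →ₗ[k] N) (x : A ⊗[k] M) :
    slice φ (f.lTensor A x) = f (slice φ x) := by
  induction x with
  | zero => simp
  | add x y hx hy => simp only [map_add, hx, hy]
  | tmul a m => simp [slice_tmul]

theorem eq_zero_of_slice {A M : Type*} [AddCommGroup A] [Module k A] [AddCommGroup M] [Module k M]
    (x : A ⊗[k] M) (h : ∀ φ : Dual k A, slice φ x = 0) : x = 0 := by
  let b := Basis.ofVectorSpace k A
  classical
  refine (TensorProduct.equivFinsuppOfBasisLeft b (N := M)).injective ?_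
  rw [map_zero]
  ext i
  have := h (b.coord i)
  simpa [TensorProduct.equivFinsuppOfBasisLeft_apply, slice] using this

theorem slice_freeCoaction_mem (n : ℕ) (f : TensorAlgebra k V)
    (hf : f ∈ LinearMap.range (TensorAlgebra.ι k : V →ₗ[k] TensorAlgebra k V) ^ n)
    (φ : Dual k (FRT (coef e c))) : slice φ (freeCoaction e c f) ∈
      LinearMap.range (TensorAlgebra.ι k : V →ₗ[k] TensorAlgebra k V) ^ n := by
  induction hf using Submodule.pow_induction_on_left' generalizing φ with
  | algebraMap r =>
    rw [AlgHom.commutes, Algebra.algebraMap_eq_smul_one, Algebra.TensorProduct.one_def,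
      map_smul, slice_tmul, pow_zero]
    exact Submodule.smul_mem _ _ (Submodule.smul_mem _ _ (Submodule.one_le.mp le_rfl))
  | add x y i hx hy ihx ihy => rw [map_add, map_add]; exact add_mem (ihx φ) (ihy φ)
  | mem_mul m hm i x hx ih =>
    obtain ⟨v, rfl⟩ := hm
    have h2 : ∀ (a : FRT (coef e c)) (j : ι) (X : FRT (coef e c) ⊗[k] TensorAlgebra k V),
        slice φ ((a ⊗ₜ TensorAlgebra.ι k (e j)) * X) =
        TensorAlgebra.ι k (e j) * slice (φ ∘ₗ LinearMap.mulLeft k a) X := by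
      intro a j X
      induction X with
      | zero => simp
      | add x y hx hy => simp only [mul_add, map_add, hx, hy]
      | tmul x y => simp [slice_tmul]
    rw [← e.sum_repr v]
    simp only [map_sum, map_smul, map_mul, Finset.sum_mul, smul_mul_assoc, freeCoaction_ι, h2]
    refine Submodule.sum_mem _ fun j _ => Submodule.smul_mem _ _ (Submodule.sum_mem _ fun p _ => ?_)
    rw [pow_succ']
    exact Submodule.mul_mem_mul ⟨_, rfl⟩ (ih _)

namespace Nichols

/-- The left `A(c)`-coaction on `B(V,c)`: the algebra map with `x_i ↦ ∑_j t_i^j ⊗ x_j`. -/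
def coaction : Nichols e c →ₐ[k] FRT (coef e c) ⊗[k] Nichols e c :=
  RingQuot.liftAlgHom k ⟨(Algebra.TensorProduct.map (.id k _) (mk e c)).comp (freeCoaction e c), by
    rintro f _ ⟨m, _, hf, h⟩
    rw [map_zero]
    refine eq_zero_of_slice _ fun φ => ?_
    have h1 : slice φ (Algebra.TensorProduct.map (.id k _) (mk e c) (freeCoaction e c f)) =
        mk e c (slice φ (freeCoaction e c f)) :=
      slice_lTensor φ (mk e c).toLinearMap (freeCoaction e c f)
    refine h1.trans ?_
    have h2 : symmetrizer e c m (slice φ (freeCoaction e c f)) = 0 := by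
      rw [← slice_lTensor, ← freeCoaction_symmetrizer, h, map_zero, map_zero]
    exact (RingQuot.mkAlgHom_rel k (NicholsRel.mk m _
      (slice_freeCoaction_mem e c _ f hf φ) h2)).trans (map_zero _)⟩

theorem coaction_of (i : ι) : coaction e c (of e c (e i)) =
    ∑ j, FRT.t (coef e c) i j ⊗ₜ[k] of e c (e j) := by
  simp only [coaction, of, mk, LinearMap.comp_apply]
  erw [RingQuot.liftAlgHom_mkAlgHom_apply]
  simp only [AlgHom.comp_apply, freeCoaction_ι, map_sum]
  rfl

variable [DecidableEq ι]

theorem isCoaction : IsCoaction (coaction e c).toLinearMap where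
  coassoc := by
    have : (Algebra.TensorProduct.assoc k k k _ _ _).toAlgHom.comp
        ((Algebra.TensorProduct.map (Bialgebra.comulAlgHom k (FRT (coef e c)))
          (.id k (Nichols e c))).comp (coaction e c)) =
        (Algebra.TensorProduct.map (.id k _) (coaction e c)).comp (coaction e c) := by
      refine algHom_ext e c fun i => ?_
      simp only [AlgHom.comp_apply, coaction_of, map_sum, Algebra.TensorProduct.map_tmul,
        Bialgebra.comulAlgHom_apply, FRT.comul_t, AlgHom.id_apply, TensorProduct.sum_tmul,
        TensorProduct.tmul_sum]
      rw [Finset.sum_comm]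
      rfl
    exact congrArg AlgHom.toLinearMap this
  counit := by
    have : (Algebra.TensorProduct.lid k _).toAlgHom.comp
        ((Algebra.TensorProduct.map (Bialgebra.counitAlgHom k (FRT (coef e c)))
          (.id k (Nichols e c))).comp (coaction e c)) = .id k _ := by
      refine algHom_ext e c fun i => ?_
      simp [coaction_of, FRT.counit_t]
    exact congrArg AlgHom.toLinearMap this

end Nichols

theorem IsCoaction.isGroupLikeElem {H M : Type*} [Ring H] [Bialgebra k H] [AddCommGroup M]
    [Module k M] {l : M →ₗ[k] H ⊗[k] M} (hl : IsCoaction l) {b : M} (hb : b ≠ 0) {D : H}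
    (h : l b = D ⊗ₜ b) : IsGroupLikeElem k D := by
  obtain ⟨φ, hφ⟩ : ∃ φ : Dual k M, φ b = 1 := by
    have h1 : ¬ ∀ φ : Dual k M, φ b = 0 := fun h' =>
      hb ((Module.forall_dual_apply_eq_zero_iff k b).mp h')
    push Not at h1
    obtain ⟨φ, hφ⟩ := h1
    exact ⟨(φ b)⁻¹ • φ, by simp [hφ]⟩
  constructor
  · have := congrArg φ (LinearMap.congr_fun hl.counit b)
    simpa [h, hφ] using this
  · have h1 := congrArg (fun z => TensorProduct.rid k (H ⊗[k] H) ((φ.lTensor (H ⊗[k] H))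
      ((TensorProduct.assoc k H H M).symm z))) (LinearMap.congr_fun hl.coassoc b)
    simpa [h, hφ] using h1

end Coaction
end Nichols

section VolumeElement

variable {k : Type*} [Field k] {V : Type*} [AddCommGroup V] [Module k V]
  {ι : Type*} [Fintype ι] [DecidableEq ι] (e : Basis ι k V) (c : V ⊗[k] V ≃ₗ[k] V ⊗[k] V)

/-- A choice of volume element for the finite-dimensional Nichols algebra `B = B(V,c)`, together
with the elements of `A(c)` that it determines:
* `top` is the largest degree with `B^top ≠ 0`, and `b` spans the line `B^top`;
* `D` is the quantum determinant, `λ(b) = D ⊗ b`;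
* `ω` is the basis of `B^(top-1)` with `x_i ω^j = δ_i^j b`
  (`B^(top-1)` is zero if `top = 0`, that is, if `V = 0`);
* `T i j` is the element `T_i^j` in `λ(ω^j) = ∑_i T_i^j ⊗ ω^i`. -/
structure VolumeData where
  top : ℕ
  degree_eq_bot : ∀ m, top < m → Nichols.degree e c m = ⊥
  b : Nichols e c
  b_ne_zero : b ≠ 0
  degree_top : Nichols.degree e c top = Submodule.span k {b}
  D : FRT (coef e c)
  coaction_b : Nichols.coaction e c b = D ⊗ₜ b
  ω : ι → Nichols e c
  span_ω : Submodule.span k (Set.range ω) = ⨆ (m : ℕ) (_ : m + 1 = top), Nichols.degree e c m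
  mul_ω : ∀ i j, Nichols.of e c (e i) * ω j = if i = j then b else 0
  T : ι → ι → FRT (coef e c)
  coaction_ω : ∀ j, Nichols.coaction e c (ω j) = ∑ i, T i j ⊗ₜ[k] ω i

namespace VolumeData

variable {e c}

/-- The quantum determinant as a group-like element of `A(c)`. -/
def det (F : VolumeData e c) : GroupLike k (FRT (coef e c)) :=
  ⟨F.D, (Nichols.isCoaction e c).isGroupLikeElem F.b_ne_zero F.coaction_b⟩

/-- The bialgebra `H(c) = A(c)[D⁻¹]`. -/
abbrev H (F : VolumeData e c) : Type _ := Loc F.det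

/-- The canonical map `A(c) → H(c)`. -/
abbrev toH (F : VolumeData e c) : FRT (coef e c) →ₐ[k] F.H := Loc.of F.det

/-- The left `H(c)`-coaction on the Nichols algebra: the `A(c)`-coaction followed by the canonical
map `A(c) → H(c)`. -/
def coaction (F : VolumeData e c) : Nichols e c →ₗ[k] F.H ⊗[k] Nichols e c :=
  F.toH.toLinearMap.rTensor (Nichols e c) ∘ₗ (Nichols.coaction e c).toLinearMap

end VolumeData
end VolumeElement

end
end NicholsFRT

open NicholsFRT

/-! The Nichols algebra B is studied through skew derivations. By Matsumoto's theorem and the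
decomposition of a symmetric group into cosets of the permutations that fix the first place, the
quantum symmetrizers satisfy QS(y) = ∑_p x_p QS(∂_p y), where ∂_p(y) is the coefficient of x_p after
each letter of y in turn has been braided to the front (`symmetrizer_succ`). Hence the kernels of
the symmetrizers are cut out by the functionals ε∂_{p_r}⋯∂_{p_1} (`symmetrizer_eq_zero_iff`). The
common kernel of these functionals is a two-sided ideal: ∂_p(x_i y) involves only y and its
derivatives, and ∂_p(y x_i) is ∂_p(y) x_i plus the term r(t_i^p, y₋₁) y₀. So it is exactly the
kernel of TV → B (`mk_eq_zero_iff`), the ∂_p act on B, and the functionals separate the points of B.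

Volume element. Rigidity expresses x_a ∂_l as a linear combination of the ∂_p x_i and the identity.
So if a nonzero homogeneous y is killed on the left by all x_i, then the span of its iterated
derivatives is a left ideal; it contains 1, hence is B (`derivSpan_eq_top`). Comparing degrees, B
vanishes above the degree of y and is the line of y in that degree. For y of top degree this gives
the line B^top. It also shows that no nonzero element of B^(top-1) is killed by all x_i, so that y ↦
(x_i y)_i is injective on B^(top-1). This map is onto as well: the v in V with v B^(top-1) = 0 are
stable under the operators v ↦ r(t_l^p, v₋₁) v₀, and then applying ∂_p to v𝔟 = 0 gives v = 0
(`eq_zero_of_lin_mul_eq_zero`).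

The form. The bialgebras of c and of c⁻¹ have the same relations, and the universal form of c⁻¹ with
its arguments exchanged is the convolution inverse of r (`isInvPairing_universalForm`). The
assignment b ↦ r(-, b) is an antihomomorphism to the dual algebra in which r(-, D) is invertible, so
it extends to the localization by the universal property. The situation is symmetric in r and its
inverse, so the other argument extends in the same way (`IsInvPairing.exists_extension`). In each
axiom, the elements for which an identity holds form a subalgebra; it is therefore enough to treat
generators and D⁻¹. Uniqueness of r_H is uniqueness in the universal property.

The Hopf structure. In the braided square of B, left multiplication by x_i ⊗ 1 + 1 ⊗ x_i has the
same commutation rule with ∂_p ⊗ id as multiplication by x_i has with ∂_p. So the map TV → B ⊗ B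
that makes the x_i primitive intertwines ∂_p with ∂_p ⊗ id. Testing with the functionals shows that
it factors through B and is coassociative (`freeComul_eq_zero`, `coassoc_comulMap`). Colinearity
follows from the quasicommutativity of r. The antipode is the Neumann series of the identity in the
convolution algebra, which is finite because B has finitely many degrees, and which is colinear term
by term. -/

namespace NicholsFRT

noncomputable section

/-! ### Matsumoto's theorem and the factorization of the sum over a symmetric group -/

section Matsumoto

/-- The braid relations for a sequence of elements of a monoid. -/
structure BraidRel {M : Type*} [Monoid M] (b : ℕ → M) : Prop where
  braid : ∀ i, b i * b (i + 1) * b i = b (i + 1) * b i * b (i + 1)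
  comm : ∀ i j, i + 2 ≤ j → b i * b j = b j * b i

/-- The value of a word in the generators. -/
def evalWord {M : Type*} [Monoid M] (b : ℕ → M) {m : ℕ} (L : List (Fin m)) : M :=
  (L.map fun i : Fin m => b i).prod

/-- The product `b₀ ⋯ b_{j-1}`. -/
def prefixProd {M : Type*} [Monoid M] (b : ℕ → M) (j : ℕ) : M := ((List.range j).map b).prod

section Monoid

variable {M : Type*} [Monoid M] {b : ℕ → M}

theorem BraidRel.succ (hb : BraidRel b) : BraidRel fun i => b (i + 1) :=
  ⟨fun i => hb.braid (i + 1), fun i j h => hb.comm (i + 1) (j + 1) (by omega)⟩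

theorem evalWord_append {m : ℕ} (L L' : List (Fin m)) :
    evalWord b (L ++ L') = evalWord b L * evalWord b L' := by
  simp [evalWord]

theorem evalWord_map_succ {m : ℕ} (L : List (Fin m)) :
    evalWord b (L.map Fin.succ) = evalWord (fun i => b (i + 1)) L := by
  simp [evalWord, Function.comp_def]

theorem evalWord_take {m j : ℕ} (h : j ≤ m) :
    evalWord b ((List.finRange m).take j) = prefixProd b j := by
  have h1 : ((List.finRange m).take j).map (fun i : Fin m => (i : ℕ)) = List.range j := by
    rw [List.map_take, List.map_coe_finRange_eq_range, List.take_range, min_eq_left h]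
  rw [prefixProd, ← h1, List.map_map]
  rfl

theorem prefixProd_succ (j : ℕ) : prefixProd b (j + 1) = prefixProd b j * b j := by
  simp [prefixProd, List.range_succ]

theorem prefixProd_succ' (j : ℕ) :
    prefixProd b (j + 1) = b 0 * prefixProd (fun i => b (i + 1)) j := by
  simp [prefixProd, List.range_succ_eq_map, Function.comp_def]

theorem BraidRel.prefixProd_mul_of_lt (hb : BraidRel b) {i j : ℕ} (h : j < i) :
    prefixProd b j * b i = b i * prefixProd b j := by
  induction j with
  | zero => simp [prefixProd]
  | succ j ih =>
    rw [prefixProd_succ, mul_assoc, hb.comm j i (by omega), ← mul_assoc, ih (by omega), mul_assoc]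

/-- The prefix represents a cycle, and conjugation by it raises the index. The braid relation is
needed once, where b_i meets the factors b_i b_{i+1}; all other factors commute past. -/
theorem BraidRel.prefixProd_mul_of_gt (hb : BraidRel b) {i j : ℕ} (h : i + 1 < j) :
    prefixProd b j * b i = b (i + 1) * prefixProd b j := by
  induction j with
  | zero => omega
  | succ j ih =>
    rcases Nat.lt_or_ge (i + 1) j with h1 | h1
    · rw [prefixProd_succ, mul_assoc, ← hb.comm i j (by omega), ← mul_assoc, ih h1, mul_assoc]
    -- Here the prefix ends in b_i b_{i+1}. The braid relation turns b_i b_{i+1} b_i into b_{i+1}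
    -- b_i b_{i+1}, and the first of these commutes with the shorter prefix.
    · obtain rfl : j = i + 1 := by omega
      rw [prefixProd_succ, prefixProd_succ, mul_assoc, mul_assoc, ← mul_assoc (b i), hb.braid,
        mul_assoc (b (i + 1)), ← mul_assoc, hb.prefixProd_mul_of_lt (by omega)]
      simp only [mul_assoc]

end Monoid

/-- The permutation that fixes `0` and acts as `τ` on the successors. -/
def shiftPerm {n : ℕ} (τ : Equiv.Perm (Fin n)) : Equiv.Perm (Fin (n + 1)) :=
  Equiv.Perm.decomposeFin.symm (0, τ)

@[simp] theorem shiftPerm_zero {n : ℕ} (τ : Equiv.Perm (Fin n)) : shiftPerm τ 0 = 0 := by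
  simp [shiftPerm]

@[simp] theorem shiftPerm_succ {n : ℕ} (τ : Equiv.Perm (Fin n)) (a : Fin n) :
    shiftPerm τ a.succ = (τ a).succ := by
  simp [shiftPerm]

theorem shiftPerm_injective (n : ℕ) : Function.Injective (shiftPerm (n := n)) := fun σ τ h =>
  Equiv.ext fun a => Fin.succ_injective _ (by
    rw [← shiftPerm_succ, h, shiftPerm_succ])

/-- A permutation, given by the preimage of `0` and a permutation of the remaining places. -/
def insertPerm {n : ℕ} (x : Fin (n + 1) × Equiv.Perm (Fin n)) : Equiv.Perm (Fin (n + 1)) :=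
  shiftPerm x.2 * Fin.cycleRange x.1

theorem insertPerm_self {n : ℕ} (j : Fin (n + 1)) (τ : Equiv.Perm (Fin n)) :
    insertPerm (j, τ) j = 0 := by
  simp [insertPerm]

theorem insertPerm_succAbove {n : ℕ} (j : Fin (n + 1)) (τ : Equiv.Perm (Fin n)) (a : Fin n) :
    insertPerm (j, τ) (j.succAbove a) = (τ a).succ := by
  simp [insertPerm, Fin.cycleRange_succAbove]

/-- The place is recovered as the preimage of 0, and then the other permutation by cancellation.
Injectivity and the count (n+1)! = (n+1)·n! are enough. -/
theorem insertPerm_bijective (n : ℕ) : Function.Bijective (insertPerm (n := n)) := by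
  rw [Fintype.bijective_iff_injective_and_card]
  constructor
  · rintro ⟨j, τ⟩ ⟨j', τ'⟩ h
    have h1 : j = j' := by
      apply (insertPerm (j, τ)).injective
      rw [insertPerm_self, h, insertPerm_self]
    subst h1
    have h2 : shiftPerm τ = shiftPerm τ' := mul_right_cancel (b := Fin.cycleRange j) h
    rw [shiftPerm_injective n h2]
  · simp [Fintype.card_perm, Nat.factorial_succ]

/-- Permutations of `n + 1` places as pairs of a place and a permutation of `n` places. -/
def insertEquiv (n : ℕ) : Fin (n + 1) × Equiv.Perm (Fin n) ≃ Equiv.Perm (Fin (n + 1)) :=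
  Equiv.ofBijective insertPerm (insertPerm_bijective n)

theorem insertEquiv_symm {n : ℕ} {σ : Equiv.Perm (Fin (n + 1))} {j : Fin (n + 1)}
    {τ : Equiv.Perm (Fin n)} (h0 : σ j = 0) (h : ∀ a, σ (j.succAbove a) = (τ a).succ) :
    (insertEquiv n).symm σ = (j, τ) := by
  rw [Equiv.symm_apply_eq]
  ext x
  rcases Fin.eq_self_or_eq_succAbove j x with rfl | ⟨a, rfl⟩
  · rw [h0]; exact congrArg Fin.val (insertPerm_self x τ).symm
  · rw [h]; exact congrArg Fin.val (insertPerm_succAbove j τ a).symm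

theorem val_swap_castSucc_succ {n : ℕ} (i : Fin n) (x : Fin (n + 1)) :
    (Equiv.swap i.castSucc i.succ x : ℕ) =
      if (x : ℕ) = i then (i : ℕ) + 1 else if (x : ℕ) = i + 1 then (i : ℕ) else x := by
  rw [Equiv.swap_apply_def]
  simp only [Fin.ext_iff, Fin.val_castSucc, Fin.val_succ]
  split_ifs <;> simp

theorem val_succAbove {n : ℕ} (j : Fin (n + 1)) (a : Fin n) :
    (j.succAbove a : ℕ) = if (a : ℕ) < j then (a : ℕ) else a + 1 := by
  rw [Fin.succAbove]
  simp only [Fin.lt_def, Fin.val_castSucc]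
  split_ifs <;> simp

/-- A normal form for permutations as words in the adjacent transpositions. -/
def normalWord : (m : ℕ) → Equiv.Perm (Fin (m + 1)) → List (Fin m)
  | 0, _ => []
  | m + 1, σ => (normalWord m ((insertEquiv (m + 1)).symm σ).2).map Fin.succ ++
      (List.finRange (m + 1)).take ((insertEquiv (m + 1)).symm σ).1

section Monoid

variable {M : Type*} [Monoid M] {b : ℕ → M}

theorem evalWord_normalWord_succ (b : ℕ → M) {m : ℕ} {σ : Equiv.Perm (Fin (m + 2))} {j : Fin (m + 2)}
    {τ : Equiv.Perm (Fin (m + 1))} (h : (insertEquiv (m + 1)).symm σ = (j, τ)) :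
    evalWord b (normalWord (m + 1) σ) =
      evalWord (fun i => b (i + 1)) (normalWord m τ) * prefixProd b j := by
  rw [normalWord, evalWord_append, evalWord_map_succ, h, evalWord_take (by omega)]

/-- Let j be the place that σ sends to 0. If j = i, the new letter extends the prefix b₀⋯b_{j-1}.
The case j = i+1 is excluded by the ascent. Otherwise b_i is moved to the left through the prefix,
with its index raised by one if i+1 < j and unchanged if j < i, and is absorbed into the permutation
of the remaining places by induction. -/
theorem BraidRel.evalWord_normalWord_mul_swap (hb : BraidRel b) {m : ℕ}
    (σ : Equiv.Perm (Fin (m + 1))) (i : Fin m) (h : σ i.castSucc < σ i.succ) :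
    evalWord b (normalWord m (σ * Equiv.swap i.castSucc i.succ)) =
      evalWord b (normalWord m σ) * b i := by
  induction m generalizing b with
  | zero => exact i.elim0
  | succ m ih =>
    obtain ⟨⟨j, τ⟩, rfl⟩ := (insertEquiv (m + 1)).surjective σ
    change insertPerm (j, τ) _ < insertPerm (j, τ) _ at h
    have e0 := evalWord_normalWord_succ b ((insertEquiv (m + 1)).symm_apply_apply (j, τ))
    -- If the swap does not touch the place sent to 0, that place stays the same and only the
    -- permutation of the remaining places is multiplied by a swap.
    have key : ∀ (i' : Fin m), (∀ a : Fin (m + 1), Equiv.swap i.castSucc i.succ (j.succAbove a) =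
        j.succAbove (Equiv.swap i'.castSucc i'.succ a)) → j ≠ i.castSucc → j ≠ i.succ →
        (insertEquiv (m + 1)).symm (insertEquiv (m + 1) (j, τ) * Equiv.swap i.castSucc i.succ) =
          (j, τ * Equiv.swap i'.castSucc i'.succ) := by
      intro i' hi' h1 h2
      refine insertEquiv_symm ?_ fun a => ?_
      · rw [Equiv.Perm.mul_apply, Equiv.swap_apply_of_ne_of_ne h1 h2]
        exact insertPerm_self j τ
      · rw [Equiv.Perm.mul_apply, hi']
        exact insertPerm_succAbove j τ _
    rcases lt_trichotomy (i : ℕ) j with hij | hij | hij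
    · rcases Nat.lt_or_ge (i + 1) j with hij' | hij'
      · have him : (i : ℕ) < m := by omega
        obtain ⟨i', rfl⟩ : ∃ i' : Fin m, i'.castSucc = i := ⟨⟨i, him⟩, rfl⟩
        have hs : ∀ a : Fin (m + 1), Equiv.swap i'.castSucc.castSucc i'.castSucc.succ
            (j.succAbove a) = j.succAbove (Equiv.swap i'.castSucc i'.succ a) := by
          intro a
          simp only [Fin.val_castSucc] at hij hij'
          refine Fin.ext ?_
          simp only [val_swap_castSucc_succ, val_succAbove, Fin.val_castSucc]
          split_ifs <;> omega
        rw [evalWord_normalWord_succ b (key i' hs (by simp [Fin.ext_iff]; simp at hij; omega)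
          (by simp [Fin.ext_iff]; simp at hij'; omega)), e0, mul_assoc, Fin.val_castSucc,
          hb.prefixProd_mul_of_gt (by simpa using hij'), ih hb.succ, mul_assoc]
        have h1 : i'.castSucc.castSucc = j.succAbove i'.castSucc := by
          refine Fin.ext ?_
          simp only [val_succAbove, Fin.val_castSucc] at hij hij' ⊢
          split_ifs <;> omega
        have h2 : i'.castSucc.succ = j.succAbove i'.succ := by
          refine Fin.ext ?_
          simp only [val_succAbove, Fin.val_castSucc, Fin.val_succ] at hij hij' ⊢
          split_ifs <;> omega
        rw [h1, h2, insertPerm_succAbove, insertPerm_succAbove] at h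
        simpa using h
      -- The value of σ at i+1 would be 0, which is impossible at an ascent.
      · obtain rfl : j = i.succ := by simp [Fin.ext_iff]; omega
        rw [insertPerm_self] at h
        exact absurd h (Fin.not_lt_zero _)
    · obtain rfl : j = i.castSucc := by simp [Fin.ext_iff]; omega
      have e1 : (insertEquiv (m + 1)).symm
          (insertEquiv (m + 1) (i.castSucc, τ) * Equiv.swap i.castSucc i.succ) = (i.succ, τ) := by
        refine insertEquiv_symm ?_ fun a => ?_
        · rw [Equiv.Perm.mul_apply, Equiv.swap_apply_right]
          exact insertPerm_self _ τ
        · rw [Equiv.Perm.mul_apply]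
          refine Eq.trans (congrArg _ ?_) (insertPerm_succAbove i.castSucc τ a)
          refine Fin.ext ?_
          simp only [val_swap_castSucc_succ, val_succAbove, Fin.val_castSucc, Fin.val_succ]
          split_ifs <;> omega
      rw [evalWord_normalWord_succ b e1, e0, Fin.val_succ, prefixProd_succ, mul_assoc]
      rfl
    · obtain ⟨i', rfl⟩ : ∃ i' : Fin m, i'.succ = i := ⟨⟨i - 1, by omega⟩, by
        simp [Fin.ext_iff]; omega⟩
      have hs : ∀ a : Fin (m + 1), Equiv.swap i'.succ.castSucc i'.succ.succ
          (j.succAbove a) = j.succAbove (Equiv.swap i'.castSucc i'.succ a) := by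
        intro a
        simp only [Fin.val_succ] at hij
        refine Fin.ext ?_
        simp only [val_swap_castSucc_succ, val_succAbove, Fin.val_succ]
        split_ifs <;> omega
      rw [evalWord_normalWord_succ b (key i' hs (by simp [Fin.ext_iff]; simp at hij; omega)
        (by simp [Fin.ext_iff]; simp at hij; omega)), e0, mul_assoc,
        hb.prefixProd_mul_of_lt hij, ih hb.succ, mul_assoc, Fin.val_succ]
      have h1 : i'.succ.castSucc = j.succAbove i'.castSucc := by
        refine Fin.ext ?_
        simp only [val_succAbove, Fin.val_castSucc, Fin.val_succ] at hij ⊢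
        split_ifs <;> omega
      have h2 : i'.succ.succ = j.succAbove i'.succ := by
        refine Fin.ext ?_
        simp only [val_succAbove, Fin.val_succ] at hij ⊢
        split_ifs <;> omega
      rw [h1, h2, insertPerm_succAbove, insertPerm_succAbove] at h
      simpa using h

end Monoid

theorem permOfWord_append {m : ℕ} (L L' : List (Fin m)) :
    permOfWord (L ++ L') = permOfWord L * permOfWord L' := by
  simp [permOfWord]

theorem permOfWord_map_succ {m : ℕ} (L : List (Fin m)) :
    permOfWord (L.map Fin.succ) = shiftPerm (permOfWord L) := by
  induction L with
  | nil =>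
    ext x
    refine Fin.cases ?_ (fun a => ?_) x <;> simp [permOfWord]
  | cons i L ih =>
    have h : permOfWord ((i :: L).map Fin.succ) =
      Equiv.swap i.succ.castSucc i.succ.succ * permOfWord (L.map Fin.succ) := by simp [permOfWord]
    have h' : permOfWord (i :: L) = Equiv.swap i.castSucc i.succ * permOfWord L := by
      simp [permOfWord]
    rw [h, ih, h']
    ext x
    refine Fin.cases ?_ (fun a => ?_) x
    · rw [Equiv.Perm.mul_apply, shiftPerm_zero, shiftPerm_zero, Equiv.swap_apply_of_ne_of_ne]
      · simp [Fin.ext_iff]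
      · simp [Fin.ext_iff]
    · rw [Equiv.Perm.mul_apply, shiftPerm_succ, shiftPerm_succ, Equiv.Perm.mul_apply]
      rw [← Fin.succ_castSucc, (Fin.succ_injective _).swap_apply]

theorem val_cycleRange {n : ℕ} (j x : Fin n) :
    (Fin.cycleRange j x : ℕ) = if (x : ℕ) < j then (x : ℕ) + 1 else if (x : ℕ) = j then 0 else x := by
  have := j.pos
  rcases lt_trichotomy x j with h | rfl | h
  · rw [Fin.coe_cycleRange_of_lt h, if_pos (by omega)]
  · have : NeZero n := ⟨by omega⟩
    simp
  · rw [Fin.cycleRange_of_gt h, if_neg (by omega), if_neg (by omega)]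

theorem permOfWord_take {m : ℕ} (j : ℕ) (hj : j < m + 1) :
    permOfWord ((List.finRange m).take j) = Fin.cycleRange ⟨j, hj⟩ := by
  induction j with
  | zero => simp [permOfWord]
  | succ j ih =>
    rw [List.take_succ_eq_append_getElem (by simpa using hj), permOfWord_append, ih (by omega)]
    have h : permOfWord [(⟨j, by omega⟩ : Fin m)] =
        Equiv.swap (Fin.castSucc ⟨j, by omega⟩) (Fin.succ ⟨j, by omega⟩) := by simp [permOfWord]
    ext x
    simp only [List.getElem_finRange, Fin.cast_mk, h, Equiv.Perm.mul_apply, val_cycleRange,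
      val_swap_castSucc_succ]
    split_ifs <;> omega

theorem permOfWord_normalWord {m : ℕ} (σ : Equiv.Perm (Fin (m + 1))) :
    permOfWord (normalWord m σ) = σ := by
  induction m with
  | zero => exact Equiv.ext fun x => Subsingleton.elim (α := Fin 1) _ _
  | succ m ih =>
    obtain ⟨⟨j, τ⟩, rfl⟩ := (insertEquiv (m + 1)).surjective σ
    rw [normalWord, Equiv.symm_apply_apply, permOfWord_append, permOfWord_map_succ, ih,
      permOfWord_take _ j.2]
    rfl

/-- In the additive monoid of natural numbers, with every generator sent to 1, the value of a word
is its length. The formula for values at an ascent then becomes a formula for lengths of normal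
words. -/
theorem braidRel_ofAdd_one : BraidRel fun _ : ℕ => Multiplicative.ofAdd 1 :=
  ⟨fun _ => rfl, fun _ _ _ => rfl⟩

theorem evalWord_ofAdd_one {m : ℕ} (L : List (Fin m)) :
    evalWord (fun _ => Multiplicative.ofAdd 1) L = Multiplicative.ofAdd L.length := by
  induction L with
  | nil => rfl
  | cons i L ih => 
    have : evalWord (fun _ => Multiplicative.ofAdd 1) (i :: L) =
      Multiplicative.ofAdd 1 * evalWord (fun _ => Multiplicative.ofAdd 1) L := by simp [evalWord]
    rw [this, ih, ← ofAdd_add, List.length_cons, add_comm]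

theorem length_normalWord_mul_swap {m : ℕ} (σ : Equiv.Perm (Fin (m + 1))) (i : Fin m)
    (h : σ i.castSucc < σ i.succ) :
    (normalWord m (σ * Equiv.swap i.castSucc i.succ)).length = (normalWord m σ).length + 1 := by
  have := braidRel_ofAdd_one.evalWord_normalWord_mul_swap σ i h
  rw [evalWord_ofAdd_one, evalWord_ofAdd_one, ← ofAdd_add] at this
  exact this

theorem length_normalWord_mul_swap' {m : ℕ} (σ : Equiv.Perm (Fin (m + 1))) (i : Fin m)
    (h : σ i.succ < σ i.castSucc) :
    (normalWord m (σ * Equiv.swap i.castSucc i.succ)).length + 1 = (normalWord m σ).length := by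
  have := length_normalWord_mul_swap (σ * Equiv.swap i.castSucc i.succ) i (by simpa using h)
  rw [← this, mul_assoc, Equiv.swap_mul_self, mul_one]

theorem permOfWord_concat {m : ℕ} (L : List (Fin m)) (i : Fin m) :
    permOfWord (L ++ [i]) = permOfWord L * Equiv.swap i.castSucc i.succ := by
  simp [permOfWord]

/-- A further letter lengthens the normal word of the product by at most one, so normal words are
shortest expressions. -/
theorem length_normalWord_le {m : ℕ} (L : List (Fin m)) :
    (normalWord m (permOfWord L)).length ≤ L.length := by
  induction L using List.reverseRecOn with
  | nil =>
    suffices ∀ m, normalWord m 1 = [] by simp [permOfWord, this]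
    intro m
    induction m with
    | zero => rfl
    | succ m ih =>
      have : (insertEquiv (m + 1)).symm 1 = (0, 1) := insertEquiv_symm rfl fun a => by simp
      simp [normalWord, this, ih]
  | append_singleton L i ih =>
    rw [permOfWord_concat, List.length_append, List.length_singleton]
    rcases lt_trichotomy (permOfWord L i.castSucc) (permOfWord L i.succ) with h | h | h
    · rw [length_normalWord_mul_swap _ _ h]; omega
    · exact absurd ((permOfWord L).injective h) (by simp [Fin.ext_iff])
    · have := length_normalWord_mul_swap' _ _ h; omega

/-- The hypothesis says that `L` is reduced. Then its last letter is an ascent of the permutation of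
the preceding word, which is reduced too, and the formula at an ascent applies. -/
theorem BraidRel.evalWord_eq {M : Type*} [Monoid M] {b : ℕ → M} (hb : BraidRel b) {m : ℕ}
    (L : List (Fin m)) (h : L.length ≤ (normalWord m (permOfWord L)).length) :
    evalWord b L = evalWord b (normalWord m (permOfWord L)) := by
  induction L using List.reverseRecOn with
  | nil =>
    have h1 := length_normalWord_le ([] : List (Fin m))
    rw [List.length_nil, Nat.le_zero, List.length_eq_zero_iff] at h1
    rw [h1]
  | append_singleton L i ih =>
    rw [permOfWord_concat, List.length_append, List.length_singleton] at h
    have h1 := length_normalWord_le L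
    rcases lt_trichotomy (permOfWord L i.castSucc) (permOfWord L i.succ) with h2 | h2 | h2
    · rw [length_normalWord_mul_swap _ _ h2] at h
      rw [permOfWord_concat, hb.evalWord_normalWord_mul_swap _ _ h2, evalWord_append,
        ih (by omega)]
      simp [evalWord]
    · exact absurd ((permOfWord L).injective h2) (by simp [Fin.ext_iff])
    -- At a descent the normal word of the product is shorter than that of the preceding word, so
    -- the whole word would not be reduced.
    · have := length_normalWord_mul_swap' _ _ h2; omega

/-- **Matsumoto's theorem** for the symmetric groups: reduced words of a permutation have the same
value under the braid relations. -/
theorem BraidRel.evalWord_reducedWord {M : Type*} [Monoid M] {b : ℕ → M} (hb : BraidRel b) {m : ℕ}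
    (σ : Equiv.Perm (Fin (m + 1))) :
    evalWord b (reducedWord σ) = evalWord b (normalWord m σ) := by
  obtain ⟨h1, h2⟩ : IsReducedWord σ (reducedWord σ) := (exists_reducedWord σ).choose_spec
  have := hb.evalWord_eq (reducedWord σ) (by rw [h1]; exact h2 _ (permOfWord_normalWord σ))
  rwa [h1] at this

/-- Every permutation is uniquely a permutation fixing the first place times a cycle s₀⋯s_{j-1}, and
the normal words of the two factors concatenate to its normal word. -/
theorem BraidRel.sum_reducedWord {R : Type*} [Semiring R] {b : ℕ → R} (hb : BraidRel b) (m : ℕ) :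
    ∑ σ : Equiv.Perm (Fin (m + 2)), evalWord b (reducedWord σ) =
      (∑ τ : Equiv.Perm (Fin (m + 1)), evalWord (fun i => b (i + 1)) (reducedWord τ)) *
        ∑ j ∈ Finset.range (m + 2), prefixProd b j := by
  simp only [hb.evalWord_reducedWord, hb.succ.evalWord_reducedWord]
  rw [← (insertEquiv (m + 1)).sum_comp, Finset.sum_range, Finset.sum_mul_sum,
    Fintype.sum_prod_type, Finset.sum_comm]
  exact Finset.sum_congr rfl fun τ _ => Finset.sum_congr rfl fun j _ =>
    evalWord_normalWord_succ b (Equiv.symm_apply_apply _ _)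

end Matsumoto

end
end NicholsFRT

namespace NicholsFRT

noncomputable section

/-! ### The braid operators on TV, skew derivations, and the recursion for the symmetrizers -/

section SkewDerivations

variable {k : Type*} [Field k] {V : Type*} [AddCommGroup V] [Module k V]
  {ι : Type*} (e : Basis ι k V) (c : V ⊗[k] V ≃ₗ[k] V ⊗[k] V)

theorem word_cons (i : ι) (w : List ι) :
    word e (i :: w) = TensorAlgebra.ι k (e i) * word e w := by simp [word]

theorem linear_ext_mul {M : Type*} [AddCommGroup M] [Module k M] {f g : TensorAlgebra k V →ₗ[k] M}
    (h1 : f 1 = g 1) (h : ∀ i y, f y = g y →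
      f (TensorAlgebra.ι k (e i) * y) = g (TensorAlgebra.ι k (e i) * y)) : f = g := by
  refine linear_ext e fun w => ?_
  induction w with
  | nil => simpa [word] using h1
  | cons i w ih => rw [word_cons]; exact h i _ ih

theorem braidAt_one (n : ℕ) : braidAt e c n 1 = 0 := by
  have := braidAt_word e c n []
  cases n <;> simpa [word, braidWord] using this

theorem braidAt_zero_ι (v : V) : braidAt e c 0 (TensorAlgebra.ι k v) = 0 := by
  have : braidAt e c 0 ∘ₗ TensorAlgebra.ι k = 0 := e.ext fun i => by
    have := braidAt_word e c 0 [i]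
    simpa [word, braidWord] using this
  exact LinearMap.congr_fun this v

theorem braidAt_zero_mulTwo (t : V ⊗[k] V) (y : TensorAlgebra k V) :
    braidAt e c 0 (mulTwo t * y) = mulTwo (c t) * y := by
  have : braidAt e c 0 ∘ₗ LinearMap.mulRight k y ∘ₗ mulTwo =
      LinearMap.mulRight k y ∘ₗ mulTwo ∘ₗ c.toLinearMap := by
    refine (e.tensorProduct e).ext fun ⟨i, j⟩ => ?_
    simp only [Basis.tensorProduct_apply, LinearMap.comp_apply, LinearMap.mulRight_apply,
      LinearEquiv.coe_coe]
    rw [← braidAt_zero, mulTwo]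
    simp [mul_assoc]
  exact LinearMap.congr_fun this t

theorem braidAt_succ_ι (n : ℕ) (v : V) (y : TensorAlgebra k V) :
    braidAt e c (n + 1) (TensorAlgebra.ι k v * y) = TensorAlgebra.ι k v * braidAt e c n y := by
  have : braidAt e c (n + 1) ∘ₗ LinearMap.mulRight k y ∘ₗ TensorAlgebra.ι k =
      LinearMap.mulRight k (braidAt e c n y) ∘ₗ TensorAlgebra.ι k :=
    e.ext fun i => by simpa using braidAt_succ e c n i y
  exact LinearMap.congr_fun this v

theorem braidAt_succ_mulTwo (n : ℕ) (t : V ⊗[k] V) (y : TensorAlgebra k V) :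
    braidAt e c (n + 2) (mulTwo t * y) = mulTwo t * braidAt e c n y := by
  induction t with
  | zero => simp
  | tmul v w =>
    have h : mulTwo (v ⊗ₜ[k] w) = TensorAlgebra.ι k v * TensorAlgebra.ι k w := by simp [mulTwo]
    rw [h, mul_assoc, braidAt_succ_ι, braidAt_succ_ι, mul_assoc]
  | add s t hs ht => simp only [map_add, add_mul, hs, ht]

theorem braidAt_one_mulTwo (t : V ⊗[k] V) : braidAt e c 1 (mulTwo t) = 0 := by
  induction t with
  | zero => simp
  | tmul v w =>
    have h : mulTwo (v ⊗ₜ[k] w) = TensorAlgebra.ι k v * TensorAlgebra.ι k w := by simp [mulTwo]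
    rw [h, braidAt_succ_ι, braidAt_zero_ι, mul_zero]
  | add s t hs ht => simp only [map_add, hs, ht, add_zero]

theorem mulTwo_tmul (v w : V) :
    mulTwo (v ⊗ₜ[k] w) = TensorAlgebra.ι k v * TensorAlgebra.ι k w := by simp [mulTwo]

-- On a word of length at least 3, the relation at places 0 and 1 is the braid equation on its first
-- three letters. On shorter words both sides vanish, because an operator that does not fit is zero
-- by definition. Relations at later places are carried past the first letter.
variable {c} in
theorem braidRel_braidAt (hc : IsBraiding c) : BraidRel (braidAt e c) where
  braid n := by
    induction n with
    | zero =>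
      -- The map u ⊗ v ⊗ w ↦ uvwy, which intertwines c ⊗ id and id ⊗ c with the operators at places
      -- 0 and 1.
      let E (y : TensorAlgebra k V) : (V ⊗[k] V) ⊗[k] V →ₗ[k] TensorAlgebra k V :=
        LinearMap.mulRight k y ∘ₗ LinearMap.mul' k _ ∘ₗ TensorProduct.map mulTwo (TensorAlgebra.ι k)
      have E_tmul : ∀ y t v, E y (t ⊗ₜ v) = mulTwo t * (TensorAlgebra.ι k v * y) := fun y t v => by
        simp [E, mul_assoc]
      have E_assoc : ∀ y v t, E y ((TensorProduct.assoc k V V V).symm (v ⊗ₜ t)) =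
          TensorAlgebra.ι k v * (mulTwo t * y) := fun y v t => by
        induction t with
        | zero => simp
        | tmul u w => simp [E_tmul, mulTwo_tmul, mul_assoc]
        | add s t hs ht => simp only [map_add, tmul_add, mul_add, add_mul, hs, ht]
      have h1 : ∀ y x, braidAt e c 0 (E y x) = E y (c.toLinearMap.rTensor V x) := fun y x => by
        induction x with
        | zero => simp
        | tmul t v => simp [E_tmul, braidAt_zero_mulTwo]
        | add s t hs ht => simp only [map_add, hs, ht]
      have h2 : ∀ y x, braidAt e c 1 (E y x) = E y ((TensorProduct.assoc k V V V).symm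
          (c.toLinearMap.lTensor V (TensorProduct.assoc k V V V x))) := fun y x => by
        obtain ⟨x, rfl⟩ := (TensorProduct.assoc k V V V).symm.surjective x
        rw [LinearEquiv.apply_symm_apply]
        induction x with
        | zero => simp
        | tmul v t =>
          rw [E_assoc, braidAt_succ_ι, braidAt_zero_mulTwo, LinearMap.lTensor_tmul, E_assoc]
          rfl
        | add s t hs ht => simp only [map_add, hs, ht]
      refine linear_ext e fun w => ?_
      match w with
      | [] => simp [word, braidAt_one]
      | [i] =>
        have h3 : braidAt e c 1 (TensorAlgebra.ι k (e i)) = 0 := by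
          have := braidAt_succ_ι e c 0 (e i) 1
          simpa [braidAt_one] using this
        simp [word, braidAt_zero_ι, h3]
      | [i, j] =>
        have h3 : word e [i, j] = mulTwo (e i ⊗ₜ e j) := by simp [word, mulTwo]
        have h4 : braidAt e c 0 (mulTwo (e i ⊗ₜ e j)) = mulTwo (c (e i ⊗ₜ e j)) := by
          simpa using braidAt_zero_mulTwo e c (e i ⊗ₜ e j) 1
        simp [h3, h4, braidAt_one_mulTwo]
      | i :: j :: l :: w =>
        have h3 : word e (i :: j :: l :: w) = E (word e w) ((e i ⊗ₜ e j) ⊗ₜ e l) := by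
          rw [E_tmul, mulTwo_tmul]; simp [word, mul_assoc]
        have h4 := LinearMap.congr_fun hc ((e i ⊗ₜ e j) ⊗ₜ e l)
        simp only [LinearMap.comp_apply, LinearEquiv.coe_coe] at h4
        simp only [zero_add, Module.End.mul_apply, h3, h1, h2, h4]
    | succ n ih =>
      refine linear_ext_mul e ?_ fun i y _ => ?_
      · simp [Module.End.mul_apply, braidAt_one]
      · simp only [Module.End.mul_apply, braidAt_succ_ι]
        have := LinearMap.congr_fun ih y
        simp only [Module.End.mul_apply] at this
        rw [this]
  comm i j hij := by
    obtain ⟨j, rfl⟩ := Nat.exists_eq_add_of_le hij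
    induction i with
    | zero =>
      refine linear_ext e fun w => ?_
      match w with
      | [] => simp [word, braidAt_one]
      | [i] =>
        have : braidAt e c (j + 2) (TensorAlgebra.ι k (e i)) = 0 := by
          have := braidAt_succ_ι e c (j + 1) (e i) 1
          simpa [braidAt_one] using this
        simp [word, braidAt_zero_ι, this, add_comm]
      | i :: l :: w =>
        have h : word e (i :: l :: w) = mulTwo (e i ⊗ₜ e l) * word e w := by
          rw [mulTwo_tmul]; simp [word, mul_assoc]
        simp only [zero_add, add_comm 2 j, Module.End.mul_apply, h, braidAt_succ_mulTwo, braidAt_zero_mulTwo]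
    | succ n ih =>
      have e1 : n + 1 + 2 + j = (n + 2 + j) + 1 := by omega
      refine linear_ext_mul e ?_ fun i y _ => ?_
      · simp [Module.End.mul_apply, braidAt_one]
      · rw [e1]
        simp only [Module.End.mul_apply, braidAt_succ_ι]
        have := LinearMap.congr_fun (ih (by omega)) y
        simp only [Module.End.mul_apply] at this
        rw [this]

theorem prefixProd_braidAt_succ (j : ℕ) (v : V) (y : TensorAlgebra k V) :
    prefixProd (fun i => braidAt e c (i + 1)) j (TensorAlgebra.ι k v * y) =
      TensorAlgebra.ι k v * prefixProd (braidAt e c) j y := by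
  induction j generalizing y with
  | zero => simp [prefixProd]
  | succ j ih => rw [prefixProd_succ, prefixProd_succ, Module.End.mul_apply, Module.End.mul_apply,
      braidAt_succ_ι, ih]

theorem evalWord_braidAt_succ {m : ℕ} (L : List (Fin m)) (v : V) (y : TensorAlgebra k V) :
    evalWord (fun i => braidAt e c (i + 1)) L (TensorAlgebra.ι k v * y) =
      TensorAlgebra.ι k v * evalWord (braidAt e c) L y := by
  induction L with
  | nil => simp [evalWord]
  | cons i L ih =>
    have h : ∀ b : ℕ → Module.End k (TensorAlgebra k V), evalWord b (i :: L) =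
      b i * evalWord b L := fun b => by simp [evalWord]
    rw [h, h, Module.End.mul_apply, Module.End.mul_apply, ih, braidAt_succ_ι]

theorem symmetrizer_eq (m : ℕ) : symmetrizer e c m =
    ∑ σ : Equiv.Perm (Fin (m + 1)), evalWord (braidAt e c) (reducedWord σ) := rfl

theorem symmetrizer_zero : symmetrizer e c 0 = 1 := by
  have h : ∀ L : List (Fin 0), L = [] := fun L => by
    cases L with
    | nil => rfl
    | cons i _ => exact i.elim0
  rw [symmetrizer]
  simp only [h, List.map_nil, List.prod_nil, Finset.sum_const, Finset.card_univ]
  simp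

/-- The homogeneous component of degree `n` of the tensor algebra. -/
abbrev tensorPow (k V : Type*) [Field k] [AddCommGroup V] [Module k V] (n : ℕ) :
    Submodule k (TensorAlgebra k V) :=
  LinearMap.range (TensorAlgebra.ι k : V →ₗ[k] TensorAlgebra k V) ^ n

variable [Fintype ι]

theorem exists_sum_of_mem_tensorPow_succ {n : ℕ} {y : TensorAlgebra k V}
    (hy : y ∈ tensorPow k V (n + 1)) :
    ∃ z : ι → TensorAlgebra k V, (∀ i, z i ∈ tensorPow k V n) ∧
      y = ∑ i, TensorAlgebra.ι k (e i) * z i := by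
  rw [tensorPow, pow_succ'] at hy
  induction hy using Submodule.mul_induction_on' with
  | mem_mul_mem m hm z hz =>
    obtain ⟨v, rfl⟩ := hm
    refine ⟨fun i => e.repr v i • z, fun i => Submodule.smul_mem _ _ hz, ?_⟩
    conv_lhs => rw [← e.sum_repr v, map_sum, Finset.sum_mul]
    simp
  | add x _ y _ hx hy =>
    obtain ⟨z, hz, rfl⟩ := hx
    obtain ⟨z', hz', rfl⟩ := hy
    exact ⟨fun i => z i + z' i, fun i => add_mem (hz i) (hz' i), by
      simp [mul_add, Finset.sum_add_distrib]⟩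

theorem ι_mul_mem_tensorPow {n : ℕ} {y : TensorAlgebra k V} (hy : y ∈ tensorPow k V n) (v : V) :
    TensorAlgebra.ι k v * y ∈ tensorPow k V (n + 1) := by
  rw [tensorPow, pow_succ']
  exact Submodule.mul_mem_mul ⟨v, rfl⟩ hy

theorem mem_tensorPow_zero {y : TensorAlgebra k V} (hy : y ∈ tensorPow k V 0) :
    ∃ s : k, y = s • 1 := by
  rw [tensorPow, pow_zero] at hy
  obtain ⟨s, rfl⟩ := Submodule.mem_one.mp hy
  exact ⟨s, Algebra.algebraMap_eq_smul_one s⟩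

variable [DecidableEq ι]

/-- The value of the skew derivation of index `p` on a monomial. -/
def derivWord : ι → List ι → TensorAlgebra k V
  | _, [] => 0
  | p, i :: w => (if p = i then word e w else 0) +
      ∑ j, ∑ q, coef e c i j p q • (TensorAlgebra.ι k (e q) * derivWord j w)

/-- The skew derivation `∂_p` of `TV` with
`∂_p(x_i y) = δ_{ip} y + ∑_{j,q} c_{ij}^{pq} x_q ∂_j(y)`. -/
def deriv (p : ι) : Module.End k (TensorAlgebra k V) :=
  e.tensorAlgebra.constr k fun w => derivWord e c p w.toList

theorem deriv_word (p : ι) (w : List ι) : deriv e c p (word e w) = derivWord e c p w := by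
  rw [← tensorAlgebra_apply, deriv, Basis.constr_basis, FreeMonoid.toList_ofList]

@[simp] theorem deriv_one (p : ι) : deriv e c p 1 = 0 := by
  have := deriv_word e c p []
  simpa [word, derivWord] using this

theorem deriv_mul (p i : ι) (y : TensorAlgebra k V) :
    deriv e c p (TensorAlgebra.ι k (e i) * y) = (if p = i then y else 0) +
      ∑ j, ∑ q, coef e c i j p q • (TensorAlgebra.ι k (e q) * deriv e c j y) := by
  have : deriv e c p ∘ₗ LinearMap.mulLeft k (TensorAlgebra.ι k (e i)) =
      (if p = i then LinearMap.id else 0) +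
      ∑ j, ∑ q, coef e c i j p q •
        (LinearMap.mulLeft k (TensorAlgebra.ι k (e q)) ∘ₗ deriv e c j) := by
    refine linear_ext e fun w => ?_
    simp only [LinearMap.comp_apply, LinearMap.mulLeft_apply, LinearMap.add_apply,
      LinearMap.sum_apply, LinearMap.smul_apply, ← word_cons, deriv_word, derivWord]
    split_ifs <;> rfl
  refine (LinearMap.congr_fun this y).trans ?_
  simp only [LinearMap.add_apply, LinearMap.sum_apply, LinearMap.smul_apply, LinearMap.comp_apply,
    LinearMap.mulLeft_apply]
  split_ifs <;> rfl

theorem deriv_of_mem_zero (p : ι) {y : TensorAlgebra k V} (hy : y ∈ tensorPow k V 0) :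
    deriv e c p y = 0 := by
  obtain ⟨s, rfl⟩ := mem_tensorPow_zero hy
  simp

theorem deriv_mem (p : ι) {n : ℕ} {y : TensorAlgebra k V} (hy : y ∈ tensorPow k V (n + 1)) :
    deriv e c p y ∈ tensorPow k V n := by
  induction n generalizing p y with
  | zero =>
    obtain ⟨z, hz, rfl⟩ := exists_sum_of_mem_tensorPow_succ e hy
    simp only [map_sum, deriv_mul, deriv_of_mem_zero e c _ (hz _), mul_zero, smul_zero,
      Finset.sum_const_zero, add_zero]
    refine Submodule.sum_mem _ fun i _ => ?_
    split_ifs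
    exacts [hz i, zero_mem _]
  | succ n ih =>
    obtain ⟨z, hz, rfl⟩ := exists_sum_of_mem_tensorPow_succ e hy
    simp only [map_sum, deriv_mul]
    refine Submodule.sum_mem _ fun i _ => add_mem ?_ (Submodule.sum_mem _ fun j _ =>
      Submodule.sum_mem _ fun q _ => Submodule.smul_mem _ _ (ι_mul_mem_tensorPow (ih j (hz i)) _))
    split_ifs
    exacts [hz i, zero_mem _]

/-- The operator c₀⋯c_{j-1} braids the letter at place j to the front. Sorting the sum over all j by
the resulting first letter x_p gives the recursion that defines ∂_p. -/
theorem sum_prefixProd_braidAt {n : ℕ} {y : TensorAlgebra k V} (hy : y ∈ tensorPow k V (n + 1)) :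
    (∑ j ∈ Finset.range (n + 1), prefixProd (braidAt e c) j) y =
      ∑ p, TensorAlgebra.ι k (e p) * deriv e c p y := by
  induction n generalizing y with
  | zero =>
    obtain ⟨z, hz, rfl⟩ := exists_sum_of_mem_tensorPow_succ e hy
    simp [deriv_mul, deriv_of_mem_zero e c _ (hz _), prefixProd]
  | succ n ih =>
    obtain ⟨z, hz, rfl⟩ := exists_sum_of_mem_tensorPow_succ e hy
    rw [map_sum]
    simp only [map_sum, Finset.mul_sum]
    rw [Finset.sum_comm]
    refine Finset.sum_congr rfl fun i _ => ?_
    -- The term j = 0 gives the summand δ_{ip} y. In all other terms c₀ acts last, after the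
    -- induction hypothesis has been applied behind the first letter.
    rw [Finset.sum_range_succ']
    simp only [prefixProd_succ', LinearMap.add_apply, LinearMap.sum_apply, Module.End.mul_apply,
      prefixProd_braidAt_succ]
    rw [← map_sum, ← Finset.mul_sum, ← LinearMap.sum_apply, ih (hz i), Finset.mul_sum, map_sum]
    simp only [braidAt_zero, deriv_mul, mul_add, Finset.sum_add_distrib]
    rw [add_comm]
    congr 1
    · simp [prefixProd]
    · simp only [apply_basis, map_sum, map_smul, mulTwo_tmul, Finset.sum_mul, Finset.mul_sum,
        smul_mul_assoc, mul_smul_comm, mul_assoc]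
      rw [Finset.sum_comm]

-- In the factorized sum, the permutations that fix the first place act behind the first letter, and
-- the sum over the cycles produces ∑ x_p ∂_p.
variable {c} in
theorem symmetrizer_succ (hc : IsBraiding c) {m : ℕ} {y : TensorAlgebra k V}
    (hy : y ∈ tensorPow k V (m + 2)) : symmetrizer e c (m + 1) y =
      ∑ p, TensorAlgebra.ι k (e p) * symmetrizer e c m (deriv e c p y) := by
  rw [symmetrizer_eq, (braidRel_braidAt e hc).sum_reducedWord, Module.End.mul_apply,
    sum_prefixProd_braidAt e c hy, map_sum]
  refine Finset.sum_congr rfl fun p _ => ?_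
  simp only [LinearMap.sum_apply, evalWord_braidAt_succ, symmetrizer_eq, Finset.mul_sum]

end SkewDerivations
end
end NicholsFRT

namespace NicholsFRT

noncomputable section

/-! ### The kernel of TV → B(V,c) as the common kernel of iterated skew derivations -/

section Pairing

variable {k : Type*} [Field k] {ι : Type*} [Fintype ι] [DecidableEq ι] {C : ι → ι → ι → ι → k}

theorem universalForm_apply (hC : YB C) (a b : FRT C) :
    universalForm hC (a ⊗ₜ b) = (rightRep hC b).unop.ofConv a := rfl

theorem universalForm_mul_right (hC : YB C) (a b d : FRT C) :
    universalForm hC (a ⊗ₜ (b * d)) = LinearMap.mul' k k (TensorProduct.map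
      ((curry (universalForm hC)).flip d) ((curry (universalForm hC)).flip b) (comul a)) := by
  rw [universalForm_apply, map_mul, MulOpposite.unop_mul]
  rfl

theorem universalForm_t_mul (hC : YB C) (i p j q : ι) (d : FRT C) :
    universalForm hC (FRT.t C i p ⊗ₜ (FRT.t C j q * d)) =
      ∑ m, C j m p q * universalForm hC (FRT.t C i m ⊗ₜ d) := by
  rw [universalForm_mul_right, FRT.comul_t]
  simp [universalForm_t, mul_comm]

end Pairing

section Null

variable {k : Type*} [Field k] {V : Type*} [AddCommGroup V] [Module k V]
  {ι : Type*} [Fintype ι] [DecidableEq ι] (e : Basis ι k V) (c : V ⊗[k] V ≃ₗ[k] V ⊗[k] V)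

/-- The operator `∂_{p_r} ⋯ ∂_{p_1}` for a word `p_1 ⋯ p_r`. -/
def derivs : List ι → Module.End k (TensorAlgebra k V)
  | [] => 1
  | p :: u => derivs u * deriv e c p

/-- The functional `ε ∂_{p_r} ⋯ ∂_{p_1}` on `TV`. -/
def derivsForm (u : List ι) : TensorAlgebra k V →ₗ[k] k :=
  TensorAlgebra.algebraMapInv.toLinearMap ∘ₗ derivs e c u

theorem derivsForm_cons (p : ι) (u : List ι) (y : TensorAlgebra k V) :
    derivsForm e c (p :: u) y = derivsForm e c u (deriv e c p y) := rfl

theorem derivsForm_nil (y : TensorAlgebra k V) :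
    derivsForm e c [] y = TensorAlgebra.algebraMapInv y := rfl

theorem algebraMapInv_ι_mul (v : V) (y : TensorAlgebra k V) :
    TensorAlgebra.algebraMapInv (TensorAlgebra.ι k v * y) = 0 := by
  simp [TensorAlgebra.algebraMapInv]

theorem algebraMapInv_of_mem {n : ℕ} {y : TensorAlgebra k V} (hy : y ∈ tensorPow k V (n + 1)) :
    TensorAlgebra.algebraMapInv y = 0 := by
  rw [tensorPow, pow_succ'] at hy
  induction hy using Submodule.mul_induction_on' with
  | mem_mul_mem m hm z hz => obtain ⟨v, rfl⟩ := hm; exact algebraMapInv_ι_mul v z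
  | add x _ y _ hx hy => rw [map_add, hx, hy, add_zero]

theorem derivsForm_of_mem {n : ℕ} {y : TensorAlgebra k V} (hy : y ∈ tensorPow k V n) (u : List ι)
    (h : u.length ≠ n) : derivsForm e c u y = 0 := by
  induction u generalizing n y with
  | nil =>
    obtain ⟨n, rfl⟩ := Nat.exists_eq_succ_of_ne_zero (n := n) (by simpa using h.symm)
    exact algebraMapInv_of_mem hy
  | cons p u ih =>
    rw [derivsForm_cons]
    cases n with
    | zero => rw [deriv_of_mem_zero e c p hy, map_zero]
    | succ n => exact ih (deriv_mem e c p hy) (by simpa using h)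

/-- The elements of `TV` that are killed by all functionals `ε ∂_{p_r} ⋯ ∂_{p_1}`. -/
def nullSpace : Submodule k (TensorAlgebra k V) := ⨅ u, LinearMap.ker (derivsForm e c u)

variable {e c}

theorem mem_nullSpace {y : TensorAlgebra k V} :
    y ∈ nullSpace e c ↔ ∀ u, derivsForm e c u y = 0 := by
  simp [nullSpace]

theorem deriv_mem_nullSpace (p : ι) {y : TensorAlgebra k V} (hy : y ∈ nullSpace e c) :
    deriv e c p y ∈ nullSpace e c :=
  mem_nullSpace.mpr fun u => mem_nullSpace.mp hy (p :: u)

theorem mem_nullSpace_iff_deriv {y : TensorAlgebra k V} : y ∈ nullSpace e c ↔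
    TensorAlgebra.algebraMapInv y = 0 ∧ ∀ p, deriv e c p y ∈ nullSpace e c := by
  refine ⟨fun h => ⟨mem_nullSpace.mp h [], fun p => deriv_mem_nullSpace p h⟩, fun h => ?_⟩
  refine mem_nullSpace.mpr fun u => ?_
  cases u with
  | nil => exact h.1
  | cons p u => exact mem_nullSpace.mp (h.2 p) u

/-- TV is free, so an element determines its parts behind each first letter; the map `d` strips the
first letter x_p and kills the words that begin otherwise. -/
theorem sum_ι_mul_eq_zero {z : ι → TensorAlgebra k V}
    (h : ∑ i, TensorAlgebra.ι k (e i) * z i = 0) (p : ι) : z p = 0 := by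
  let d : TensorAlgebra k V →ₗ[k] TensorAlgebra k V := e.tensorAlgebra.constr k fun w =>
    match w.toList with
    | [] => 0
    | i :: w => if p = i then word e w else 0
  have hd : ∀ i, d ∘ₗ LinearMap.mulLeft k (TensorAlgebra.ι k (e i)) =
      if p = i then LinearMap.id else 0 := fun i => by
    refine linear_ext e fun w => ?_
    rw [LinearMap.comp_apply, LinearMap.mulLeft_apply, ← word_cons, ← tensorAlgebra_apply]
    simp only [d, Basis.constr_basis, FreeMonoid.toList_ofList]
    split_ifs <;> rfl
  have h1 := congrArg d h
  have h2 : ∀ i, d (TensorAlgebra.ι k (e i) * z i) = if p = i then z i else 0 := fun i => by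
    have := LinearMap.congr_fun (hd i) (z i)
    simp only [LinearMap.comp_apply, LinearMap.mulLeft_apply] at this
    rw [this]
    split_ifs <;> rfl
  simpa [h2] using h1

/-- The recursion for QS reduces the degree by one, since a sum ∑ x_p z_p vanishes only if all z_p
do. In degree 1 the symmetrizer is the identity, and y = ∑ x_p ∂_p(y) with scalars ∂_p(y). -/
theorem symmetrizer_eq_zero_iff (hc : IsBraiding c) {m : ℕ} {y : TensorAlgebra k V}
    (hy : y ∈ tensorPow k V (m + 1)) : symmetrizer e c m y = 0 ↔ y ∈ nullSpace e c := by
  induction m generalizing y with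
  | zero =>
    rw [symmetrizer_zero, Module.End.one_apply]
    refine ⟨fun h => h ▸ zero_mem _, fun h => ?_⟩
    have h1 := sum_prefixProd_braidAt e c hy
    simp only [zero_add, Finset.range_one, Finset.sum_singleton, prefixProd, List.range_zero,
      List.map_nil, List.prod_nil, Module.End.one_apply] at h1
    rw [h1]
    refine Finset.sum_eq_zero fun p _ => ?_
    obtain ⟨s, hs⟩ := mem_tensorPow_zero (deriv_mem e c p hy)
    have h2 := mem_nullSpace.mp (deriv_mem_nullSpace p h) []
    rw [derivsForm_nil, hs, map_smul, map_one, smul_eq_mul, mul_one] at h2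
    rw [hs, h2, zero_smul, mul_zero]
  | succ m ih =>
    rw [symmetrizer_succ e hc hy, mem_nullSpace_iff_deriv]
    refine ⟨fun h => ⟨algebraMapInv_of_mem hy, fun p =>
      (ih (deriv_mem e c p hy)).mp (sum_ι_mul_eq_zero h p)⟩, fun h => ?_⟩
    refine Finset.sum_eq_zero fun p _ => ?_
    rw [(ih (deriv_mem e c p hy)).mpr (h.2 p), mul_zero]

/-- The terms of ∂_p(x_i y) are y itself and letters times derivatives of y, so induction on the
number of derivations applies. -/
theorem ι_mul_mem_nullSpace (v : V) {y : TensorAlgebra k V} (hy : y ∈ nullSpace e c) :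
    TensorAlgebra.ι k v * y ∈ nullSpace e c := by
  have key : ∀ (u : List ι) (i : ι) (y : TensorAlgebra k V), y ∈ nullSpace e c →
      derivsForm e c u (TensorAlgebra.ι k (e i) * y) = 0 := by
    intro u
    induction u with
    | nil => exact fun i y _ => algebraMapInv_ι_mul _ _
    | cons p u ih =>
      intro i y hy
      rw [derivsForm_cons, deriv_mul, map_add, map_sum]
      simp only [map_sum, map_smul, ih _ _ (deriv_mem_nullSpace _ hy), smul_zero,
        Finset.sum_const_zero, add_zero]
      split_ifs
      exacts [mem_nullSpace.mp hy u, map_zero _]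
  rw [← e.sum_repr v, map_sum, Finset.sum_mul]
  refine Submodule.sum_mem _ fun i _ => ?_
  rw [map_smul, smul_mul_assoc]
  exact Submodule.smul_mem _ _ (mem_nullSpace.mpr fun u => key u i y hy)

theorem slice_tmul_mul {A : Type*} [Ring A] [Algebra k A] {M : Type*} [Ring M] [Algebra k M]
    (φ : Dual k A) (a : A) (m : M) (X : A ⊗[k] M) :
    slice φ ((a ⊗ₜ m) * X) = m * slice (φ ∘ₗ LinearMap.mulLeft k a) X := by
  induction X with
  | zero => simp
  | add x y hx hy => simp only [mul_add, map_add, hx, hy]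
  | tmul x y => simp [slice_tmul]

variable (e c)

/-- The derivations are built from c, and the relations of A(c) say that the coaction commutes with
c. The index of ∂ is transformed like a vector, by the matrix of the t_p^q. -/
theorem lTensor_deriv_freeCoaction (q : ι) (y : TensorAlgebra k V) :
    (deriv e c q).lTensor _ (freeCoaction e c y) =
      ∑ p, (FRT.t (coef e c) p q ⊗ₜ[k] 1) * freeCoaction e c (deriv e c p y) := by
  have h : ∀ (q : ι), (deriv e c q).lTensor _ ∘ₗ (freeCoaction e c).toLinearMap =
      ∑ p, LinearMap.mulLeft k (FRT.t (coef e c) p q ⊗ₜ[k] (1 : TensorAlgebra k V)) ∘ₗ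
        (freeCoaction e c).toLinearMap ∘ₗ deriv e c p := by
    -- All indices q are treated at once, because ∂_q of a product x_j y involves every derivative
    -- of y.
    suffices H : LinearMap.pi (fun q => (deriv e c q).lTensor _ ∘ₗ (freeCoaction e c).toLinearMap) =
        LinearMap.pi (fun q => ∑ p, LinearMap.mulLeft k
          (FRT.t (coef e c) p q ⊗ₜ[k] (1 : TensorAlgebra k V)) ∘ₗ
          (freeCoaction e c).toLinearMap ∘ₗ deriv e c p) from fun q =>
      LinearMap.ext fun y => congrFun (LinearMap.congr_fun H y) q
    refine linear_ext_mul e (by ext q; simp [Algebra.TensorProduct.one_def]) fun i y ih => ?_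
    have ih : ∀ q, (deriv e c q).lTensor _ (freeCoaction e c y) =
      ∑ p, (FRT.t (coef e c) p q ⊗ₜ[k] 1) * freeCoaction e c (deriv e c p y) := fun q => by
        simpa using congrFun ih q
    funext q
    have h2 : ∀ (a : FRT (coef e c)) (j : ι) (X : FRT (coef e c) ⊗[k] TensorAlgebra k V),
        (deriv e c q).lTensor _ ((a ⊗ₜ TensorAlgebra.ι k (e j)) * X) =
        (if q = j then (a ⊗ₜ 1) * X else 0) + ∑ s, ∑ r, coef e c j s q r •
          ((a ⊗ₜ TensorAlgebra.ι k (e r)) * (deriv e c s).lTensor _ X) := by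
      intro a j X
      induction X with
      | zero => simp
      | add x y hx hy =>
        simp only [mul_add, map_add, hx, hy, smul_add, Finset.sum_add_distrib]
        split_ifs <;> abel
      | tmul x y =>
        simp only [Algebra.TensorProduct.tmul_mul_tmul, LinearMap.lTensor_tmul, deriv_mul,
          tmul_add, tmul_sum, tmul_smul, one_mul]
        split_ifs <;> simp
    -- After both sides are expanded, they differ by exactly one relation of A(c).
    have h3 : ∀ (s u : ι) (X : FRT (coef e c) ⊗[k] TensorAlgebra k V),
        ∑ j, ∑ l, coef e c j l q u • (((FRT.t (coef e c) i j * FRT.t (coef e c) s l) ⊗ₜ[k]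
          TensorAlgebra.ι k (e u)) * X) =
        ∑ p, ∑ r, coef e c i s p r • (((FRT.t (coef e c) p q * FRT.t (coef e c) r u) ⊗ₜ[k]
          TensorAlgebra.ι k (e u)) * X) := fun s u X => by
      have := congrArg (fun a => (a ⊗ₜ[k] TensorAlgebra.ι k (e u)) * X)
        (FRT.rel (coef e c) i s q u).symm
      simpa only [TensorProduct.sum_tmul, ← TensorProduct.smul_tmul', Finset.sum_mul,
        smul_mul_assoc] using this
    have hL : (deriv e c q).lTensor _ (freeCoaction e c (TensorAlgebra.ι k (e i) * y)) =
        (FRT.t (coef e c) i q ⊗ₜ[k] 1) * freeCoaction e c y +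
        ∑ j, ∑ l, ∑ u, ∑ s, coef e c j l q u •
          (((FRT.t (coef e c) i j * FRT.t (coef e c) s l) ⊗ₜ[k]
            TensorAlgebra.ι k (e u)) * freeCoaction e c (deriv e c s y)) := by
      rw [map_mul, freeCoaction_ι, Finset.sum_mul, map_sum]
      simp only [h2, ih, Finset.sum_add_distrib, Finset.mul_sum, Finset.smul_sum, ← mul_assoc,
        Algebra.TensorProduct.tmul_mul_tmul, mul_one, Finset.sum_ite_eq, Finset.mem_univ, if_true]
    have hR : ∑ p, (FRT.t (coef e c) p q ⊗ₜ[k] 1) *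
          freeCoaction e c (deriv e c p (TensorAlgebra.ι k (e i) * y)) =
        (FRT.t (coef e c) i q ⊗ₜ[k] 1) * freeCoaction e c y +
        ∑ p, ∑ s, ∑ r, ∑ u, coef e c i s p r •
          (((FRT.t (coef e c) p q * FRT.t (coef e c) r u) ⊗ₜ[k]
            TensorAlgebra.ι k (e u)) * freeCoaction e c (deriv e c s y)) := by
      simp only [deriv_mul, map_add, map_sum, map_smul, map_mul, freeCoaction_ι, mul_add,
        Finset.sum_add_distrib, Finset.sum_mul, Finset.mul_sum, Finset.smul_sum, mul_smul_comm,
        ← mul_assoc, Algebra.TensorProduct.tmul_mul_tmul, one_mul, apply_ite (freeCoaction e c),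
        map_zero, mul_ite, mul_zero, Finset.sum_ite_eq', Finset.mem_univ, if_true]
    have h4 : ∀ F : ι → ι → ι → ι → FRT (coef e c) ⊗[k] TensorAlgebra k V,
        ∑ p, ∑ s, ∑ r, ∑ u, F p s r u = ∑ s, ∑ u, ∑ p, ∑ r, F p s r u := fun F => by
      rw [Finset.sum_comm]
      refine Finset.sum_congr rfl fun s _ => ?_
      rw [Finset.sum_congr rfl fun p _ => Finset.sum_comm, Finset.sum_comm]
    have h5 := hL.trans (Eq.trans ?_ hR.symm)
    · simpa only [LinearMap.pi_apply, LinearMap.comp_apply, AlgHom.toLinearMap_apply,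
        LinearMap.sum_apply, LinearMap.mulLeft_apply] using h5
    · exact congrArg _ ((sum_comm₄ _).trans (Finset.sum_comm.trans ((Finset.sum_congr rfl
        fun s _ => Finset.sum_congr rfl fun u _ => h3 s u _).trans (h4 _).symm)))
  have := LinearMap.congr_fun (h q) y
  simpa using this

omit [DecidableEq ι] in
theorem lTensor_algebraMapInv_freeCoaction (y : TensorAlgebra k V) :
    (TensorAlgebra.algebraMapInv (M := V)).toLinearMap.lTensor _ (freeCoaction e c y) =
      1 ⊗ₜ TensorAlgebra.algebraMapInv y := by
  have : (Algebra.TensorProduct.map (.id k (FRT (coef e c)))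
      (TensorAlgebra.algebraMapInv (R := k) (M := V))).comp (freeCoaction e c) =
      Algebra.TensorProduct.includeRight.comp (TensorAlgebra.algebraMapInv (R := k) (M := V)) := by
    refine TensorAlgebra.hom_ext (e.ext fun i => ?_)
    simp [freeCoaction_ι, TensorAlgebra.algebraMapInv]
  exact AlgHom.congr_fun this y

variable {e c}

/-- By the preceding commutation rule, a derivative of φ(y₋₁) y₀ is a sum of expressions of the same
kind in the derivatives of y; multiplication by t_p^q only changes the functional φ. -/
theorem slice_freeCoaction_mem_nullSpace (φ : Dual k (FRT (coef e c))) {y : TensorAlgebra k V}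
    (hy : y ∈ nullSpace e c) : slice φ (freeCoaction e c y) ∈ nullSpace e c := by
  refine mem_nullSpace.mpr fun u => ?_
  induction u generalizing φ y with
  | nil =>
    have h := congrArg (slice φ) (lTensor_algebraMapInv_freeCoaction e c y)
    rw [slice_lTensor, mem_nullSpace_iff_deriv.mp hy |>.1, tmul_zero, map_zero] at h
    exact h
  | cons p u ih =>
    rw [derivsForm_cons, ← slice_lTensor, lTensor_deriv_freeCoaction, map_sum, map_sum]
    refine Finset.sum_eq_zero fun q _ => ?_
    rw [slice_tmul_mul, one_mul]
    exact ih _ (deriv_mem_nullSpace q hy)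

/-- This is the Leibniz rule at the other end: for ∂_p to reach the last letter x_i, that letter
must be braided to the front through y, and r(t_i^p, y₋₁) y₀ is what remains of y with the
coefficient of x_p. -/
theorem deriv_mul_ι (hC : YB (coef e c)) (p i : ι) (y : TensorAlgebra k V) :
    deriv e c p (y * TensorAlgebra.ι k (e i)) = deriv e c p y * TensorAlgebra.ι k (e i) +
      slice (curry (universalForm hC) (FRT.t (coef e c) i p)) (freeCoaction e c y) := by
  suffices H : LinearMap.pi (fun p => deriv e c p ∘ₗ LinearMap.mulRight k
      (TensorAlgebra.ι k (e i))) = LinearMap.pi (fun p => LinearMap.mulRight k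
      (TensorAlgebra.ι k (e i)) ∘ₗ deriv e c p + slice (curry (universalForm hC)
      (FRT.t (coef e c) i p)) ∘ₗ (freeCoaction e c).toLinearMap) from
    congrFun (LinearMap.congr_fun H y) p
  refine linear_ext_mul e ?_ fun l y ih => ?_
  · funext p
    have h := deriv_mul e c p i 1
    have h1 : universalForm hC (FRT.t (coef e c) i p ⊗ₜ 1) = if p = i then 1 else 0 := by
      rw [universalForm_apply, map_one]
      exact (FRT.counit_t (coef e c) i p).trans (by simp [eq_comm])
    simp only [mul_one, deriv_one, mul_zero, smul_zero, Finset.sum_const_zero, add_zero] at h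
    simp [h, Algebra.TensorProduct.one_def, slice_tmul, h1]
  · funext p
    have ih : ∀ p, deriv e c p (y * TensorAlgebra.ι k (e i)) =
        deriv e c p y * TensorAlgebra.ι k (e i) + slice (curry (universalForm hC)
          (FRT.t (coef e c) i p)) (freeCoaction e c y) := fun p => by simpa using congrFun ih p
    have h1 : ∀ q, (curry (universalForm hC) (FRT.t (coef e c) i p)) ∘ₗ
        LinearMap.mulLeft k (FRT.t (coef e c) l q) =
        ∑ m, coef e c l m p q • curry (universalForm hC) (FRT.t (coef e c) i m) := fun q =>
      LinearMap.ext fun d => by simpa using universalForm_t_mul hC i p l q d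
    have h2 : ∀ (φ : ι → Dual k (FRT (coef e c))) (s : ι → k) X,
        slice (∑ m, s m • φ m) X = ∑ m, s m • slice (M := TensorAlgebra k V) (φ m) X := by
      intro φ s X
      induction X with
      | zero => simp
      | add x y hx hy => simp only [map_add, hx, hy, smul_add, Finset.sum_add_distrib]
      | tmul x y => simp [slice_tmul, Finset.sum_smul, smul_smul]
    have h3 : deriv e c p (TensorAlgebra.ι k (e l) * y * TensorAlgebra.ι k (e i)) =
        deriv e c p (TensorAlgebra.ι k (e l) * y) * TensorAlgebra.ι k (e i) +
        slice (curry (universalForm hC) (FRT.t (coef e c) i p))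
          (freeCoaction e c (TensorAlgebra.ι k (e l) * y)) := by
      rw [mul_assoc, deriv_mul, deriv_mul, map_mul, freeCoaction_ι, Finset.sum_mul, map_sum,
        add_mul, add_assoc]
      refine congrArg₂ HAdd.hAdd (by split_ifs <;> simp) ?_
      simp only [ih, slice_tmul_mul, h1, h2, mul_add, smul_add, Finset.sum_add_distrib,
        Finset.sum_mul, Finset.mul_sum, mul_smul_comm, smul_mul_assoc, mul_assoc]
      refine congrArg₂ HAdd.hAdd rfl ?_
      rw [Finset.sum_comm]
    simpa only [LinearMap.pi_apply, LinearMap.comp_apply, LinearMap.add_apply,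
      LinearMap.mulRight_apply, AlgHom.toLinearMap_apply] using h3

/-- The extra term in the Leibniz rule for y x_i is a slice of the coaction of y, and the null space
is stable under these. -/
theorem mul_ι_mem_nullSpace (hc : IsBraiding c) (v : V) {y : TensorAlgebra k V}
    (hy : y ∈ nullSpace e c) : y * TensorAlgebra.ι k v ∈ nullSpace e c := by
  have key : ∀ (u : List ι) (i : ι) (y : TensorAlgebra k V), y ∈ nullSpace e c →
      derivsForm e c u (y * TensorAlgebra.ι k (e i)) = 0 := by
    intro u
    induction u with
    | nil => intro i y _; simp [derivsForm_nil, TensorAlgebra.algebraMapInv]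
    | cons p u ih =>
      intro i y hy
      rw [derivsForm_cons, deriv_mul_ι (coef_braid e hc), map_add,
        ih _ _ (deriv_mem_nullSpace _ hy), zero_add]
      exact mem_nullSpace.mp (slice_freeCoaction_mem_nullSpace _ hy) u
  rw [← e.sum_repr v, map_sum, Finset.mul_sum]
  refine Submodule.sum_mem _ fun i _ => ?_
  rw [map_smul, mul_smul_comm]
  exact Submodule.smul_mem _ _ (mem_nullSpace.mpr fun u => key u i y hy)

variable (e) in
/-- The null space as an ideal; it is two-sided. -/
def nullIdeal (c : V ⊗[k] V ≃ₗ[k] V ⊗[k] V) : Ideal (TensorAlgebra k V) where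
  __ := (nullSpace e c).toAddSubmonoid
  smul_mem' x y hy := by
    change x * y ∈ nullSpace e c
    replace hy : y ∈ nullSpace e c := hy
    induction x using TensorAlgebra.induction generalizing y with
    | algebraMap s => rw [← Algebra.smul_def]; exact Submodule.smul_mem _ _ hy
    | ι v => exact ι_mul_mem_nullSpace v hy
    | mul a b ha hb => rw [mul_assoc]; exact ha _ (hb _ hy)
    | add a b ha hb => rw [add_mul]; exact add_mem (ha _ hy) (hb _ hy)

theorem isTwoSided_nullIdeal (hc : IsBraiding c) : (nullIdeal e c).IsTwoSided where
  mul_mem_of_left {y} x hy := by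
    change y * x ∈ nullSpace e c
    replace hy : y ∈ nullSpace e c := hy
    induction x using TensorAlgebra.induction generalizing y with
    | algebraMap s => rw [← Algebra.commutes, ← Algebra.smul_def]; exact Submodule.smul_mem _ _ hy
    | ι v => exact mul_ι_mem_nullSpace hc v hy
    | mul a b ha hb => rw [← mul_assoc]; exact hb (ha hy)
    | add a b ha hb => rw [mul_add]; exact add_mem (ha hy) (hb hy)

/-- One direction needs the null space to be a two-sided ideal, so that the quotient by it is an
algebra in which the defining relations of B hold. The other needs it to be graded: its components
of positive degree are in the kernels of the symmetrizers. -/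
theorem mk_eq_zero_iff (hc : IsBraiding c) (y : TensorAlgebra k V) :
    Nichols.mk e c y = 0 ↔ y ∈ nullSpace e c := by
  constructor
  · intro h
    have := isTwoSided_nullIdeal (e := e) hc
    let f : Nichols e c →ₐ[k] TensorAlgebra k V ⧸ nullIdeal e c := RingQuot.liftAlgHom k
      ⟨Ideal.Quotient.mkₐ k (nullIdeal e c), by
        rintro f _ ⟨m, _, hf, h⟩
        rw [map_zero]
        exact Ideal.Quotient.eq_zero_iff_mem.mpr ((symmetrizer_eq_zero_iff hc hf).mp h)⟩
    have h1 : f (Nichols.mk e c y) = Ideal.Quotient.mkₐ k (nullIdeal e c) y :=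
      RingQuot.liftAlgHom_mkAlgHom_apply ..
    rw [h, map_zero] at h1
    exact Ideal.Quotient.eq_zero_iff_mem.mp h1.symm
  · intro h
    classical
    rw [← DirectSum.sum_support_decompose (tensorPow k V) y, map_sum]
    refine Finset.sum_eq_zero fun n _ => ?_
    -- A functional with n derivations sees only the component of degree n, so homogeneous
    -- components of null elements are null.
    have h1 : (DirectSum.decompose (tensorPow k V) y n : TensorAlgebra k V) ∈ nullSpace e c := by
      refine mem_nullSpace.mpr fun u => ?_
      by_cases hu : u.length = n
      · subst hu
        have h2 := mem_nullSpace.mp h u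
        rw [← DirectSum.sum_support_decompose (tensorPow k V) y, map_sum] at h2
        by_cases hs : u.length ∈ (DirectSum.decompose (tensorPow k V) y).support
        · rwa [Finset.sum_eq_single_of_mem _ hs fun n _ hn =>
            derivsForm_of_mem e c (SetLike.coe_mem _) u hn.symm] at h2
        · rw [DFinsupp.notMem_support_iff.mp hs]
          simp
      · exact derivsForm_of_mem e c (SetLike.coe_mem _) u hu
    have h3 : (DirectSum.decompose (tensorPow k V) y n : TensorAlgebra k V) ∈ tensorPow k V n :=
      SetLike.coe_mem _
    generalize (DirectSum.decompose (tensorPow k V) y n : TensorAlgebra k V) = z at h1 h3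
    cases n with
    | zero =>
      obtain ⟨s, rfl⟩ := mem_tensorPow_zero h3
      have h4 := mem_nullSpace.mp h1 []
      rw [derivsForm_nil, map_smul, map_one, smul_eq_mul, mul_one] at h4
      rw [h4, zero_smul, map_zero]
    | succ m =>
      exact (RingQuot.mkAlgHom_rel k (NicholsRel.mk m z h3
        ((symmetrizer_eq_zero_iff hc h3).mpr h1))).trans (map_zero _)

end Null
end
end NicholsFRT

namespace NicholsFRT

noncomputable section

/-! ### Subalgebras defined by identities in the Sweedler components -/

section Closure

variable {k : Type*} [Field k] {H : Type*} [Ring H] [Bialgebra k H]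
  {E : Type*} [Ring E] [Algebra k E]

theorem repr_sum_eq {C N : Type*} [AddCommGroup C] [Module k C] [Coalgebra k C] [AddCommGroup N]
    [Module k N] {κ : Type*} {a : C} (R : Coalgebra.Repr k a κ) (f : C ⊗[k] C →ₗ[k] N) :
    f (comul a) = ∑ i ∈ R.index, f (R.left i ⊗ₜ R.right i) := by
  rw [← R.eq, map_sum]

theorem repr_mul_sum_eq {κ κ' : Type*} {a b : H} (R : Coalgebra.Repr k a κ)
    (S : Coalgebra.Repr k b κ') {N : Type*} [AddCommGroup N] [Module k N] (f : H ⊗[k] H →ₗ[k] N) :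
    f (comul (a * b)) = ∑ i ∈ R.index, ∑ j ∈ S.index,
      f ((R.left i * S.left j) ⊗ₜ (R.right i * S.right j)) := by
  rw [Bialgebra.comul_mul, ← R.eq, ← S.eq]
  simp [Finset.sum_mul_sum, Algebra.TensorProduct.tmul_mul_tmul]

/-- The element `f(a₁) Z g(a₂)`. -/
def sandwich (f g : H →ₗ[k] E) (Z : E) : H →ₗ[k] E :=
  LinearMap.mul' k E ∘ₗ TensorProduct.map (LinearMap.mulRight k Z ∘ₗ f) g ∘ₗ comul

theorem sandwich_repr (f g : H →ₗ[k] E) (Z : E) {κ : Type*} {a : H} (R : Coalgebra.Repr k a κ) :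
    sandwich f g Z a = ∑ i ∈ R.index, f (R.left i) * Z * g (R.right i) :=
  (repr_sum_eq R (LinearMap.mul' k E ∘ₗ TensorProduct.map (LinearMap.mulRight k Z ∘ₗ f) g)).trans
    (by simp)

theorem sandwich_mul_repr (f g : H →ₗ[k] E) (Z : E) {κ κ' : Type*} {a b : H}
    (R : Coalgebra.Repr k a κ) (S : Coalgebra.Repr k b κ') :
    sandwich f g Z (a * b) = ∑ i ∈ R.index, ∑ j ∈ S.index,
      f (R.left i * S.left j) * Z * g (R.right i * S.right j) :=
  (repr_mul_sum_eq R S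
    (LinearMap.mul' k E ∘ₗ TensorProduct.map (LinearMap.mulRight k Z ∘ₗ f) g)).trans (by simp)

theorem sandwich_of_comul (f g : H →ₗ[k] E) (Z : E) {a : H} (ha : comul (R := k) a = a ⊗ₜ a) :
    sandwich f g Z a = f a * Z * g a := by
  simp [sandwich, ha]

theorem sandwich_algebraMap (f g : H →ₗ[k] E) (Z : E) (hf : f 1 = 1) (hg : g 1 = 1) (s : k) :
    sandwich f g Z (algebraMap k H s) = s • Z := by
  rw [Algebra.algebraMap_eq_smul_one, map_smul, sandwich_of_comul _ _ _ (by simp; rfl), hf, hg,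
    one_mul, mul_one]

/-- For algebra maps `ρ`, `ℓ` with commuting values, the `a` with
`ρ(a₁) ℓ(a₂) Y = Y ℓ(a₁) ρ(a₂)`. -/
def leftCommuting (ρ ℓ : H →ₐ[k] E) (h : ∀ a b, Commute (ρ a) (ℓ b)) (Y : E) :
    Subalgebra k H where
  carrier := {a | sandwich ρ.toLinearMap ℓ.toLinearMap 1 a * Y =
    Y * sandwich ℓ.toLinearMap ρ.toLinearMap 1 a}
  add_mem' {a b} ha hb := by
    simp only [Set.mem_ofPred_eq, map_add, add_mul, mul_add] at *
    rw [ha, hb]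
  algebraMap_mem' s := by
    simp [sandwich_algebraMap]
  mul_mem' {a b} ha hb := by
    have h1 : ∀ (f g : H →ₐ[k] E) (_ : ∀ a b, Commute (f a) (g b)),
        sandwich f.toLinearMap g.toLinearMap 1 (a * b) =
        sandwich f.toLinearMap g.toLinearMap 1 a * sandwich f.toLinearMap g.toLinearMap 1 b := by
      intro f g hfg
      rw [sandwich_mul_repr _ _ _ (ℛ k a) (ℛ k b), sandwich_repr _ _ _ (ℛ k a),
        sandwich_repr _ _ _ (ℛ k b), Finset.sum_mul_sum]
      refine Finset.sum_congr rfl fun i _ => Finset.sum_congr rfl fun j _ => ?_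
      simp only [AlgHom.toLinearMap_apply, map_mul, mul_one]
      rw [mul_assoc, ← mul_assoc (f _) (g _), (hfg _ _).eq]
      simp only [mul_assoc]
    simp only [Set.mem_ofPred_eq] at *
    rw [h1 ρ ℓ h, h1 ℓ ρ fun a b => (h b a).symm, mul_assoc, hb, ← mul_assoc, ha, mul_assoc]

theorem mem_leftCommuting {ρ ℓ : H →ₐ[k] E} {h : ∀ a b, Commute (ρ a) (ℓ b)} {Y : E} {a : H} :
    a ∈ leftCommuting ρ ℓ h Y ↔ sandwich ρ.toLinearMap ℓ.toLinearMap 1 a * Y =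
      Y * sandwich ℓ.toLinearMap ρ.toLinearMap 1 a := Iff.rfl

/-- For a group-like element the identity has a single term, and can be multiplied by inverses on
both sides. This supplies D⁻¹, which is not reached by sums and products of elements of A. -/
theorem inv_mem_leftCommuting {ρ ℓ : H →ₐ[k] E} {h : ∀ a b, Commute (ρ a) (ℓ b)} {Y : E}
    {a b : H} (hab : a * b = 1) (hba : b * a = 1) (ha' : comul (R := k) a = a ⊗ₜ a)
    (hb' : comul (R := k) b = b ⊗ₜ b) (ha : a ∈ leftCommuting ρ ℓ h Y) :
    b ∈ leftCommuting ρ ℓ h Y := by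
  rw [mem_leftCommuting] at *
  simp only [sandwich_of_comul _ _ _ ha', sandwich_of_comul _ _ _ hb', AlgHom.toLinearMap_apply,
    mul_one] at *
  have h1 : ρ b * ℓ b * (ρ a * ℓ a) = 1 := by
    rw [(h a a).eq, mul_assoc, ← mul_assoc (ℓ b), ← map_mul, hba, map_one, one_mul, ← map_mul, hba,
      map_one]
  have h2 : ℓ a * ρ a * (ℓ b * ρ b) = 1 := by
    rw [← (h b b).eq, mul_assoc, ← mul_assoc (ρ a), ← map_mul, hab, map_one, one_mul, ← map_mul,
      hab, map_one]
  have h3 : ρ b * ℓ b * (Y * (ℓ a * ρ a)) = Y := by rw [← ha, ← mul_assoc, h1, one_mul]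
  calc ρ b * ℓ b * Y = ρ b * ℓ b * (Y * (ℓ a * ρ a)) * (ℓ b * ρ b) := by
        rw [mul_assoc (ρ b * ℓ b) _ (ℓ b * ρ b), mul_assoc Y, h2, mul_one]
    _ = Y * (ℓ b * ρ b) := by rw [h3]

theorem sum_sandwich {κ : Type*} (s : Finset κ) (x y : κ → E) (f g : H →ₗ[k] E) (Z : E) (a : H) :
    ∑ j ∈ s, x j * sandwich f g Z a * y j = ∑ j ∈ s, ∑ i ∈ (ℛ k a).index,
      x j * (f ((ℛ k a).left i) * Z * g ((ℛ k a).right i)) * y j := by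
  simp only [sandwich_repr _ _ _ (ℛ k a), Finset.mul_sum, Finset.sum_mul]

/-- For an algebra antihomomorphism `ρ` and an algebra map `ℓ` with commuting values, the `b` with
`ρ(b₁) X ℓ(b₂) = ℓ(b₁) X ρ(b₂)`. -/
def rightCommuting (ρ : H →ₗ[k] E) (ℓ : H →ₐ[k] E) (hρ1 : ρ 1 = 1)
    (hρ : ∀ a b, ρ (a * b) = ρ b * ρ a) (h : ∀ a b, Commute (ρ a) (ℓ b)) (X : E) :
    Subalgebra k H where
  carrier := {a | sandwich ρ ℓ.toLinearMap X a = sandwich ℓ.toLinearMap ρ X a}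
  add_mem' {a b} ha hb := by
    simp only [Set.mem_ofPred_eq, map_add] at *
    rw [ha, hb]
  algebraMap_mem' s := by simp [sandwich_algebraMap, hρ1]
  mul_mem' {a b} ha hb := by
    simp only [Set.mem_ofPred_eq] at *
    -- The chain is ρ(b₁)ρ(a₁) X ℓ(a₂)ℓ(b₂) = ρ(b₁)ℓ(a₁) X ρ(a₂)ℓ(b₂) = ℓ(a₁)ρ(b₁) X ℓ(b₂)ρ(a₂) =
    -- ℓ(a₁)ℓ(b₁) X ρ(b₂)ρ(a₂), where the middle step uses that the values of ρ and ℓ commute.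
    have h1 := sum_sandwich (ℛ k b).index (fun j => ρ ((ℛ k b).left j))
      (fun j => ℓ ((ℛ k b).right j)) ρ ℓ.toLinearMap X a
    have h2 := sum_sandwich (ℛ k b).index (fun j => ρ ((ℛ k b).left j))
      (fun j => ℓ ((ℛ k b).right j)) ℓ.toLinearMap ρ X a
    have h3 := sum_sandwich (ℛ k a).index (fun j => ℓ ((ℛ k a).left j))
      (fun j => ρ ((ℛ k a).right j)) ρ ℓ.toLinearMap X b
    have h4 := sum_sandwich (ℛ k a).index (fun j => ℓ ((ℛ k a).left j))
      (fun j => ρ ((ℛ k a).right j)) ℓ.toLinearMap ρ X b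
    rw [← ha, h1] at h2
    rw [← hb, h3] at h4
    rw [sandwich_mul_repr _ _ _ (ℛ k a) (ℛ k b), sandwich_mul_repr _ _ _ (ℛ k a) (ℛ k b)]
    simp only [AlgHom.toLinearMap_apply, map_mul, hρ] at *
    refine Eq.trans (Finset.sum_comm.trans ?_) (h2.trans (Finset.sum_comm.trans ?_))
    · exact Finset.sum_congr rfl fun i _ => Finset.sum_congr rfl fun j _ => by
        simp only [mul_assoc]
    · refine Eq.trans ?_ (h4.trans ?_)
      · refine Finset.sum_congr rfl fun i _ => Finset.sum_congr rfl fun j _ => ?_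
        rw [← mul_assoc, ← mul_assoc, (h _ _).eq, mul_assoc, (h _ _).eq]
        simp only [mul_assoc]
      · exact Finset.sum_congr rfl fun i _ => Finset.sum_congr rfl fun j _ => by
          simp only [mul_assoc]

theorem mem_rightCommuting {ρ : H →ₗ[k] E} {ℓ : H →ₐ[k] E} {hρ1 : ρ 1 = 1}
    {hρ : ∀ a b, ρ (a * b) = ρ b * ρ a} {h : ∀ a b, Commute (ρ a) (ℓ b)} {X : E} {a : H} :
    a ∈ rightCommuting ρ ℓ hρ1 hρ h X ↔
      sandwich ρ ℓ.toLinearMap X a = sandwich ℓ.toLinearMap ρ X a := Iff.rfl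

theorem inv_mem_rightCommuting {ρ : H →ₗ[k] E} {ℓ : H →ₐ[k] E} {hρ1 : ρ 1 = 1}
    {hρ : ∀ a b, ρ (a * b) = ρ b * ρ a} {h : ∀ a b, Commute (ρ a) (ℓ b)} {X : E}
    {a b : H} (hab : a * b = 1) (hba : b * a = 1) (ha' : comul (R := k) a = a ⊗ₜ a)
    (hb' : comul (R := k) b = b ⊗ₜ b) (ha : a ∈ rightCommuting ρ ℓ hρ1 hρ h X) :
    b ∈ rightCommuting ρ ℓ hρ1 hρ h X := by
  rw [mem_rightCommuting] at *
  simp only [sandwich_of_comul _ _ _ ha', sandwich_of_comul _ _ _ hb',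
    AlgHom.toLinearMap_apply] at *
  have h1 : ρ a * ρ b = 1 := by rw [← hρ, hba, hρ1]
  have h2 : ρ b * ρ a = 1 := by rw [← hρ, hab, hρ1]
  have h3 : ℓ b * ℓ a = 1 := by rw [← map_mul, hba, map_one]
  have h4 : ℓ a * ℓ b = 1 := by rw [← map_mul, hab, map_one]
  calc ρ b * X * ℓ b = (ℓ b * ℓ a) * (ρ b * X * ℓ b) * (ρ a * ρ b) := by
        rw [h3, h1, one_mul, mul_one]
    _ = ℓ b * (ℓ a * ρ b) * X * (ℓ b * ρ a) * ρ b := by simp only [mul_assoc]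
    _ = ℓ b * ρ b * (ℓ a * X * ρ a) * ℓ b * ρ b := by
        rw [← (h b a).eq, ← (h a b).eq]; simp only [mul_assoc]
    _ = ℓ b * ρ b * (ρ a * X * ℓ a) * ℓ b * ρ b := by rw [ha]
    _ = ℓ b * (ρ b * ρ a) * X * (ℓ a * ℓ b) * ρ b := by simp only [mul_assoc]
    _ = ℓ b * X * ρ b := by rw [h2, h4, mul_one, mul_one]

/-- For maps `ρ`, `σ` that preserve or reverse products, the `a` with `ρ(a₁) σ(a₂) = ε(a)`. -/
def convInverse (ρ σ : H →ₗ[k] E) (hρ1 : ρ 1 = 1) (hσ1 : σ 1 = 1)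
    (h : (∀ a b, ρ (a * b) = ρ a * ρ b ∧ σ (a * b) = σ b * σ a) ∨
      (∀ a b, ρ (a * b) = ρ b * ρ a ∧ σ (a * b) = σ a * σ b)) : Subalgebra k H where
  carrier := {a | sandwich ρ σ 1 a = algebraMap k E (counit a)}
  add_mem' {a b} ha hb := by
    simp only [Set.mem_ofPred_eq, map_add] at *
    rw [ha, hb]
  algebraMap_mem' s := by
    rw [Set.mem_ofPred_eq, sandwich_algebraMap _ _ _ hρ1 hσ1, Algebra.algebraMap_eq_smul_one s]
    simp [Algebra.algebraMap_eq_smul_one]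
  mul_mem' {a b} ha hb := by
    simp only [Set.mem_ofPred_eq] at *
    rw [sandwich_mul_repr _ _ _ (ℛ k a) (ℛ k b)]
    rcases h with h | h
    -- The product telescopes: ρ(a₁) (ρ(b₁)σ(b₂)) σ(a₂) = ε(b) ρ(a₁)σ(a₂). In the other case the
    -- roles of a and b are exchanged.
    · have h1 := sum_sandwich (ℛ k a).index (fun j => ρ ((ℛ k a).left j))
        (fun j => σ ((ℛ k a).right j)) ρ σ 1 b
      simp only [hb, ← Algebra.commutes (counit (R := k) b), mul_assoc] at h1
      rw [← Finset.mul_sum] at h1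
      rw [sandwich_repr _ _ _ (ℛ k a)] at ha
      simp only [mul_one] at ha h1
      rw [ha, ← map_mul, ← mul_comm, ← Bialgebra.counit_mul] at h1
      rw [h1]
      simp only [h, mul_assoc, one_mul]
    · have h1 := sum_sandwich (ℛ k b).index (fun j => ρ ((ℛ k b).left j))
        (fun j => σ ((ℛ k b).right j)) ρ σ 1 a
      simp only [ha, ← Algebra.commutes (counit (R := k) a), mul_assoc] at h1
      rw [← Finset.mul_sum] at h1
      rw [sandwich_repr _ _ _ (ℛ k b)] at hb
      simp only [mul_one] at hb h1
      rw [hb, ← map_mul, ← Bialgebra.counit_mul] at h1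
      rw [h1, Finset.sum_comm]
      simp only [h, mul_assoc, one_mul]

theorem mem_convInverse {ρ σ : H →ₗ[k] E} {hρ1 : ρ 1 = 1} {hσ1 : σ 1 = 1}
    {h : (∀ a b, ρ (a * b) = ρ a * ρ b ∧ σ (a * b) = σ b * σ a) ∨
      (∀ a b, ρ (a * b) = ρ b * ρ a ∧ σ (a * b) = σ a * σ b)} {a : H} :
    a ∈ convInverse ρ σ hρ1 hσ1 h ↔ sandwich ρ σ 1 a = algebraMap k E (counit a) := Iff.rfl

end Closure
end
end NicholsFRT

namespace NicholsFRT

noncomputable section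

/-! ### Pairings of bialgebras and their convolution inverses -/

section Pairing

variable {k : Type*} [Field k] {A B : Type*} [Ring A] [Bialgebra k A] [Ring B] [Bialgebra k B]

theorem sum_comm₄' {M κ₁ κ₂ κ₃ κ₄ : Type*} [AddCommMonoid M] (s₁ : Finset κ₁) (s₂ : Finset κ₂)
    (s₃ : Finset κ₃) (s₄ : Finset κ₄) (F : κ₁ → κ₂ → κ₃ → κ₄ → M) :
    ∑ p ∈ s₁, ∑ q ∈ s₂, ∑ r ∈ s₃, ∑ s ∈ s₄, F p q r s =
      ∑ r ∈ s₃, ∑ s ∈ s₄, ∑ p ∈ s₁, ∑ q ∈ s₂, F p q r s := by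
  rw [Finset.sum_congr rfl fun p _ => Finset.sum_comm, Finset.sum_comm]
  refine Finset.sum_congr rfl fun r _ => ?_
  rw [Finset.sum_congr rfl fun p _ => Finset.sum_comm, Finset.sum_comm]

/-- A bialgebra pairing with `r(ab, c) = r(a, c₁) r(b, c₂)` and `r(a, bc) = r(a₂, b) r(a₁, c)`. -/
structure IsPairing (r : A ⊗[k] B →ₗ[k] k) : Prop where
  one_left : ∀ b, r (1 ⊗ₜ b) = counit b
  one_right : ∀ a, r (a ⊗ₜ 1) = counit a
  mul_left : ∀ a a' b, r ((a * a') ⊗ₜ b) =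
    LinearMap.mul' k k (TensorProduct.map (curry r a) (curry r a') (comul b))
  mul_right : ∀ a b b', r (a ⊗ₜ (b * b')) =
    LinearMap.mul' k k (TensorProduct.map ((curry r).flip b') ((curry r).flip b) (comul a))

theorem mul_left_repr {r : A ⊗[k] B →ₗ[k] k} {a a' : A} {b : B} {κ : Type*}
    (h : r ((a * a') ⊗ₜ b) =
      LinearMap.mul' k k (TensorProduct.map (curry r a) (curry r a') (comul b)))
    (R : Coalgebra.Repr k b κ) :
    r ((a * a') ⊗ₜ b) = ∑ i ∈ R.index, r (a ⊗ₜ R.left i) * r (a' ⊗ₜ R.right i) :=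
  h.trans ((repr_sum_eq R (LinearMap.mul' k k ∘ₗ
    TensorProduct.map (curry r a) (curry r a'))).trans (by simp))

theorem mul_right_repr {r : A ⊗[k] B →ₗ[k] k} {a : A} {b b' : B} {κ : Type*}
    (h : r (a ⊗ₜ (b * b')) =
      LinearMap.mul' k k (TensorProduct.map ((curry r).flip b') ((curry r).flip b) (comul a)))
    (R : Coalgebra.Repr k a κ) :
    r (a ⊗ₜ (b * b')) = ∑ i ∈ R.index, r (R.left i ⊗ₜ b') * r (R.right i ⊗ₜ b) :=
  h.trans ((repr_sum_eq R (LinearMap.mul' k k ∘ₗ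
    TensorProduct.map ((curry r).flip b') ((curry r).flip b))).trans (by simp))

/-- For a form with `r(a, bc) = r(a₂, b) r(a₁, c)`, the `b` with `r(aa', b) = r(a, b₁) r(a', b₂)`
for all `a`, `a'`. -/
def leftSplitting (r : A ⊗[k] B →ₗ[k] k) (h1 : ∀ a, r (a ⊗ₜ 1) = counit a)
    (hmul : ∀ a b b', r (a ⊗ₜ (b * b')) =
      LinearMap.mul' k k (TensorProduct.map ((curry r).flip b') ((curry r).flip b) (comul a))) :
    Subalgebra k B where
  carrier := {b | ∀ a a', r ((a * a') ⊗ₜ b) =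
    LinearMap.mul' k k (TensorProduct.map (curry r a) (curry r a') (comul b))}
  add_mem' {b c} hb hc a a' := by simp only [tmul_add, map_add, hb a a', hc a a']
  algebraMap_mem' s a a' := by
    simp [Algebra.algebraMap_eq_smul_one, h1, Algebra.TensorProduct.one_def]
  mul_mem' {b c} hb hc a a' := by
    have h2 := fun x x' => mul_left_repr (hb x x') (ℛ k b)
    have h3 := fun x x' => mul_left_repr (hc x x') (ℛ k c)
    have h4 := fun x y y' => mul_right_repr (hmul x y y') (ℛ k x)
    have h5 : r ((a * a') ⊗ₜ (b * c)) = ∑ i ∈ (ℛ k a).index, ∑ j ∈ (ℛ k a').index,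
        r (((ℛ k a).left i * (ℛ k a').left j) ⊗ₜ c) *
          r (((ℛ k a).right i * (ℛ k a').right j) ⊗ₜ b) :=
      (hmul _ b c).trans ((repr_mul_sum_eq (ℛ k a) (ℛ k a') (LinearMap.mul' k k ∘ₗ
        TensorProduct.map ((curry r).flip c) ((curry r).flip b))).trans (by simp))
    have h6 : LinearMap.mul' k k (TensorProduct.map (curry r a) (curry r a') (comul (b * c))) =
        ∑ i ∈ (ℛ k b).index, ∑ j ∈ (ℛ k c).index,
        r (a ⊗ₜ ((ℛ k b).left i * (ℛ k c).left j)) *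
          r (a' ⊗ₜ ((ℛ k b).right i * (ℛ k c).right j)) :=
      (repr_mul_sum_eq (ℛ k b) (ℛ k c) (LinearMap.mul' k k ∘ₗ
        TensorProduct.map (curry r a) (curry r a'))).trans (by simp)
    rw [h5, h6]
    simp only [h2, h3, h4, Finset.sum_mul_sum]
    -- Both sides are r(a₁, c₁) r(a'₁, c₂) r(a₂, b₁) r(a'₂, b₂), summed in different orders.
    refine Eq.trans ?_ (sum_comm₄' _ _ _ _ _)
    refine Finset.sum_congr rfl fun i _ => Finset.sum_congr rfl fun j _ => ?_
    rw [Finset.sum_comm]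
    exact Finset.sum_congr rfl fun p _ => Finset.sum_congr rfl fun q _ => by ring

/-- For a form with `r(ab, c) = r(a, c₁) r(b, c₂)`, the `a` with `r(a, bb') = r(a₂, b) r(a₁, b')`
for all `b`, `b'`. -/
def rightSplitting (r : A ⊗[k] B →ₗ[k] k) (h1 : ∀ b, r (1 ⊗ₜ b) = counit b)
    (hmul : ∀ a a' b, r ((a * a') ⊗ₜ b) =
      LinearMap.mul' k k (TensorProduct.map (curry r a) (curry r a') (comul b))) :
    Subalgebra k A where
  carrier := {a | ∀ b b', r (a ⊗ₜ (b * b')) =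
    LinearMap.mul' k k (TensorProduct.map ((curry r).flip b') ((curry r).flip b) (comul a))}
  add_mem' {b c} hb hc a a' := by simp only [add_tmul, map_add, hb a a', hc a a']
  algebraMap_mem' s a a' := by
    simp [Algebra.algebraMap_eq_smul_one, h1, Algebra.TensorProduct.one_def,
      ← TensorProduct.smul_tmul', mul_comm]
  mul_mem' {b c} hb hc a a' := by
    have h2 := fun x x' => mul_right_repr (hb x x') (ℛ k b)
    have h3 := fun x x' => mul_right_repr (hc x x') (ℛ k c)
    have h4 := fun y y' x => mul_left_repr (hmul y y' x) (ℛ k x)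
    have h5 : r ((b * c) ⊗ₜ (a * a')) = ∑ i ∈ (ℛ k a).index, ∑ j ∈ (ℛ k a').index,
        r (b ⊗ₜ ((ℛ k a).left i * (ℛ k a').left j)) *
          r (c ⊗ₜ ((ℛ k a).right i * (ℛ k a').right j)) :=
      (hmul b c _).trans ((repr_mul_sum_eq (ℛ k a) (ℛ k a') (LinearMap.mul' k k ∘ₗ
        TensorProduct.map (curry r b) (curry r c))).trans (by simp))
    have h6 : LinearMap.mul' k k (TensorProduct.map ((curry r).flip a') ((curry r).flip a)
        (comul (b * c))) = ∑ i ∈ (ℛ k b).index, ∑ j ∈ (ℛ k c).index,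
        r (((ℛ k b).left i * (ℛ k c).left j) ⊗ₜ a') *
          r (((ℛ k b).right i * (ℛ k c).right j) ⊗ₜ a) :=
      (repr_mul_sum_eq (ℛ k b) (ℛ k c) (LinearMap.mul' k k ∘ₗ
        TensorProduct.map ((curry r).flip a') ((curry r).flip a))).trans (by simp)
    rw [h5, h6]
    simp only [h2, h3, h4, Finset.sum_mul_sum]
    refine Finset.sum_comm.trans (Eq.trans ?_ (sum_comm₄' _ _ _ _ _))
    refine Finset.sum_congr rfl fun i _ => Finset.sum_congr rfl fun j _ => ?_
    exact Finset.sum_congr rfl fun p _ => Finset.sum_congr rfl fun q _ => by ring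

/-- The linear map `a ↦ r(a, -)`. -/
def leftLin (r : A ⊗[k] B →ₗ[k] k) : A →ₗ[k] WithConv (B →ₗ[k] k) where
  toFun a := WithConv.toConv (curry r a)
  map_add' a b := by simp
  map_smul' s a := by simp

/-- The linear map `b ↦ r(-, b)`. -/
def rightLin (r : A ⊗[k] B →ₗ[k] k) : B →ₗ[k] WithConv (A →ₗ[k] k) where
  toFun b := WithConv.toConv ((curry r).flip b)
  map_add' a b := by simp
  map_smul' s a := by simp

/-- An antimultiplicative map as an algebra map to the opposite algebra. -/
def antiHom {H E : Type*} [Ring H] [Algebra k H] [Ring E] [Algebra k E] (f : H →ₗ[k] E)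
    (h1 : f 1 = 1) (hmul : ∀ a b, f (a * b) = f b * f a) : H →ₐ[k] Eᵐᵒᵖ :=
  AlgHom.ofLinearMap ((MulOpposite.opLinearEquiv k).toLinearMap ∘ₗ f)
    (by simp [h1]) (fun a b => by simp [hmul])

namespace IsPairing

variable {r : A ⊗[k] B →ₗ[k] k} (hr : IsPairing r)

/-- The algebra map `a ↦ r(a, -)`. -/
def leftHom : A →ₐ[k] WithConv (B →ₗ[k] k) :=
  AlgHom.ofLinearMap (leftLin r)
    (WithConv.ext (LinearMap.ext fun b => hr.one_left b))
    (fun a a' => WithConv.ext (LinearMap.ext fun b => hr.mul_left a a' b))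

include hr in
theorem rightLin_one : rightLin r 1 = 1 :=
  WithConv.ext (LinearMap.ext fun a => hr.one_right a)

include hr in
theorem rightLin_mul (b b' : B) : rightLin r (b * b') = rightLin r b' * rightLin r b :=
  WithConv.ext (LinearMap.ext fun a => hr.mul_right a b b')

include hr in
theorem leftLin_one : leftLin r 1 = 1 :=
  WithConv.ext (LinearMap.ext fun a => hr.one_left a)

include hr in
theorem leftLin_mul (a a' : A) : leftLin r (a * a') = leftLin r a * leftLin r a' :=
  WithConv.ext (LinearMap.ext fun b => hr.mul_left a a' b)

/-- The algebra map `b ↦ r(-, b)` to the opposite convolution algebra. -/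
def rightHom : B →ₐ[k] (WithConv (A →ₗ[k] k))ᵐᵒᵖ :=
  antiHom (rightLin r) hr.rightLin_one hr.rightLin_mul

end IsPairing

/-- The form `b ⊗ a ↦ r(a, b)`. -/
def swapForm (r : A ⊗[k] B →ₗ[k] k) : B ⊗[k] A →ₗ[k] k :=
  r ∘ₗ (TensorProduct.comm k B A).toLinearMap

theorem convMul_tmul_repr {R : Type*} [Ring R] [Algebra k R] (f g : A ⊗[k] B →ₗ[k] R) {κ κ' : Type*}
    {a : A} {b : B} (S : Coalgebra.Repr k a κ) (T : Coalgebra.Repr k b κ') :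
    (WithConv.toConv f * WithConv.toConv g) (a ⊗ₜ b) = ∑ i ∈ S.index, ∑ j ∈ T.index,
      f (S.left i ⊗ₜ T.left j) * g (S.right i ⊗ₜ T.right j) := by
  rw [LinearMap.convMul_apply, TensorProduct.comul_tmul, ← S.eq, ← T.eq]
  simp [sum_tmul, tmul_sum]
  rw [Finset.sum_comm]

/-- A pairing `r` of `A` and `B` and a pairing `s` of `B` and `A` with `r(a₁, b₁) s(b₂, a₂) =
ε(a) ε(b) = s(b₁, a₁) r(a₂, b₂)`. -/
structure IsInvPairing (r : A ⊗[k] B →ₗ[k] k) (s : B ⊗[k] A →ₗ[k] k) : Prop where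
  left : IsPairing r
  right : IsPairing s
  mul_inv : WithConv.toConv r * WithConv.toConv (swapForm s) = 1
  inv_mul : WithConv.toConv (swapForm s) * WithConv.toConv r = 1

theorem convMul_repr {C R : Type*} [AddCommGroup C] [Module k C] [Coalgebra k C] [Ring R]
    [Algebra k R] (f g : WithConv (C →ₗ[k] R)) {κ : Type*} {a : C} (S : Coalgebra.Repr k a κ) :
    (f * g) a = ∑ i ∈ S.index, f (S.left i) * g (S.right i) :=
  (repr_sum_eq S (LinearMap.mul' k R ∘ₗ TensorProduct.map f.ofConv g.ofConv)).trans (by simp)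

theorem sandwich_conv_apply {C R : Type*} [AddCommGroup C] [Module k C] [Coalgebra k C] [Ring R]
    [Algebra k R] (f g : B →ₗ[k] WithConv (C →ₗ[k] R)) (Z : WithConv (C →ₗ[k] R)) {κ κ' : Type*}
    {a : C} {b : B} (S : Coalgebra.Repr k a κ) (T : Coalgebra.Repr k b κ') :
    sandwich f g Z b a = ∑ j ∈ T.index, ∑ i ∈ S.index,
      (f (T.left j) * Z) (S.left i) * g (T.right j) (S.right i) := by
  rw [sandwich_repr _ _ _ T]
  simp only [← convMul_repr]
  exact (congrArg (fun f : C →ₗ[k] R => f a) (WithConv.ofConv_sum _ _)).trans (LinearMap.sum_apply _ _ _)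

/-- For fixed b the equation is r(-, b₁) s(b₂, -) = ε(b) in the dual algebra of A. This is the shape
required by `convInverse`, so it can be checked on generators b. -/
theorem conv_eq_one_iff (r : A ⊗[k] B →ₗ[k] k) (s : B ⊗[k] A →ₗ[k] k) :
    WithConv.toConv r * WithConv.toConv (swapForm s) = 1 ↔
      ∀ b, sandwich (rightLin r) (leftLin s) 1 b = algebraMap k _ (counit b) := by
  have h : ∀ a b, (WithConv.toConv r * WithConv.toConv (swapForm s)) (a ⊗ₜ b) =
      sandwich (rightLin r) (leftLin s) 1 b a := fun a b => by
    rw [convMul_tmul_repr _ _ (ℛ k a) (ℛ k b), sandwich_conv_apply _ _ _ (ℛ k a) (ℛ k b),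
      Finset.sum_comm]
    simp only [mul_one]
    rfl
  have h1 : ∀ a b, (1 : WithConv (A ⊗[k] B →ₗ[k] k)) (a ⊗ₜ b) =
      (algebraMap k (WithConv (A →ₗ[k] k)) (counit b)) a := fun a b => by
    rw [Algebra.algebraMap_eq_smul_one]
    change counit (R := k) (a ⊗ₜ[k] b) = counit (R := k) b * counit (R := k) a
    simp
  constructor
  · intro H b
    refine WithConv.ext (LinearMap.ext fun a => ?_)
    exact (h a b).symm.trans ((congrArg (fun f => f (a ⊗ₜ b)) H).trans (h1 a b))
  · intro H
    refine WithConv.ext (TensorProduct.ext' fun a b => ?_)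
    exact (h a b).trans ((congrArg (fun f => f a) (H b)).trans (h1 a b).symm)

theorem conv_eq_one_iff' (r : A ⊗[k] B →ₗ[k] k) (s : B ⊗[k] A →ₗ[k] k) :
    WithConv.toConv (swapForm s) * WithConv.toConv r = 1 ↔
      ∀ b, sandwich (leftLin s) (rightLin r) 1 b = algebraMap k _ (counit b) := by
  have h : ∀ a b, (WithConv.toConv (swapForm s) * WithConv.toConv r) (a ⊗ₜ b) =
      sandwich (leftLin s) (rightLin r) 1 b a := fun a b => by
    rw [convMul_tmul_repr _ _ (ℛ k a) (ℛ k b), sandwich_conv_apply _ _ _ (ℛ k a) (ℛ k b),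
      Finset.sum_comm]
    simp only [mul_one]
    rfl
  have h1 : ∀ a b, (1 : WithConv (A ⊗[k] B →ₗ[k] k)) (a ⊗ₜ b) =
      (algebraMap k (WithConv (A →ₗ[k] k)) (counit b)) a := fun a b => by
    rw [Algebra.algebraMap_eq_smul_one]
    change counit (R := k) (a ⊗ₜ[k] b) = counit (R := k) b * counit (R := k) a
    simp
  constructor
  · intro H b
    refine WithConv.ext (LinearMap.ext fun a => ?_)
    exact (h a b).symm.trans ((congrArg (fun f => f (a ⊗ₜ b)) H).trans (h1 a b))
  · intro H
    refine WithConv.ext (TensorProduct.ext' fun a b => ?_)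
    exact (h a b).trans ((congrArg (fun f => f a) (H b)).trans (h1 a b).symm)

theorem swapForm_swapForm (s : A ⊗[k] B →ₗ[k] k) : swapForm (swapForm s) = s :=
  TensorProduct.ext' fun _ _ => rfl

theorem swapForm_mul_eq_one {f g : A ⊗[k] B →ₗ[k] k}
    (hfg : WithConv.toConv f * WithConv.toConv g = 1) :
    WithConv.toConv (swapForm f) * WithConv.toConv (swapForm g) = 1 := by
  refine WithConv.ext (TensorProduct.ext' fun b a => ?_)
  have h1 := congrArg (fun f => f (a ⊗ₜ[k] b)) hfg
  have h2 : (WithConv.toConv (swapForm f) * WithConv.toConv (swapForm g)) (b ⊗ₜ[k] a) =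
      (WithConv.toConv f * WithConv.toConv g) (a ⊗ₜ[k] b) := by
    rw [convMul_tmul_repr _ _ (ℛ k a) (ℛ k b), convMul_tmul_repr _ _ (ℛ k b) (ℛ k a),
      Finset.sum_comm]
    rfl
  refine h2.trans (h1.trans ?_)
  change counit (R := k) (a ⊗ₜ[k] b) = counit (R := k) (b ⊗ₜ[k] a)
  simp [mul_comm]

/-- A convolution inverse obeys the product rules in the opposite order, and exchanging the
arguments restores them. So the notion is symmetric, and a construction in one argument gives the
same in the other. -/
theorem IsInvPairing.symm {r : A ⊗[k] B →ₗ[k] k} {s : B ⊗[k] A →ₗ[k] k} (h : IsInvPairing r s) :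
    IsInvPairing s r :=
  ⟨h.right, h.left, swapForm_swapForm s ▸ swapForm_mul_eq_one h.inv_mul,
    swapForm_swapForm s ▸ swapForm_mul_eq_one h.mul_inv⟩

end Pairing
end
end NicholsFRT

namespace NicholsFRT

noncomputable section

/-! ### Extension of a pairing to the localization in one argument -/

section Extension

variable {k : Type*} [Field k] {A B : Type*} [Ring A] [Bialgebra k A] [Ring B] [Bialgebra k B]

theorem Loc.mem_of_subalgebra {D : GroupLike k B} (S : Subalgebra k (Loc D))
    (h1 : ∀ b, Loc.of D b ∈ S) (h2 : Loc.inv D ∈ S) (x : Loc D) : x ∈ S := by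
  obtain ⟨a, rfl⟩ : ∃ a, RingQuot.mkAlgHom k (LocRel (k := k) D.val) a = x :=
    RingQuot.mkAlgHom_surjective k _ x
  induction a using FreeAlgebra.induction with
  | grade0 s => rw [AlgHom.commutes]; exact S.algebraMap_mem s
  | grade1 x =>
    cases x with
    | none => exact h2
    | some b => exact h1 b
  | add a b ha hb => rw [map_add]; exact add_mem ha hb
  | mul a b ha hb => rw [map_mul]; exact mul_mem ha hb

theorem comul_groupLike (D : GroupLike k B) : comul (R := k) D.val = D.val ⊗ₜ D.val :=
  D.isGroupLikeElem_val.comul_eq_tmul_self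

theorem counit_groupLike (D : GroupLike k B) : counit (R := k) D.val = 1 :=
  D.isGroupLikeElem_val.counit_eq_one

/-- The form on `A ⊗ B` with given values `f(b)(a)`. -/
def formOfRight (f : B →ₗ[k] WithConv (A →ₗ[k] k)) : A ⊗[k] B →ₗ[k] k :=
  TensorProduct.lift ((WithConv.linearEquiv k (A →ₗ[k] k)).toLinearMap ∘ₗ f).flip

variable {r : A ⊗[k] B →ₗ[k] k} {s : B ⊗[k] A →ₗ[k] k}

/-- For a group-like D the inversion identity has one term, so r(-, D) is a unit of the dual
algebra, with inverse s(D, -). -/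
theorem IsInvPairing.rightLin_mul_leftLin (h : IsInvPairing r s) (D : GroupLike k B) :
    rightLin r D.val * leftLin s D.val = 1 := by
  have := (conv_eq_one_iff r s).mp h.mul_inv D.val
  rwa [sandwich_of_comul _ _ _ (comul_groupLike D), counit_groupLike, map_one, mul_one] at this

theorem IsInvPairing.leftLin_mul_rightLin (h : IsInvPairing r s) (D : GroupLike k B) :
    leftLin s D.val * rightLin r D.val = 1 := by
  have := (conv_eq_one_iff' r s).mp h.inv_mul D.val
  rwa [sandwich_of_comul _ _ _ (comul_groupLike D), counit_groupLike, map_one, mul_one] at this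

theorem curry_map_comul_of {D : GroupLike k B} {N : Type*} [AddCommGroup N] [Module k N]
    (f : Loc D ⊗[k] Loc D →ₗ[k] N) (g : B ⊗[k] B →ₗ[k] N)
    (h : ∀ b b', f (Loc.of D b ⊗ₜ Loc.of D b') = g (b ⊗ₜ b')) (b : B) :
    f (comul (Loc.of D b)) = g (comul b) := by
  rw [Loc.comul_of]
  have : f ∘ₗ TensorProduct.map (Loc.of D).toLinearMap (Loc.of D).toLinearMap = g :=
    TensorProduct.ext' h
  exact LinearMap.congr_fun this _

theorem sandwich_of {D : GroupLike k B} {E : Type*} [Ring E] [Algebra k E] {f g : Loc D →ₗ[k] E}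
    {f' g' : B →ₗ[k] E} (hf : ∀ b, f (Loc.of D b) = f' b) (hg : ∀ b, g (Loc.of D b) = g' b) (Z : E)
    (b : B) : sandwich f g Z (Loc.of D b) = sandwich f' g' Z b :=
  curry_map_comul_of (LinearMap.mul' k E ∘ₗ TensorProduct.map (LinearMap.mulRight k Z ∘ₗ f) g)
    (LinearMap.mul' k E ∘ₗ TensorProduct.map (LinearMap.mulRight k Z ∘ₗ f') g')
    (fun b b' => by simp [hf, hg]) b

/-- The maps b ↦ r(-, b) and b ↦ s(b, -) to the dual algebra of A, an antihomomorphism and a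
homomorphism, send D to mutually inverse units. Hence both extend to the localization, with D⁻¹ sent
to s(D, -) and r(-, D). Products in the localized argument are then respected by construction, and
the remaining axioms hold on a subalgebra that contains the image of B and D⁻¹. -/
theorem IsInvPairing.exists_extension (h : IsInvPairing r s) (D : GroupLike k B) :
    ∃ (r₁ : A ⊗[k] Loc D →ₗ[k] k) (s₁ : Loc D ⊗[k] A →ₗ[k] k), IsInvPairing r₁ s₁ ∧
      (∀ a b, r₁ (a ⊗ₜ Loc.of D b) = r (a ⊗ₜ b)) ∧
      (∀ a b, s₁ (Loc.of D b ⊗ₜ a) = s (b ⊗ₜ a)) := by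
  let R : Loc D →ₐ[k] (WithConv (A →ₗ[k] k))ᵐᵒᵖ := Loc.lift h.left.rightHom
    (MulOpposite.op (leftLin s D.val))
    (MulOpposite.unop_injective (h.leftLin_mul_rightLin D))
    (MulOpposite.unop_injective (h.rightLin_mul_leftLin D))
  let S : Loc D →ₐ[k] WithConv (A →ₗ[k] k) := Loc.lift h.right.leftHom (rightLin r D.val)
    (h.leftLin_mul_rightLin D) (h.rightLin_mul_leftLin D)
  let r₁ : A ⊗[k] Loc D →ₗ[k] k :=
    formOfRight ((MulOpposite.opLinearEquiv k).symm.toLinearMap ∘ₗ R.toLinearMap)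
  let s₁ : Loc D ⊗[k] A →ₗ[k] k := swapForm (formOfRight S.toLinearMap)
  have hR : ∀ x, rightLin r₁ x = (R x).unop := fun x => rfl
  have hS : ∀ x, leftLin s₁ x = S x := fun x => rfl
  have hRof : ∀ b, rightLin r₁ (Loc.of D b) = rightLin r b := fun b => by
    rw [hR]; simp only [R, Loc.lift_of]; rfl
  have hSof : ∀ b, leftLin s₁ (Loc.of D b) = leftLin s b := fun b => by
    exact Loc.lift_of _ _ _ _ _
  have hRinv : rightLin r₁ (Loc.inv D) = leftLin s D.val := by
    rw [hR]; simp only [R, Loc.lift_inv]; rfl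
  have hSinv : leftLin s₁ (Loc.inv D) = rightLin r D.val := Loc.lift_inv _ _ _ _
  have hrof : ∀ a b, r₁ (a ⊗ₜ Loc.of D b) = r (a ⊗ₜ b) := fun a b =>
    congrArg (fun f => f a) (hRof b)
  have hsof : ∀ a b, s₁ (Loc.of D b ⊗ₜ a) = s (b ⊗ₜ a) := fun a b =>
    congrArg (fun f => f a) (hSof b)
  have hrinv : ∀ a, r₁ (a ⊗ₜ Loc.inv D) = s (D.val ⊗ₜ a) := fun a =>
    congrArg (fun f => f a) hRinv
  have hsinv : ∀ a, s₁ (Loc.inv D ⊗ₜ a) = r (a ⊗ₜ D.val) := fun a =>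
    congrArg (fun f => f a) hSinv
  have hr1 : ∀ a, r₁ (a ⊗ₜ 1) = counit a := fun a =>
    congrArg (fun f => f.unop a) (map_one R)
  have hs1 : ∀ a, s₁ (1 ⊗ₜ a) = counit a := fun a =>
    congrArg (fun f => f a) (map_one S)
  have hrmul : ∀ a b b', r₁ (a ⊗ₜ (b * b')) = LinearMap.mul' k k
      (TensorProduct.map ((curry r₁).flip b') ((curry r₁).flip b) (comul a)) := fun a b b' =>
    congrArg (fun f => f.unop a) (map_mul R b b')
  have hsmul : ∀ b b' a, s₁ ((b * b') ⊗ₜ a) = LinearMap.mul' k k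
      (TensorProduct.map (curry s₁ b) (curry s₁ b') (comul a)) := fun b b' a =>
    congrArg (fun f => f a) (map_mul S b b')
  have hr : IsPairing r₁ :=
    { one_left := by
        -- Since 1 is group-like, r₁(1, -) is multiplicative, and it agrees with the counit on the
        -- image of B.
        let f : Loc D →ₐ[k] k := AlgHom.ofLinearMap (curry r₁ 1)
          ((hr1 1).trans (Bialgebra.counit_one)) fun x y => by
            refine (hrmul 1 x y).trans ?_
            simp [Algebra.TensorProduct.one_def, mul_comm]
        have : f = Bialgebra.counitAlgHom k (Loc D) := Loc.algHom_ext fun b => by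
          change r₁ (1 ⊗ₜ Loc.of D b) = counit (Loc.of D b)
          rw [hrof, h.left.one_left, Loc.counit_of]
        exact fun b => AlgHom.congr_fun this b
      one_right := hr1
      mul_left := fun a a' x => by
        refine Loc.mem_of_subalgebra (leftSplitting r₁ hr1 hrmul) (fun b a a' => ?_)
          (fun a a' => ?_) x a a'
        · rw [hrof, h.left.mul_left]
          exact (curry_map_comul_of (LinearMap.mul' k k ∘ₗ
            TensorProduct.map (curry r₁ a) (curry r₁ a')) (LinearMap.mul' k k ∘ₗ
            TensorProduct.map (curry r a) (curry r a')) (fun b b' => by simp [hrof]) b).symm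
        -- At D⁻¹ the product rule for the left argument of r₁ is the product rule for the right
        -- argument of s at D.
        · rw [hrinv, h.right.mul_right, comul_groupLike, Loc.comul_inv]
          simp [hrinv, mul_comm]
      mul_right := hrmul }
  have hs : IsPairing s₁ :=
    { one_right := by
        let f : Loc D →ₐ[k] k := AlgHom.ofLinearMap ((curry s₁).flip 1)
          ((hs1 1).trans (Bialgebra.counit_one)) fun x y => by
            refine (hsmul x y 1).trans ?_
            simp [Algebra.TensorProduct.one_def]
        have : f = Bialgebra.counitAlgHom k (Loc D) := Loc.algHom_ext fun b => by
          change s₁ (Loc.of D b ⊗ₜ 1) = counit (Loc.of D b)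
          rw [hsof, h.right.one_right, Loc.counit_of]
        exact fun b => AlgHom.congr_fun this b
      one_left := hs1
      mul_right := fun x a a' => by
        refine Loc.mem_of_subalgebra (rightSplitting s₁ hs1 hsmul) (fun b a a' => ?_)
          (fun a a' => ?_) x a a'
        · rw [hsof, h.right.mul_right]
          exact (curry_map_comul_of (LinearMap.mul' k k ∘ₗ
            TensorProduct.map ((curry s₁).flip a') ((curry s₁).flip a)) (LinearMap.mul' k k ∘ₗ
            TensorProduct.map ((curry s).flip a') ((curry s).flip a))
            (fun b b' => by simp [hsof]) b).symm
        · rw [hsinv, h.left.mul_left, comul_groupLike, Loc.comul_inv]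
          simp [hsinv, mul_comm]
      mul_left := hsmul }
  refine ⟨r₁, s₁, ⟨hr, hs, ?_, ?_⟩, hrof, hsof⟩
  · refine (conv_eq_one_iff r₁ s₁).mpr fun x => ?_
    refine Loc.mem_of_subalgebra (convInverse (rightLin r₁) (leftLin s₁) hr.rightLin_one
      hs.leftLin_one (Or.inr fun a b => ⟨hr.rightLin_mul a b, hs.leftLin_mul a b⟩)) ?_ ?_ x
    · intro b
      rw [mem_convInverse, Loc.counit_of, ← (conv_eq_one_iff r s).mp h.mul_inv b]
      exact sandwich_of (by assumption) (by assumption) _ b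
    · rw [mem_convInverse, sandwich_of_comul _ _ _ (Loc.comul_inv D), Loc.counit_inv, map_one,
        mul_one, hRinv, hSinv, h.leftLin_mul_rightLin]
  · refine (conv_eq_one_iff' r₁ s₁).mpr fun x => ?_
    refine Loc.mem_of_subalgebra (convInverse (leftLin s₁) (rightLin r₁) hs.leftLin_one
      hr.rightLin_one (Or.inl fun a b => ⟨hs.leftLin_mul a b, hr.rightLin_mul a b⟩)) ?_ ?_ x
    · intro b
      rw [mem_convInverse, Loc.counit_of, ← (conv_eq_one_iff' r s).mp h.inv_mul b]
      exact sandwich_of (by assumption) (by assumption) _ b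
    · rw [mem_convInverse, sandwich_of_comul _ _ _ (Loc.comul_inv D), Loc.counit_inv, map_one,
        mul_one, hRinv, hSinv, h.rightLin_mul_leftLin]

end Extension
end
end NicholsFRT

namespace NicholsFRT

noncomputable section

/-! ### Quasicommutativity as an identity in a convolution algebra -/

section Quasicommutative

variable {k : Type*} [Field k] {A B H : Type*} [Ring A] [Bialgebra k A] [Ring B] [Bialgebra k B]
  [Ring H] [Algebra k H]

section Scalars

variable {C : Type*} [AddCommGroup C] [Module k C] [Coalgebra k C]

theorem sum_smul_counit {κ : Type*} {a : C} (R : Coalgebra.Repr k a κ) :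
    ∑ i ∈ R.index, counit (R := k) (R.right i) • R.left i = a := by
  have h := congrArg (TensorProduct.rid k C) (Coalgebra.lTensor_counit_comul (R := k) a)
  rw [← R.eq, map_sum, map_sum] at h
  simpa only [LinearMap.lTensor_tmul, rid_tmul, one_smul] using h

variable (k H C) in
/-- The algebra map `h ↦ (c ↦ ε(c) h)` to the convolution algebra. -/
def constHom : H →ₐ[k] WithConv (C →ₗ[k] H) :=
  AlgHom.ofLinearMap
    { toFun h := WithConv.toConv ((counit (R := k) (A := C)).smulRight h)
      map_add' a b := WithConv.ext (LinearMap.ext fun c => smul_add _ _ _)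
      map_smul' s a := WithConv.ext (LinearMap.ext fun c => smul_comm _ _ _) }
    (WithConv.ext (LinearMap.ext fun c => (Algebra.algebraMap_eq_smul_one _).symm))
    (fun a b => WithConv.ext (LinearMap.ext fun c => by
      refine Eq.trans ?_ (convMul_repr _ _ (ℛ k c)).symm
      have h := congrArg (counit (R := k)) (Coalgebra.sum_counit_smul (ℛ k c))
      simp only [map_sum, map_smul, smul_eq_mul] at h
      change counit (R := k) c • (a * b) = ∑ i ∈ (ℛ k c).index,
        (counit (R := k) ((ℛ k c).left i) • a) * (counit (R := k) ((ℛ k c).right i) • b)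
      simp only [smul_mul_smul_comm, ← Finset.sum_smul, h]))

theorem constHom_apply (h : H) (c : C) :
    constHom k H C h c = counit (R := k) c • h := rfl

theorem mul_constHom_apply (Y : WithConv (C →ₗ[k] H)) (h : H) (c : C) :
    (Y * constHom k H C h) c = Y c * h := by
  rw [convMul_repr _ _ (ℛ k c)]
  conv_rhs => rw [← sum_smul_counit (ℛ k c)]
  simp [constHom_apply, Finset.sum_mul]

theorem constHom_mul_apply (Y : WithConv (C →ₗ[k] H)) (h : H) (c : C) :
    (constHom k H C h * Y) c = h * Y c := by
  rw [convMul_repr _ _ (ℛ k c)]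
  conv_rhs => rw [← Coalgebra.sum_counit_smul (ℛ k c)]
  simp [constHom_apply, Finset.mul_sum]

variable (k H C) in
/-- The algebra map from the dual algebra of a coalgebra to the convolution algebra. -/
def scalarHom : WithConv (C →ₗ[k] k) →ₐ[k] WithConv (C →ₗ[k] H) :=
  AlgHom.ofLinearMap
    { toFun φ := WithConv.toConv (φ.ofConv.smulRight 1)
      map_add' a b := WithConv.ext (LinearMap.ext fun c => add_smul _ _ _)
      map_smul' s a := WithConv.ext (LinearMap.ext fun c => mul_smul _ _ _) }
    (WithConv.ext (LinearMap.ext fun c => (Algebra.algebraMap_eq_smul_one _).symm))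
    (fun a b => WithConv.ext (LinearMap.ext fun c => by
      refine Eq.trans ?_ (convMul_repr _ _ (ℛ k c)).symm
      change (a * b) c • (1 : H) = ∑ i ∈ (ℛ k c).index,
        (a ((ℛ k c).left i) • 1) * (b ((ℛ k c).right i) • 1)
      rw [convMul_repr _ _ (ℛ k c)]
      simp only [Finset.sum_smul, smul_mul_smul_comm, mul_one]))

theorem scalarHom_apply (φ : WithConv (C →ₗ[k] k)) (c : C) : scalarHom k H C φ c = φ c • 1 := rfl

/-- The convolution algebra need not be commutative, but here one factor takes scalar values and the
other has coefficient ε, so both products have the value φ(c) h at c. -/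
theorem scalarHom_commute (φ : WithConv (C →ₗ[k] k)) (h : H) :
    Commute (scalarHom k H C φ) (constHom k H C h) :=
  WithConv.ext (LinearMap.ext fun c =>
    (mul_constHom_apply _ h c).trans (Eq.trans (by simp [scalarHom_apply])
      (constHom_mul_apply _ h c).symm))

theorem scalarHom_mul_apply (φ : WithConv (C →ₗ[k] k)) (Y : WithConv (C →ₗ[k] H)) {κ : Type*}
    {c : C} (S : Coalgebra.Repr k c κ) :
    (scalarHom k H C φ * Y) c = ∑ i ∈ S.index, φ (S.left i) • Y (S.right i) := by
  rw [convMul_repr _ _ S]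
  simp [scalarHom_apply]

theorem mul_scalarHom_apply (φ : WithConv (C →ₗ[k] k)) (Y : WithConv (C →ₗ[k] H)) {κ : Type*}
    {c : C} (S : Coalgebra.Repr k c κ) :
    (Y * scalarHom k H C φ) c = ∑ i ∈ S.index, φ (S.right i) • Y (S.left i) := by
  rw [convMul_repr _ _ S]
  simp [scalarHom_apply]

end Scalars

/-- The identity `r(a₁, b₁) f(a₂) g(b₂) = g(b₁) f(a₁) r(a₂, b₂)`. -/
def Quasicommute (r : A ⊗[k] B →ₗ[k] k) (f : A →ₐ[k] H) (g : B →ₐ[k] H) (a : A) (b : B) : Prop :=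
  ∑ i ∈ (ℛ k a).index, ∑ j ∈ (ℛ k b).index, r ((ℛ k a).left i ⊗ₜ (ℛ k b).left j) •
    (f ((ℛ k a).right i) * g ((ℛ k b).right j)) =
  ∑ i ∈ (ℛ k a).index, ∑ j ∈ (ℛ k b).index, r ((ℛ k a).right i ⊗ₜ (ℛ k b).right j) •
    (g ((ℛ k b).left j) * f ((ℛ k a).left i))

theorem quasicommute_iff_tensor (r : A ⊗[k] A →ₗ[k] k) (a b : A) :
    Quasicommute r (.id k A) (.id k A) a b ↔
    TensorProduct.lid k A (TensorProduct.map r (LinearMap.mul' k A)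
      (comul (R := k) (a ⊗ₜ[k] b))) =
    TensorProduct.rid k A (TensorProduct.map
      (LinearMap.mul' k A ∘ₗ (TensorProduct.comm k A A).toLinearMap) r
      (comul (R := k) (a ⊗ₜ[k] b))) := by
  rw [TensorProduct.comul_tmul, Quasicommute]
  conv_rhs => rw [← (ℛ k a).eq, ← (ℛ k b).eq]
  simp only [sum_tmul, tmul_sum, map_sum, AlgebraTensorModule.tensorTensorTensorComm_tmul,
    TensorProduct.map_tmul, lid_tmul, rid_tmul, LinearMap.mul'_apply, LinearMap.comp_apply,
    LinearEquiv.coe_coe, comm_tmul, AlgHom.id_apply]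
  rw [Finset.sum_comm]
  conv_lhs => rhs; rw [Finset.sum_comm]

theorem sum_conv_apply {C R κ : Type*} [AddCommGroup C] [Module k C] [Coalgebra k C] [Ring R]
    [Algebra k R] (s : Finset κ) (F : κ → WithConv (C →ₗ[k] R)) (c : C) :
    (∑ i ∈ s, F i) c = ∑ i ∈ s, F i c :=
  (congrArg (fun f : C →ₗ[k] R => f c) (WithConv.ofConv_sum _ _)).trans (LinearMap.sum_apply _ _ _)

theorem sandwich_scalar_const_apply {C L : Type*} [AddCommGroup C] [Module k C] [Coalgebra k C]
    [Ring L] [Bialgebra k L] (ρ : L →ₗ[k] WithConv (C →ₗ[k] k)) (g : L →ₐ[k] H)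
    (X : WithConv (C →ₗ[k] H)) {κ κ' : Type*} {b : L} {c : C} (S : Coalgebra.Repr k b κ)
    (T : Coalgebra.Repr k c κ') :
    sandwich ((scalarHom k H C).toLinearMap ∘ₗ ρ) ((constHom k H C).toLinearMap ∘ₗ g.toLinearMap) X b c =
      ∑ i ∈ S.index, ∑ j ∈ T.index, ρ (S.left i) (T.left j) • (X (T.right j) * g (S.right i)) := by
  rw [sandwich_repr _ _ _ S, sum_conv_apply]
  refine Finset.sum_congr rfl fun i _ => ?_
  refine (mul_constHom_apply _ _ _).trans ?_
  refine (congrArg (· * _) (scalarHom_mul_apply _ _ T)).trans ?_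
  simp [Finset.sum_mul]

theorem sandwich_const_scalar_apply {C L : Type*} [AddCommGroup C] [Module k C] [Coalgebra k C]
    [Ring L] [Bialgebra k L] (ρ : L →ₗ[k] WithConv (C →ₗ[k] k)) (g : L →ₐ[k] H)
    (X : WithConv (C →ₗ[k] H)) {κ κ' : Type*} {b : L} {c : C} (S : Coalgebra.Repr k b κ)
    (T : Coalgebra.Repr k c κ') :
    sandwich ((constHom k H C).toLinearMap ∘ₗ g.toLinearMap) ((scalarHom k H C).toLinearMap ∘ₗ ρ) X b c =
      ∑ i ∈ S.index, ∑ j ∈ T.index, ρ (S.right i) (T.right j) • (g (S.left i) * X (T.left j)) := by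
  rw [sandwich_repr _ _ _ S, sum_conv_apply]
  refine Finset.sum_congr rfl fun i _ => ?_
  refine (mul_scalarHom_apply _ _ T).trans ?_
  refine Finset.sum_congr rfl fun j _ => ?_
  exact congrArg _ (constHom_mul_apply _ _ _)

/-- The `b` that quasicommute with all `a`. -/
def rightQuasi {r : A ⊗[k] B →ₗ[k] k} (hr : IsPairing r) (f : A →ₐ[k] H) (g : B →ₐ[k] H) :
    Subalgebra k B :=
  rightCommuting ((scalarHom k H A).toLinearMap ∘ₗ rightLin r) ((constHom k H A).comp g)
    (by simp [hr.rightLin_one])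
    (fun a b => by simp [hr.rightLin_mul])
    (fun a b => scalarHom_commute _ _) (WithConv.toConv f.toLinearMap)

/-- In Hom(A, H), let ρ(b) be the scalar-valued map r(-, b) and ℓ(b) the constant g(b). For all a at
once, quasicommutativity of b reads ρ(b₁) f ℓ(b₂) = ℓ(b₁) f ρ(b₂). -/
theorem mem_rightQuasi {r : A ⊗[k] B →ₗ[k] k} (hr : IsPairing r) (f : A →ₐ[k] H) (g : B →ₐ[k] H)
    (b : B) : b ∈ rightQuasi hr f g ↔ ∀ a, Quasicommute r f g a b := by
  have h : b ∈ rightQuasi hr f g ↔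
      sandwich ((scalarHom k H A).toLinearMap ∘ₗ rightLin r) ((constHom k H A).toLinearMap ∘ₗ g.toLinearMap)
        (WithConv.toConv f.toLinearMap) b =
      sandwich ((constHom k H A).toLinearMap ∘ₗ g.toLinearMap) ((scalarHom k H A).toLinearMap ∘ₗ rightLin r)
        (WithConv.toConv f.toLinearMap) b := Iff.rfl
  rw [h]
  have h1 : ∀ X Y : WithConv (A →ₗ[k] H), X = Y ↔ ∀ a, X a = Y a := fun X Y =>
    ⟨fun h _ => h ▸ rfl, fun h => WithConv.ext (LinearMap.ext h)⟩
  rw [h1]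
  refine forall_congr' fun a => ?_
  rw [sandwich_scalar_const_apply _ _ _ (ℛ k b) (ℛ k a),
    sandwich_const_scalar_apply _ _ _ (ℛ k b) (ℛ k a), Finset.sum_comm]
  conv_lhs => rhs; rw [Finset.sum_comm]
  rfl

/-- The `a` that quasicommute with all `b`. -/
def leftQuasi {r : A ⊗[k] B →ₗ[k] k} (hr : IsPairing r) (f : A →ₐ[k] H) (g : B →ₐ[k] H) :
    Subalgebra k A :=
  leftCommuting ((scalarHom k H B).comp hr.leftHom) ((constHom k H B).comp f)
    (fun _ _ => scalarHom_commute _ _) (WithConv.toConv g.toLinearMap)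

/-- The same translation in Hom(B, H), with ρ(a) = r(a, -) and ℓ(a) the constant f(a): the identity
becomes ρ(a₁) ℓ(a₂) g = g ℓ(a₁) ρ(a₂). -/
theorem mem_leftQuasi {r : A ⊗[k] B →ₗ[k] k} (hr : IsPairing r) (f : A →ₐ[k] H) (g : B →ₐ[k] H)
    (a : A) : a ∈ leftQuasi hr f g ↔ ∀ b, Quasicommute r f g a b := by
  have h : a ∈ leftQuasi hr f g ↔
      sandwich ((scalarHom k H B).toLinearMap ∘ₗ leftLin r) ((constHom k H B).toLinearMap ∘ₗ f.toLinearMap) 1 a *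
        (WithConv.toConv g.toLinearMap) = (WithConv.toConv g.toLinearMap) *
      sandwich ((constHom k H B).toLinearMap ∘ₗ f.toLinearMap) ((scalarHom k H B).toLinearMap ∘ₗ leftLin r) 1 a :=
    Iff.rfl
  rw [h]
  have h1 : ∀ X Y : WithConv (B →ₗ[k] H), X = Y ↔ ∀ a, X a = Y a := fun X Y =>
    ⟨fun h _ => h ▸ rfl, fun h => WithConv.ext (LinearMap.ext h)⟩
  rw [h1]
  refine forall_congr' fun b => ?_
  rw [sandwich_repr _ _ _ (ℛ k a), sandwich_repr _ _ _ (ℛ k a), Finset.sum_mul, Finset.mul_sum,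
    sum_conv_apply, sum_conv_apply]
  refine Eq.congr (Finset.sum_congr rfl fun i _ => ?_) (Finset.sum_congr rfl fun i _ => ?_)
  · rw [mul_one, mul_assoc]
    refine (scalarHom_mul_apply _ _ (ℛ k b)).trans ?_
    exact Finset.sum_congr rfl fun j _ => congrArg _ (constHom_mul_apply _ _ _)
  · rw [mul_one, ← mul_assoc]
    refine (mul_scalarHom_apply _ _ (ℛ k b)).trans ?_
    exact Finset.sum_congr rfl fun j _ => congrArg _ (mul_constHom_apply _ _ _)

end Quasicommutative
end
end NicholsFRT

namespace NicholsFRT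

noncomputable section

/-! ### Existence and uniqueness of coquasitriangular structures on a localization -/

section Coquasi

variable {k : Type*} [Field k] {A B H : Type*} [Ring A] [Bialgebra k A] [Ring B] [Bialgebra k B]
  [Ring H] [Algebra k H]

theorem sum_quasi_left (r : A ⊗[k] B →ₗ[k] k) (f : A →ₐ[k] H) (g : B →ₐ[k] H) {a : A} {b : B}
    {κ κ' : Type*} (S : Coalgebra.Repr k a κ) (T : Coalgebra.Repr k b κ') :
    ∑ i ∈ S.index, ∑ j ∈ T.index, r (S.left i ⊗ₜ T.left j) • (f (S.right i) * g (T.right j)) =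
      sandwich ((scalarHom k H A).toLinearMap ∘ₗ rightLin r)
        ((constHom k H A).toLinearMap ∘ₗ g.toLinearMap) (WithConv.toConv f.toLinearMap) b a := by
  rw [sandwich_scalar_const_apply _ _ _ T S, Finset.sum_comm]
  rfl

theorem sum_quasi_right (r : A ⊗[k] B →ₗ[k] k) (f : A →ₐ[k] H) (g : B →ₐ[k] H) {a : A} {b : B}
    {κ κ' : Type*} (S : Coalgebra.Repr k a κ) (T : Coalgebra.Repr k b κ') :
    ∑ i ∈ S.index, ∑ j ∈ T.index, r (S.right i ⊗ₜ T.right j) • (g (T.left j) * f (S.left i)) =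
      sandwich ((constHom k H A).toLinearMap ∘ₗ g.toLinearMap)
        ((scalarHom k H A).toLinearMap ∘ₗ rightLin r) (WithConv.toConv f.toLinearMap) b a := by
  rw [sandwich_const_scalar_apply _ _ _ T S, Finset.sum_comm]
  rfl

/-- Both sides are linear in the two comultiplications, so any presentations may be used, such as
the matrix one of a generator. -/
theorem quasicommute_iff (r : A ⊗[k] B →ₗ[k] k) (f : A →ₐ[k] H) (g : B →ₐ[k] H) {a : A} {b : B}
    {κ κ' : Type*} (S : Coalgebra.Repr k a κ) (T : Coalgebra.Repr k b κ') :
    Quasicommute r f g a b ↔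
    ∑ i ∈ S.index, ∑ j ∈ T.index, r (S.left i ⊗ₜ T.left j) • (f (S.right i) * g (T.right j)) =
    ∑ i ∈ S.index, ∑ j ∈ T.index, r (S.right i ⊗ₜ T.right j) • (g (T.left j) * f (S.left i)) := by
  rw [sum_quasi_left r f g S T, sum_quasi_right r f g S T, Quasicommute, sum_quasi_left,
    sum_quasi_right]

theorem IsPairing.isCoquasitriangular {r s : A ⊗[k] A →ₗ[k] k} (h : IsInvPairing r s)
    (hq : ∀ a b, Quasicommute r (.id k A) (.id k A) a b) : IsCoquasitriangular r where
  isUnit := ⟨⟨_, _, h.mul_inv, h.inv_mul⟩, rfl⟩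
  mul_left := h.left.mul_left
  mul_right := h.left.mul_right
  quasicomm a b := (quasicommute_iff_tensor r a b).mp (hq a b)

theorem curry_convMul (r s : A ⊗[k] B →ₗ[k] k) (a : A) (ha : comul (R := k) a = a ⊗ₜ a) :
    WithConv.toConv (curry r a) * WithConv.toConv (curry s a) =
      WithConv.toConv (curry (WithConv.toConv r * WithConv.toConv s).ofConv a) :=
  WithConv.ext (LinearMap.ext fun b => by
    refine Eq.trans (convMul_repr _ _ (ℛ k b)) (Eq.trans ?_
      (convMul_tmul_repr r s (⟨{()}, fun _ => a, fun _ => a, by simp [ha]⟩ : Coalgebra.Repr k a Unit)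
        (ℛ k b)).symm)
    simp)

theorem curry_flip_convMul (r s : A ⊗[k] B →ₗ[k] k) (b : B) (hb : comul (R := k) b = b ⊗ₜ b) :
    WithConv.toConv ((curry r).flip b) * WithConv.toConv ((curry s).flip b) =
      WithConv.toConv ((curry (WithConv.toConv r * WithConv.toConv s).ofConv).flip b) :=
  WithConv.ext (LinearMap.ext fun a => by
    refine Eq.trans (convMul_repr _ _ (ℛ k a)) (Eq.trans ?_
      (convMul_tmul_repr r s (ℛ k a)
        (⟨{()}, fun _ => b, fun _ => b, by simp [hb]⟩ : Coalgebra.Repr k b Unit)).symm)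
    simp)

/-- The normalizations r(1, b) = ε(b) and r(a, 1) = ε(a) are not among the axioms. They follow
because r(1, -) and r(-, 1) are idempotent by the product rules and invertible because r is. -/
theorem IsCoquasitriangular.isPairing {r : A ⊗[k] A →ₗ[k] k} (h : IsCoquasitriangular r) :
    IsPairing r := by
  obtain ⟨u, hu⟩ := h.isUnit
  have hrs : WithConv.toConv r * WithConv.toConv (u⁻¹.val).ofConv = 1 := by
    rw [← hu]
    exact u.mul_inv
  -- An idempotent with a right inverse is 1.
  have key : ∀ {E : Type _} [Ring E] (x y : E), x * x = x → x * y = 1 → x = 1 :=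
    fun x y h1 h2 => by rw [← h2, ← h1, mul_assoc, h2, mul_one, h1]
  have h1 : comul (R := k) (1 : A) = 1 ⊗ₜ 1 := Bialgebra.comul_one
  have hl : WithConv.toConv (curry r 1) = 1 := by
    refine key _ (WithConv.toConv (curry (u⁻¹.val).ofConv 1)) ?_ ?_
    · refine WithConv.ext (LinearMap.ext fun b => ?_)
      have := h.mul_left 1 1 b
      rw [mul_one] at this
      exact this.symm
    · rw [curry_convMul _ _ _ h1, hrs]
      refine WithConv.ext (LinearMap.ext fun b => ?_)
      change counit (R := k) ((1 : A) ⊗ₜ[k] b) = counit (R := k) b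
      simp
  have hr : WithConv.toConv ((curry r).flip 1) = 1 := by
    refine key _ (WithConv.toConv ((curry (u⁻¹.val).ofConv).flip 1)) ?_ ?_
    · refine WithConv.ext (LinearMap.ext fun a => ?_)
      have := h.mul_right a 1 1
      rw [mul_one] at this
      exact this.symm
    · rw [curry_flip_convMul _ _ _ h1, hrs]
      refine WithConv.ext (LinearMap.ext fun b => ?_)
      change counit (R := k) (b ⊗ₜ[k] (1 : A)) = counit (R := k) b
      simp
  exact ⟨fun b => congrArg (fun f => f b) hl, fun a => congrArg (fun f => f a) hr,
    h.mul_left, h.mul_right⟩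

/-- The image in the localization of a presentation of the comultiplication. -/
def reprOf {D : GroupLike k A} {a : A} {κ : Type*} (S : Coalgebra.Repr k a κ) :
    Coalgebra.Repr k (Loc.of D a) κ where
  index := S.index
  left i := Loc.of D (S.left i)
  right i := Loc.of D (S.right i)
  eq := by
    rw [Loc.comul_of, ← S.eq, map_sum]
    rfl

/-- The form is extended in its right argument and then, through the inverse pairing, in its left
one. Quasicommutativity is carried along each time by the subalgebra of elements that satisfy it,
which contains the image of A and, as an inverse of a group-like element, D⁻¹. -/
theorem exists_isCoquasitriangular_loc {r s : A ⊗[k] A →ₗ[k] k} (h : IsInvPairing r s)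
    (hq : ∀ a b, Quasicommute r (.id k A) (.id k A) a b) (D : GroupLike k A) :
    ∃ r' : Loc D ⊗[k] Loc D →ₗ[k] k, IsCoquasitriangular r' ∧
      ∀ x y, r' (Loc.of D x ⊗ₜ Loc.of D y) = r (x ⊗ₜ y) := by
  obtain ⟨r₁, s₁, h₁, hr₁, hs₁⟩ := h.exists_extension D
  -- For the exchanged pair, the argument of r₁ still in A is the right argument of s₁, so the same
  -- extension applies.
  obtain ⟨s₂, r₂, h₂, hs₂, hr₂⟩ := h₁.symm.exists_extension D
  have hq₁ : ∀ b a, Quasicommute r₁ (Loc.of D) (.id k (Loc D)) a b := by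
    intro b
    have hof : ∀ b, Loc.of D b ∈ rightQuasi h₁.left (Loc.of D) (.id k (Loc D)) := fun b => by
      refine (mem_rightQuasi _ _ _ _).mpr fun a => ?_
      refine (quasicommute_iff _ _ _ (ℛ k a) (reprOf (ℛ k b))).mpr ?_
      have := congrArg (Loc.of D) (hq a b)
      simpa [reprOf, hr₁] using this
    refine (mem_rightQuasi h₁.left _ _ _).mp (Loc.mem_of_subalgebra _ hof ?_ b)
    exact inv_mem_rightCommuting (Loc.of_mul_inv D) (Loc.inv_mul_of D)
      (by rw [Loc.comul_of, comul_groupLike]; rfl) (Loc.comul_inv D) (hof D.val)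
  have hq₂ : ∀ a b, Quasicommute r₂ (.id k (Loc D)) (.id k (Loc D)) a b := by
    intro a
    have hof : ∀ a, Loc.of D a ∈ leftQuasi h₂.right (.id k (Loc D)) (.id k (Loc D)) := fun a => by
      refine (mem_leftQuasi _ _ _ _).mpr fun b => ?_
      refine (quasicommute_iff _ _ _ (reprOf (ℛ k a)) (ℛ k b)).mpr ?_
      have := hq₁ b a
      simpa [reprOf, hr₂, Quasicommute] using this
    refine (mem_leftQuasi h₂.right _ _ _).mp (Loc.mem_of_subalgebra _ hof ?_ a)
    exact inv_mem_leftCommuting (Loc.of_mul_inv D) (Loc.inv_mul_of D)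
      (by rw [Loc.comul_of, comul_groupLike]; rfl) (Loc.comul_inv D) (hof D.val)
  exact ⟨r₂, IsPairing.isCoquasitriangular h₂.symm hq₂, fun x y => by rw [hr₂, hr₁]⟩

/-- The algebra map `y ↦ r(-, y)` for the restriction of a pairing to `A ⊗ A[D⁻¹]`. -/
def IsPairing.rightHomOf {D : GroupLike k A} {r : Loc D ⊗[k] B →ₗ[k] k} (hr : IsPairing r) :
    B →ₐ[k] (WithConv (A →ₗ[k] k))ᵐᵒᵖ :=
  antiHom
    { toFun y := WithConv.toConv ((curry r).flip y ∘ₗ (Loc.of D).toLinearMap)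
      map_add' x y := by simp [LinearMap.add_comp]
      map_smul' s y := by simp [LinearMap.smul_comp] }
    (WithConv.ext (LinearMap.ext fun a => (hr.one_right _).trans (Loc.counit_of D a)))
    (fun x y => WithConv.ext (LinearMap.ext fun a =>
      (mul_right_repr (hr.mul_right (Loc.of D a) x y) (reprOf (ℛ k a))).trans
        (convMul_repr (WithConv.toConv ((curry r).flip y ∘ₗ (Loc.of D).toLinearMap))
          (WithConv.toConv ((curry r).flip x ∘ₗ (Loc.of D).toLinearMap)) (ℛ k a)).symm))

/-- An algebra map from the localization is determined on A. This is applied to the right argument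
with the left one restricted to A, and then to the left argument. -/
theorem IsPairing.ext_loc {D : GroupLike k A} {r r' : Loc D ⊗[k] Loc D →ₗ[k] k} (hr : IsPairing r)
    (hr' : IsPairing r')
    (h : ∀ x y, r (Loc.of D x ⊗ₜ Loc.of D y) = r' (Loc.of D x ⊗ₜ Loc.of D y)) : r = r' := by
  have h0 : hr.rightHomOf = hr'.rightHomOf := Loc.algHom_ext fun y =>
    MulOpposite.unop_injective (WithConv.ext (LinearMap.ext fun x => h x y))
  have h1 : ∀ x y, r (Loc.of D x ⊗ₜ y) = r' (Loc.of D x ⊗ₜ y) := fun x y =>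
    congrArg (fun f => f.unop x) (AlgHom.congr_fun h0 y)
  have h2 : hr.leftHom = hr'.leftHom := Loc.algHom_ext fun a =>
    WithConv.ext (LinearMap.ext fun b => h1 a b)
  exact TensorProduct.ext' fun x y => congrArg (fun f => f y) (AlgHom.congr_fun h2 x)

end Coquasi
end
end NicholsFRT

namespace NicholsFRT

noncomputable section

/-! ### The universal form of A(c): pairing, quasicommutativity, convolution inverse -/

section UniversalForm

variable {k : Type*} [Field k] {ι : Type*} [Fintype ι] {C C' : ι → ι → ι → ι → k}

theorem FRT.mem_of_subalgebra (S : Subalgebra k (FRT C)) (h : ∀ i j, FRT.t C i j ∈ S) (x : FRT C) :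
    x ∈ S := by
  induction x using FRT.induction with
  | hs s => exact S.algebraMap_mem s
  | ht i j => exact h i j
  | hadd a b ha hb => exact add_mem ha hb
  | hmul a b ha hb => exact mul_mem ha hb

variable [DecidableEq ι]

variable (C) in
/-- The presentation of the comultiplication of a generator. -/
def FRT.reprT (i j : ι) : Coalgebra.Repr k (FRT.t C i j) ι where
  index := Finset.univ
  left m := FRT.t C i m
  right m := FRT.t C m j
  eq := (FRT.comul_t C i j).symm

theorem universalForm_one_right (hC : YB C) (a : FRT C) :
    universalForm hC (a ⊗ₜ 1) = counit a := by
  rw [universalForm_apply, map_one]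
  rfl

theorem isPairing_universalForm (hC : YB C) : IsPairing (universalForm hC) where
  one_left := by
    let f : FRT C →ₐ[k] k := AlgHom.ofLinearMap (curry (universalForm hC) 1)
      ((universalForm_one_right hC 1).trans Bialgebra.counit_one) fun x y => by
        refine (universalForm_mul_right hC 1 x y).trans ?_
        simp [Algebra.TensorProduct.one_def, mul_comm]
    have : f = Bialgebra.counitAlgHom k (FRT C) := FRT.algHom_ext fun j q => by
      refine Eq.trans ?_ (FRT.counit_t C j q).symm
      change universalForm hC (1 ⊗ₜ FRT.t C j q) = _
      simp [universalForm, rightRep, leftCoef, Matrix.one_apply]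
    exact fun b => AlgHom.congr_fun this b
  one_right := universalForm_one_right hC
  mul_left a a' x := by
    -- It suffices that the right argument is a generator t_j^q, where the rule says that a ↦ (r(a,
    -- t_j^q)) is multiplicative with values in matrices.
    refine FRT.mem_of_subalgebra (leftSplitting (universalForm hC) (universalForm_one_right hC)
      (universalForm_mul_right hC)) (fun j q a a' => ?_) x a a'
    have h : ∀ a j q, universalForm hC (a ⊗ₜ FRT.t C j q) = leftRep hC a j q := fun a j q => by
      simp [universalForm, rightRep, leftCoef]
    rw [h, FRT.comul_t]
    simp [h, Matrix.mul_apply]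
  mul_right := universalForm_mul_right hC

/-- The elements a that quasicommute with everything form a subalgebra, so a may be a generator. For
the whole matrix of the t_i^p the condition on b is an identity of matrices over A(c), whose
solutions again form a subalgebra; for generators b it is the defining relation of A(c). -/
theorem quasicommute_universalForm (hC : YB C) (a b : FRT C) :
    Quasicommute (universalForm hC) (.id k _) (.id k _) a b := by
  have hr := isPairing_universalForm hC
  let ρ : FRT C →ₗ[k] Matrix ι ι (FRT C) :=
    { toFun b := Matrix.of fun i p => algebraMap k (FRT C) (universalForm hC (FRT.t C i p ⊗ₜ b))
      map_add' b b' := by ext i p; simp [tmul_add]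
      map_smul' s b := by
        ext i p
        change algebraMap k (FRT C) (universalForm hC (FRT.t C i p ⊗ₜ (s • b))) =
          s • algebraMap k (FRT C) (universalForm hC (FRT.t C i p ⊗ₜ b))
        rw [tmul_smul, map_smul, smul_eq_mul, map_mul, Algebra.smul_def] }
  have hρ : ∀ b i p, ρ b i p = algebraMap k (FRT C) (universalForm hC (FRT.t C i p ⊗ₜ b)) :=
    fun _ _ _ => rfl
  have hρ1 : ρ 1 = 1 := by
    ext i p
    rw [hρ, universalForm_one_right, FRT.counit_t, Matrix.one_apply]
    split_ifs <;> simp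
  have hρmul : ∀ b b', ρ (b * b') = ρ b' * ρ b := fun b b' => by
    ext i p
    rw [hρ, mul_right_repr (hr.mul_right _ _ _) (FRT.reprT C i p), Matrix.mul_apply, map_sum]
    exact Finset.sum_congr rfl fun m _ => map_mul _ _ _
  let ℓ : FRT C →ₐ[k] Matrix ι ι (FRT C) :=
    { Matrix.scalar ι with
      commutes' s := by
        ext i p
        simp [Matrix.algebraMap_matrix_apply, Matrix.diagonal_apply] }
  have hℓ : ∀ b, ℓ b = Matrix.diagonal fun _ => b := fun _ => rfl
  have hcomm : ∀ a b, Commute (ρ a) (ℓ b) := fun a b => by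
    ext i p
    rw [hℓ, Matrix.mul_diagonal, Matrix.diagonal_mul, hρ, Algebra.commutes]
  have hT : ∀ b i p, Quasicommute (universalForm hC) (.id k _) (.id k _) (FRT.t C i p) b := by
    intro b
    let X : Matrix ι ι (FRT C) := Matrix.of fun i p => FRT.t C i p
    have h1 : ∀ b i p, sandwich ρ ℓ.toLinearMap X b i p = ∑ m, ∑ j ∈ (ℛ k b).index,
        universalForm hC (FRT.t C i m ⊗ₜ (ℛ k b).left j) •
          (FRT.t C m p * (ℛ k b).right j) := fun b i p => by
      rw [sandwich_repr _ _ _ (ℛ k b), Matrix.sum_apply, Finset.sum_comm]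
      refine Finset.sum_congr rfl fun j _ => ?_
      simp only [AlgHom.toLinearMap_apply, hℓ, Matrix.mul_diagonal]
      simp only [Matrix.mul_apply, hρ, X,
        Matrix.of_apply, ← Algebra.smul_def, Finset.sum_mul, smul_mul_assoc]
    have h2 : ∀ b i p, sandwich ℓ.toLinearMap ρ X b i p = ∑ m, ∑ j ∈ (ℛ k b).index,
        universalForm hC (FRT.t C m p ⊗ₜ (ℛ k b).right j) •
          ((ℛ k b).left j * FRT.t C i m) := fun b i p => by
      rw [sandwich_repr _ _ _ (ℛ k b), Matrix.sum_apply, Finset.sum_comm]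
      refine Finset.sum_congr rfl fun j _ => ?_
      simp only [AlgHom.toLinearMap_apply, hℓ]
      rw [Matrix.mul_apply]
      simp only [Matrix.diagonal_mul, hρ, X, Matrix.of_apply, ← Algebra.commutes, ← Algebra.smul_def]
    have h3 : ∀ b i p, Quasicommute (universalForm hC) (.id k _) (.id k _) (FRT.t C i p) b ↔
        sandwich ρ ℓ.toLinearMap X b i p = sandwich ℓ.toLinearMap ρ X b i p := fun b i p => by
      rw [quasicommute_iff _ _ _ (FRT.reprT C i p) (ℛ k b), h1, h2]
      rfl
    have h4 := FRT.mem_of_subalgebra (rightCommuting ρ ℓ hρ1 hρmul hcomm X) (fun j q => by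
      rw [mem_rightCommuting]
      ext i p
      refine (h3 _ i p).mp ((quasicommute_iff _ _ _ (FRT.reprT C i p) (FRT.reprT C j q)).mpr ?_)
      simp only [FRT.reprT, universalForm_t, AlgHom.id_apply]
      -- As r(t_i^m, t_j^n) = c_{ji}^{mn}, the relation has to be taken with the two rows exchanged.
      refine (FRT.rel C j i p q).trans ?_
      rw [Finset.sum_comm]) b
    exact fun i p => (h3 b i p).mpr 
      (congrArg (fun Z : Matrix ι ι (FRT C) => Z i p) (mem_rightCommuting.mp h4))
  refine (mem_leftQuasi hr _ _ _).mp (FRT.mem_of_subalgebra (leftQuasi hr _ _) (fun i p => ?_) a) b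
  exact (mem_leftQuasi hr _ _ _).mpr fun b => hT b i p

section Inverse

variable (hC : YB C) (hC' : YB C') (h₁ : ∀ i j r s, ∑ p, ∑ q, C i j p q * C' p q r s =
  if i = r ∧ j = s then 1 else 0) (h₂ : ∀ i j r s, ∑ p, ∑ q, C' i j p q * C p q r s =
  if i = r ∧ j = s then 1 else 0)

-- As matrices, a relation MT = TM is equivalent to M⁻¹T = TM⁻¹, so c and c⁻¹ define the same
-- relations.
include h₁ h₂ in
theorem FRT.rel_inv (i j r s : ι) : ∑ p, ∑ q, C i j p q • (t C' p r * t C' q s) =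
    ∑ p, ∑ q, C p q r s • (t C' i p * t C' j q) := by
  let M : Matrix (ι × ι) (ι × ι) (FRT C') :=
    Matrix.of fun x y => algebraMap k _ (C x.1 x.2 y.1 y.2)
  let M' : Matrix (ι × ι) (ι × ι) (FRT C') :=
    Matrix.of fun x y => algebraMap k _ (C' x.1 x.2 y.1 y.2)
  let T : Matrix (ι × ι) (ι × ι) (FRT C') :=
    Matrix.of fun x y => t C' x.1 y.1 * t C' x.2 y.2
  have hM : M * M' = 1 := by
    ext x y
    simp only [M, M', Matrix.mul_apply, Matrix.of_apply, ← map_mul, ← map_sum,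
      Fintype.sum_prod_type, h₁, Matrix.one_apply, Prod.ext_iff]
    split_ifs <;> simp
  have hM' : M' * M = 1 := by
    ext x y
    simp only [M, M', Matrix.mul_apply, Matrix.of_apply, ← map_mul, ← map_sum,
      Fintype.sum_prod_type, h₂, Matrix.one_apply, Prod.ext_iff]
    split_ifs <;> simp
  have hT : M' * T = T * M' := by
    ext x y
    have := rel C' x.1 x.2 y.1 y.2
    simpa only [M', T, Matrix.mul_apply, Matrix.of_apply, Fintype.sum_prod_type,
      ← Algebra.commutes, ← Algebra.smul_def] using this
  have : M * T = T * M := by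
    rw [← mul_one (M * T), ← hM', ← mul_assoc, mul_assoc M, ← hT, ← mul_assoc, hM, one_mul]
  have h := congrFun (congrFun this (i, j)) (r, s)
  simpa only [M, T, Matrix.mul_apply, Matrix.of_apply, Fintype.sum_prod_type,
      ← Algebra.commutes, ← Algebra.smul_def] using h

/-- The identification of the FRT bialgebra with that of the inverse braiding. -/
def FRT.toInv (h₁ : ∀ i j r s, ∑ p, ∑ q, C i j p q * C' p q r s =
    if i = r ∧ j = s then 1 else 0) (h₂ : ∀ i j r s, ∑ p, ∑ q, C' i j p q * C p q r s =
    if i = r ∧ j = s then 1 else 0) : FRT C →ₐc[k] FRT C' :=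
  BialgHom.ofAlgHom (FRT.lift (t C') (rel_inv h₁ h₂))
    (FRT.algHom_ext fun i j => by simp [FRT.counit_t])
    (FRT.algHom_ext fun i j => by simp [FRT.comul_t])

theorem FRT.toInv_t (i j : ι) : FRT.toInv h₁ h₂ (t C i j) = t C' i j := FRT.lift_t _ _ _ _

theorem IsPairing.comap {A B A' B' : Type*} [Ring A] [Bialgebra k A] [Ring B] [Bialgebra k B]
    [Ring A'] [Bialgebra k A'] [Ring B'] [Bialgebra k B'] {r : A' ⊗[k] B' →ₗ[k] k}
    (hr : IsPairing r) (f : A →ₐc[k] A') (g : B →ₐc[k] B') :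
    IsPairing (r ∘ₗ TensorProduct.map (f : A →ₐ[k] A').toLinearMap
      (g : B →ₐ[k] B').toLinearMap) := by
  have hval : ∀ a b, (r ∘ₗ TensorProduct.map (f : A →ₐ[k] A').toLinearMap
      (g : B →ₐ[k] B').toLinearMap) (a ⊗ₜ b) = r (f a ⊗ₜ g b) := fun _ _ => rfl
  constructor
  · intro b
    rw [hval, map_one, hr.one_left, CoalgHomClass.counit_comp_apply]
  · intro a
    rw [hval, map_one, hr.one_right, CoalgHomClass.counit_comp_apply]
  · intro a a' b
    rw [hval, map_mul, mul_left_repr (hr.mul_left _ _ _) ((ℛ k b).induced g), ← (ℛ k b).eq]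
    simp only [map_sum, map_tmul, curry_apply, hval, LinearMap.mul'_apply]
    rfl
  · intro a b b'
    rw [hval, map_mul, mul_right_repr (hr.mul_right _ _ _) ((ℛ k a).induced f), ← (ℛ k a).eq]
    simp only [map_sum, map_tmul, LinearMap.flip_apply, curry_apply, hval, LinearMap.mul'_apply]
    rfl

/-- The form `r̄` for which `r̄(b, a)` is the convolution inverse of the universal form. -/
def inverseForm (hC' : YB C') (h₁ : ∀ i j r s, ∑ p, ∑ q, C i j p q * C' p q r s =
    if i = r ∧ j = s then 1 else 0) (h₂ : ∀ i j r s, ∑ p, ∑ q, C' i j p q * C p q r s =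
    if i = r ∧ j = s then 1 else 0) : FRT C ⊗[k] FRT C →ₗ[k] k :=
  universalForm hC' ∘ₗ TensorProduct.map (FRT.toInv h₁ h₂ : FRT C →ₐ[k] FRT C').toLinearMap
    (FRT.toInv h₁ h₂ : FRT C →ₐ[k] FRT C').toLinearMap

theorem inverseForm_t (i p j q : ι) :
    inverseForm hC' h₁ h₂ (FRT.t C i p ⊗ₜ FRT.t C j q) = C' j i p q := by
  change universalForm hC' (FRT.toInv h₁ h₂ (FRT.t C i p) ⊗ₜ FRT.toInv h₁ h₂ (FRT.t C j q)) = _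
  rw [FRT.toInv_t, FRT.toInv_t, universalForm_t]

theorem isPairing_inverseForm : IsPairing (inverseForm hC' h₁ h₂) :=
  (isPairing_universalForm hC').comap _ _

/-- Pairings of FRT bialgebras are convolution inverses if they are so on the generators. -/
theorem leftLin_rightLin_inverse {r s : FRT C ⊗[k] FRT C →ₗ[k] k} (hr : IsPairing r)
    (hs : IsPairing s) (h : ∀ i p j q, ∑ m, ∑ n, r (FRT.t C i m ⊗ₜ FRT.t C j n) *
      s (FRT.t C n q ⊗ₜ FRT.t C m p) = if i = p ∧ j = q then 1 else 0) (a : FRT C) :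
    sandwich (leftLin r) (rightLin s) 1 a = algebraMap k _ (counit a) := by
  let ρ : FRT C →ₗ[k] Matrix ι ι k :=
    { toFun b := Matrix.of fun i p => r (FRT.t C i p ⊗ₜ b)
      map_add' b b' := by ext i p; simp [tmul_add]
      map_smul' s b := by ext i p; simp }
  let σ : FRT C →ₗ[k] Matrix ι ι k :=
    { toFun b := Matrix.of fun i p => s (b ⊗ₜ FRT.t C i p)
      map_add' b b' := by ext i p; simp [add_tmul]
      map_smul' s b := by ext i p; simp [← TensorProduct.smul_tmul'] }
  have hρ : ∀ b i p, ρ b i p = r (FRT.t C i p ⊗ₜ b) := fun _ _ _ => rfl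
  have hσ : ∀ b i p, σ b i p = s (b ⊗ₜ FRT.t C i p) := fun _ _ _ => rfl
  have hρ1 : ρ 1 = 1 := by
    ext i p
    rw [hρ, hr.one_right, FRT.counit_t, Matrix.one_apply]
  have hσ1 : σ 1 = 1 := by
    ext i p
    rw [hσ, hs.one_left, FRT.counit_t, Matrix.one_apply]
  have hρmul : ∀ b b', ρ (b * b') = ρ b' * ρ b := fun b b' => by
    ext i p
    rw [hρ, mul_right_repr (hr.mul_right _ _ _) (FRT.reprT C i p), Matrix.mul_apply]
    rfl
  have hσmul : ∀ b b', σ (b * b') = σ b * σ b' := fun b b' => by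
    ext i p
    rw [hσ, mul_left_repr (hs.mul_left _ _ _) (FRT.reprT C i p), Matrix.mul_apply]
    rfl
  -- For a generator in place of a, the identity is an entry of a matrix identity in b, which can
  -- then be checked on generators b.
  have hT : ∀ b i p, sandwich (leftLin r) (rightLin s) 1 (FRT.t C i p) b =
      sandwich ρ σ 1 b i p := fun b i p => by
    rw [sandwich_conv_apply _ _ _ (ℛ k b) (FRT.reprT C i p), sandwich_repr _ _ _ (ℛ k b),
      Matrix.sum_apply, Finset.sum_comm]
    simp only [mul_one, Matrix.mul_apply]
    rfl
  have h1 : ∀ b, sandwich ρ σ 1 b = algebraMap k _ (counit b) := fun b => by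
    refine FRT.mem_of_subalgebra (convInverse ρ σ hρ1 hσ1
      (Or.inr fun a b => ⟨hρmul a b, hσmul a b⟩)) (fun j q => ?_) b
    rw [mem_convInverse, sandwich_repr _ _ _ (FRT.reprT C j q)]
    ext i p
    rw [Matrix.sum_apply, FRT.counit_t, Matrix.algebraMap_matrix_apply]
    simp only [mul_one, Matrix.mul_apply, hρ, hσ]
    rw [Finset.sum_comm]
    refine (h i p j q).trans ?_
    split_ifs <;> simp_all
  refine FRT.mem_of_subalgebra (convInverse (leftLin r) (rightLin s) hr.leftLin_one
    hs.rightLin_one (Or.inl fun a b => ⟨hr.leftLin_mul a b, hs.rightLin_mul a b⟩))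
    (fun i p => ?_) a
  refine (mem_convInverse (k := k)).mpr (WithConv.ext (LinearMap.ext fun b => (hT b i p).trans ?_))
  rw [h1, Matrix.algebraMap_matrix_apply, FRT.counit_t,
    Algebra.algebraMap_eq_smul_one (A := WithConv _)]
  change (if i = p then counit (R := k) b else 0) = (if i = p then 1 else 0) * counit (R := k) b
  split_ifs <;> simp

/-- On pairs of generators the two conditions say that the matrices of c and c⁻¹ are inverse, and
generators suffice in both arguments. -/
theorem isInvPairing_universalForm :
    IsInvPairing (universalForm hC) (inverseForm hC' h₁ h₂) := by
  have hr := isPairing_universalForm hC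
  have hs := isPairing_inverseForm hC' h₁ h₂
  have h : WithConv.toConv (swapForm (universalForm hC)) *
      WithConv.toConv (inverseForm hC' h₁ h₂) = 1 := by
    refine (conv_eq_one_iff' _ _).mpr (leftLin_rightLin_inverse hr hs fun i p j q => ?_)
    simp only [universalForm_t, inverseForm_t, h₁]
    exact if_congr and_comm rfl rfl
  refine ⟨hr, hs, swapForm_swapForm (universalForm hC) ▸ swapForm_mul_eq_one h,
    (conv_eq_one_iff' _ _).mpr (leftLin_rightLin_inverse hs hr fun i p j q => ?_)⟩
  simp only [universalForm_t, inverseForm_t, h₂]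
  exact if_congr and_comm rfl rfl

end Inverse

end UniversalForm

/-! ### The inverse braiding and the form on H(c) -/

section Braiding

variable {k : Type*} [Field k] {V : Type*} [AddCommGroup V] [Module k V]
  {c : V ⊗[k] V ≃ₗ[k] V ⊗[k] V}

theorem IsBraiding.symm (hc : IsBraiding c) : IsBraiding c.symm := by
  let a₁ : Module.End k ((V ⊗[k] V) ⊗[k] V) := c.toLinearMap.rTensor V
  let b₁ : Module.End k ((V ⊗[k] V) ⊗[k] V) := c.symm.toLinearMap.rTensor V
  let α := TensorProduct.assoc k V V V
  let a₂ : Module.End k ((V ⊗[k] V) ⊗[k] V) :=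
    α.symm.toLinearMap ∘ₗ c.toLinearMap.lTensor V ∘ₗ α.toLinearMap
  let b₂ : Module.End k ((V ⊗[k] V) ⊗[k] V) :=
    α.symm.toLinearMap ∘ₗ c.symm.toLinearMap.lTensor V ∘ₗ α.toLinearMap
  have h1 : a₁ * b₁ = 1 := TensorProduct.ext' fun x y => by simp [a₁, b₁]
  have h2 : b₁ * a₁ = 1 := TensorProduct.ext' fun x y => by simp [a₁, b₁]
  have h3 : a₂ * b₂ = 1 := LinearMap.ext fun x => by
    have : (c.toLinearMap.lTensor V) ∘ₗ (c.symm.toLinearMap.lTensor V) = LinearMap.id :=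
      TensorProduct.ext' fun x y => by simp
    have := LinearMap.congr_fun this (α x)
    simp only [LinearMap.comp_apply, LinearMap.id_apply] at this
    simp [a₂, b₂, this]
  have h4 : b₂ * a₂ = 1 := LinearMap.ext fun x => by
    have : (c.symm.toLinearMap.lTensor V) ∘ₗ (c.toLinearMap.lTensor V) = LinearMap.id :=
      TensorProduct.ext' fun x y => by simp
    have := LinearMap.congr_fun this (α x)
    simp only [LinearMap.comp_apply, LinearMap.id_apply] at this
    simp [a₂, b₂, this]
  have h : a₁ * (a₂ * a₁) = a₂ * (a₁ * a₂) := hc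
  change b₁ * (b₂ * b₁) = b₂ * (b₁ * b₂)
  refine left_inv_eq_right_inv (a := a₁ * (a₂ * a₁)) ?_ ?_
  · rw [mul_assoc, mul_assoc b₂, ← mul_assoc b₁ a₁, h2, one_mul, ← mul_assoc b₂, h4, one_mul, h2]
  · rw [h, mul_assoc, mul_assoc a₁, ← mul_assoc a₂ b₂, h3, one_mul, ← mul_assoc a₁, h1, one_mul, h3]

variable {ι : Type*} [Fintype ι] [DecidableEq ι] (e : Basis ι k V) (c)

theorem coef_mul_coef_symm (i j r s : ι) :
    ∑ p, ∑ q, coef e c i j p q * coef e c.symm p q r s = if i = r ∧ j = s then 1 else 0 := by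
  have h := congrArg (fun z => (e.tensorProduct e).repr z (r, s)) (c.symm_apply_apply (e i ⊗ₜ e j))
  simp only [apply_basis, map_sum, map_smul, Finsupp.finsetSum_apply, Finsupp.smul_apply,
    Basis.tensorProduct_repr_tmul_apply, Basis.repr_self, smul_eq_mul, Finsupp.single_apply] at h
  refine Eq.trans ?_ (h.trans ?_)
  · refine Finset.sum_congr rfl fun p _ => Finset.sum_congr rfl fun q _ => ?_
    rw [Finset.sum_eq_single r, Finset.sum_eq_single s] <;> simp +contextual
  · split_ifs <;> simp_all

theorem coef_symm_mul_coef (i j r s : ι) :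
    ∑ p, ∑ q, coef e c.symm i j p q * coef e c p q r s = if i = r ∧ j = s then 1 else 0 :=
  coef_mul_coef_symm c.symm e i j r s

variable {c} in
theorem exists_isInvPairing (hc : IsBraiding c) :
    ∃ s, IsInvPairing (universalForm (coef_braid e hc)) s :=
  ⟨_, isInvPairing_universalForm (coef_braid e hc) (coef_braid e hc.symm)
    (coef_mul_coef_symm c e) (coef_symm_mul_coef c e)⟩

variable {c e} in
theorem VolumeData.existsUnique_isCoquasitriangular (hc : IsBraiding c) (F : VolumeData e c) :
    ∃! r : F.H ⊗[k] F.H →ₗ[k] k, IsCoquasitriangular r ∧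
      ∀ x y, r (F.toH x ⊗ₜ F.toH y) = universalForm (coef_braid e hc) (x ⊗ₜ y) := by
  obtain ⟨s, hs⟩ := exists_isInvPairing e hc
  obtain ⟨r, hr, h⟩ := exists_isCoquasitriangular_loc hs (quasicommute_universalForm _) F.det
  refine ⟨r, ⟨hr, h⟩, fun r' ⟨hr', h'⟩ => ?_⟩
  exact hr'.isPairing.ext_loc hr.isPairing fun x y => (h' x y).trans (h x y).symm

end Braiding
end
end NicholsFRT

namespace NicholsFRT

noncomputable section

/-! ### Skew derivations and separating functionals on the Nichols algebra -/

section Descend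

variable {k M N P : Type*} [Field k] [AddCommGroup M] [Module k M] [AddCommGroup N] [Module k N]
  [AddCommGroup P] [Module k P]

/-- The map induced on the image of a surjection. -/
def descend (f : M →ₗ[k] N) (hf : Function.Surjective f) (g : M →ₗ[k] P)
    (h : LinearMap.ker f ≤ LinearMap.ker g) : N →ₗ[k] P :=
  (LinearMap.ker f).liftQ g h ∘ₗ (f.quotKerEquivOfSurjective hf).symm.toLinearMap

theorem descend_apply (f : M →ₗ[k] N) (hf : Function.Surjective f) (g : M →ₗ[k] P)
    (h : LinearMap.ker f ≤ LinearMap.ker g) (x : M) : descend f hf g h (f x) = g x := by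
  have : (f.quotKerEquivOfSurjective hf).symm (f x) = (LinearMap.ker f).mkQ x := by
    rw [LinearEquiv.symm_apply_eq]
    rfl
  simp [descend, this]

/-- Expanding x in a basis of the first factor, the coefficients are slices of x. This produces D
and the T_i^j, since slices of the coaction preserve the degrees of B. -/
theorem exists_sum_tmul_of_slice {ι : Type*} [Finite ι] (ω : ι → M) (x : N ⊗[k] M)
    (h : ∀ φ : Dual k N, slice φ x ∈ Submodule.span k (Set.range ω)) :
    ∃ a : ι → N, ∀ [Fintype ι], x = ∑ i, a i ⊗ₜ ω i := by
  classical
  have := Fintype.ofFinite ι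
  let B := Basis.ofVectorSpace k N
  obtain ⟨s, hs⟩ := TensorProduct.eq_repr_basis_left B x
  have h1 : ∀ β, s β = slice (B.coord β) x := fun β => by
    rw [← hs, map_finsuppSum]
    simp [slice_tmul, Finsupp.single_apply, Finsupp.sum]
  have h2 : ∀ β, ∃ v : ι → k, ∑ i, v i • ω i = s β := fun β =>
    (Submodule.mem_span_range_iff_exists_fun k).mp (h1 β ▸ h _)
  choose v hv using h2
  refine ⟨fun i => ∑ β ∈ s.support, v β i • B β, fun {inst} => ?_⟩
  rw [← hs, Finsupp.sum]
  simp only [sum_tmul]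
  rw [Finset.sum_comm]
  refine Finset.sum_congr rfl fun β _ => ?_
  conv_lhs => rw [← hv β, tmul_sum]
  convert Finset.sum_congr rfl fun i _ => ?_
  rw [tmul_smul, smul_tmul']

end Descend

namespace Nichols

variable {k : Type*} [Field k] {V : Type*} [AddCommGroup V] [Module k V]
  {ι : Type*} (e : Basis ι k V) (c : V ⊗[k] V ≃ₗ[k] V ⊗[k] V)

theorem mk_surjective : Function.Surjective (mk e c) := RingQuot.mkAlgHom_surjective k _

theorem mk_ι (v : V) : mk e c (TensorAlgebra.ι k v) = of e c v := rfl

theorem map_tensorPow (n : ℕ) :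
    (tensorPow k V n).map (mk e c).toLinearMap = degree e c n := by
  rw [tensorPow, Submodule.map_pow, degree]
  congr 1
  rw [← LinearMap.range_comp]
  rfl

/-- The counit of the Nichols algebra, as an algebra map. -/
def counitHom : Nichols e c →ₐ[k] k :=
  RingQuot.liftAlgHom k ⟨TensorAlgebra.algebraMapInv, by
    rintro f _ ⟨m, _, hf, h⟩
    rw [map_zero]
    exact algebraMapInv_of_mem hf⟩

theorem counitHom_mk (y : TensorAlgebra k V) :
    counitHom e c (mk e c y) = TensorAlgebra.algebraMapInv y :=
  RingQuot.liftAlgHom_mkAlgHom_apply ..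

theorem counitHom_of (v : V) : counitHom e c (of e c v) = 0 := by
  rw [← mk_ι, counitHom_mk]
  simp [TensorAlgebra.algebraMapInv]

variable {e c} in
theorem linear_ext_mul {M : Type*} [AddCommGroup M] [Module k M] {f g : Nichols e c →ₗ[k] M}
    (h1 : f 1 = g 1) (h : ∀ i y, f y = g y → f (of e c (e i) * y) = g (of e c (e i) * y)) :
    f = g := by
  have : f ∘ₗ (mk e c).toLinearMap = g ∘ₗ (mk e c).toLinearMap :=
    NicholsFRT.linear_ext_mul e (by simpa using h1) fun i y hy => by
      simpa [mk_ι] using h i (mk e c y) hy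
  refine LinearMap.ext fun x => ?_
  obtain ⟨y, rfl⟩ := mk_surjective e c x
  exact LinearMap.congr_fun this y

theorem degree_zero : degree e c 0 = Submodule.span k {1} := by
  rw [degree, pow_zero, Submodule.one_eq_span]

variable {e c} in
theorem of_mul_mem {n : ℕ} {y : Nichols e c} (hy : y ∈ degree e c n) (v : V) :
    of e c v * y ∈ degree e c (n + 1) := by
  rw [degree, pow_succ']
  exact Submodule.mul_mem_mul ⟨v, rfl⟩ hy

variable [Fintype ι]

theorem coaction_mk (y : TensorAlgebra k V) :
    coaction e c (mk e c y) = (mk e c).toLinearMap.lTensor _ (freeCoaction e c y) :=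
  RingQuot.liftAlgHom_mkAlgHom_apply ..

theorem slice_coaction_mem {n : ℕ} {y : Nichols e c} (hy : y ∈ degree e c n)
    (φ : Dual k (FRT (coef e c))) : slice φ (coaction e c y) ∈ degree e c n := by
  rw [← map_tensorPow] at hy ⊢
  obtain ⟨f, hf, rfl⟩ := hy
  refine ⟨_, slice_freeCoaction_mem e c n f hf φ, ?_⟩
  rw [← slice_lTensor, ← coaction_mk]
  rfl

variable [DecidableEq ι] {c} (hc : IsBraiding c)

/-- The skew derivation `∂_p` of the Nichols algebra. -/
def deriv (p : ι) : Module.End k (Nichols e c) :=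
  descend (mk e c).toLinearMap (mk_surjective e c) ((mk e c).toLinearMap ∘ₗ NicholsFRT.deriv e c p)
    fun y hy => (mk_eq_zero_iff hc _).mpr
      (deriv_mem_nullSpace p ((mk_eq_zero_iff hc y).mp hy))

theorem deriv_mk (p : ι) (y : TensorAlgebra k V) :
    deriv e hc p (mk e c y) = mk e c (NicholsFRT.deriv e c p y) :=
  descend_apply (mk e c).toLinearMap (mk_surjective e c) _ _ y

theorem deriv_one (p : ι) : deriv e hc p 1 = 0 := by
  rw [← map_one (mk e c), deriv_mk, NicholsFRT.deriv_one, map_zero]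

theorem deriv_mul (p i : ι) (y : Nichols e c) : deriv e hc p (of e c (e i) * y) =
    (if p = i then y else 0) + ∑ j, ∑ q, coef e c i j p q • (of e c (e q) * deriv e hc j y) := by
  obtain ⟨y, rfl⟩ := mk_surjective e c y
  rw [← mk_ι, ← map_mul, deriv_mk, NicholsFRT.deriv_mul, map_add]
  simp only [map_sum, map_smul, map_mul, mk_ι, deriv_mk, apply_ite (mk e c), map_zero]

theorem deriv_of (p i : ι) : deriv e hc p (of e c (e i)) = if p = i then 1 else 0 := by
  have := deriv_mul e hc p i 1
  simpa [deriv_one] using this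

theorem deriv_mem (p : ι) {n : ℕ} {y : Nichols e c} (hy : y ∈ degree e c (n + 1)) :
    deriv e hc p y ∈ degree e c n := by
  rw [← map_tensorPow] at hy ⊢
  obtain ⟨f, hf, rfl⟩ := hy
  exact ⟨_, NicholsFRT.deriv_mem e c p hf, (deriv_mk e hc p f).symm⟩

theorem lTensor_deriv_coaction (q : ι) (y : Nichols e c) :
    (deriv e hc q).lTensor _ (coaction e c y) =
      ∑ p, (FRT.t (coef e c) p q ⊗ₜ[k] 1) * coaction e c (deriv e hc p y) := by
  obtain ⟨y, rfl⟩ := mk_surjective e c y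
  have h := congrArg ((mk e c).toLinearMap.lTensor (FRT (coef e c)))
    (lTensor_deriv_freeCoaction e c q y)
  have h1 : (mk e c).toLinearMap ∘ₗ NicholsFRT.deriv e c q =
      deriv e hc q ∘ₗ (mk e c).toLinearMap := LinearMap.ext fun y => (deriv_mk e hc q y).symm
  rw [coaction_mk, ← LinearMap.comp_apply, ← LinearMap.lTensor_comp, ← h1, LinearMap.lTensor_comp,
    LinearMap.comp_apply, h, map_sum]
  refine Finset.sum_congr rfl fun p _ => ?_
  rw [deriv_mk, coaction_mk]
  generalize freeCoaction e c (NicholsFRT.deriv e c p y) = X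
  induction X with
  | zero => simp
  | add x y hx hy => simp only [mul_add, map_add, hx, hy]
  | tmul a y => simp

/-- The functional `ε ∂_{p_r} ⋯ ∂_{p_1}`. -/
def form : List ι → Nichols e c →ₗ[k] k
  | [] => (counitHom e c).toLinearMap
  | p :: u => form u ∘ₗ deriv e hc p

theorem form_mk (u : List ι) (y : TensorAlgebra k V) :
    form e hc u (mk e c y) = derivsForm e c u y := by
  induction u generalizing y with
  | nil => exact counitHom_mk e c y
  | cons p u ih =>
    rw [derivsForm_cons, ← ih, ← deriv_mk e hc]
    rfl

variable {e}

/-- A restatement of the description of the kernel of TV → B; it is the test for vanishing used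
throughout. -/
theorem eq_zero_of_form {y : Nichols e c} (h : ∀ u, form e hc u y = 0) : y = 0 := by
  obtain ⟨y, rfl⟩ := mk_surjective e c y
  exact (mk_eq_zero_iff hc y).mpr (mem_nullSpace.mpr fun u => (form_mk e hc u y).symm.trans (h u))

theorem form_of_mem {n : ℕ} {y : Nichols e c} (hy : y ∈ degree e c n) (u : List ι)
    (h : u.length ≠ n) : form e hc u y = 0 := by
  rw [← map_tensorPow] at hy
  obtain ⟨f, hf, rfl⟩ := hy
  exact (form_mk e hc u f).trans (derivsForm_of_mem e c hf u h)

theorem tensor_eq_zero_of_form {M : Type*} [AddCommGroup M] [Module k M] {X : Nichols e c ⊗[k] M}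
    (h : ∀ u, slice (form e hc u) X = 0) : X = 0 := by
  classical
  let B := Basis.ofVectorSpace k M
  refine (TensorProduct.equivFinsuppOfBasisRight B (M := Nichols e c)).injective ?_
  rw [map_zero]
  ext i
  refine eq_zero_of_form hc fun u => ?_
  have h1 : ∀ X : Nichols e c ⊗[k] M,
      form e hc u (TensorProduct.equivFinsuppOfBasisRight B X i) =
        B.coord i (slice (form e hc u) X) := fun X => by
    induction X with
    | zero => simp
    | add x y hx hy => simp only [map_add, Finsupp.add_apply, hx, hy]
    | tmul a y =>
      simp [slice_tmul, mul_comm]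
  rw [h1, h, map_zero]

end Nichols
end
end NicholsFRT

namespace NicholsFRT

noncomputable section

/-! ### Rigidity and elements killed by left multiplication -/

section Rigid

variable {k : Type*} [Field k] {V : Type*} [AddCommGroup V] [Module k V]
  {ι : Type*} [Fintype ι] [DecidableEq ι] (e : Basis ι k V) {c : V ⊗[k] V ≃ₗ[k] V ⊗[k] V}

/-- The array consists of the coordinates of a preimage of x_a ⊗ x_l^* under c^♭. -/
theorem IsRigid.exists_inverse (h : IsRigid e c) (a l : ι) : ∃ s : ι → ι → k, ∀ j q,
    ∑ p, ∑ i, s p i * coef e c i j p q = if q = a ∧ j = l then 1 else 0 := by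
  obtain ⟨z, hz⟩ := h.2 (e a ⊗ₜ e.coord l)
  let B := e.dualBasis.tensorProduct e
  refine ⟨fun p i => B.repr z (p, i), fun j q => ?_⟩
  have h1 : ∀ p i, flat e c (e.dualBasis p ⊗ₜ e i) =
      ∑ j, (∑ q, coef e c i j p q • e q) ⊗ₜ e.coord j := fun p i => by
    simp only [flat, TensorProduct.lift.tmul, LinearMap.mk₂_apply]
    refine Finset.sum_congr rfl fun j _ => ?_
    rw [apply_basis]
    simp [Finsupp.single_apply]
  have h2 : (e.tensorProduct e.dualBasis).repr (flat e c z) (q, j) =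
      ∑ p, ∑ i, B.repr z (p, i) * coef e c i j p q := by
    conv_lhs => rw [← B.sum_repr z]
    rw [map_sum, map_sum, Finsupp.finsetSum_apply, Fintype.sum_prod_type]
    refine Finset.sum_congr rfl fun p _ => Finset.sum_congr rfl fun i _ => ?_
    rw [map_smul, map_smul, Finsupp.smul_apply, smul_eq_mul]
    congr 1
    rw [Basis.tensorProduct_apply', h1, map_sum, Finsupp.finsetSum_apply]
    simp only [← Basis.coe_dualBasis, Basis.tensorProduct_repr_tmul_apply, Basis.repr_self,
      Finsupp.single_apply, smul_eq_mul]
    simp [Finsupp.single_apply]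
  have h3 : (e.tensorProduct e.dualBasis).repr (e a ⊗ₜ e.coord l) (q, j) =
      if q = a ∧ j = l then 1 else 0 := by
    clear h2
    rw [← Basis.coe_dualBasis]
    simp only [Basis.tensorProduct_repr_tmul_apply, Basis.repr_self, Finsupp.single_apply,
      smul_eq_mul, eq_comm (a := q), eq_comm (a := j)]
    split_ifs <;> simp_all
  exact h2.symm.trans ((congrArg (fun z => (e.tensorProduct e.dualBasis).repr z (q, j)) hz).trans
    h3)

end Rigid

namespace Nichols

variable {k : Type*} [Field k] {V : Type*} [AddCommGroup V] [Module k V]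
  {ι : Type*} [Fintype ι] [DecidableEq ι] {e : Basis ι k V} {c : V ⊗[k] V ≃ₗ[k] V ⊗[k] V}
  (hc : IsBraiding c)

variable (e) in
/-- The operator `∂_{p_1} ⋯ ∂_{p_r}`. -/
def derivsOp (u : List ι) : Module.End k (Nichols e c) := (u.map (deriv e hc)).prod

theorem derivsOp_cons (p : ι) (u : List ι) (y : Nichols e c) :
    derivsOp e hc (p :: u) y = deriv e hc p (derivsOp e hc u y) := by
  simp [derivsOp]

theorem form_append (u w : List ι) (y : Nichols e c) :
    form e hc (u ++ w) y = form e hc w (derivsOp e hc u.reverse y) := by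
  induction u generalizing y with
  | nil => simp [derivsOp]
  | cons p u ih =>
    change form e hc (u ++ w) (deriv e hc p y) = _
    rw [ih]
    simp [derivsOp]

theorem derivsOp_mem (u : List ι) {n : ℕ} {y : Nichols e c}
    (hy : y ∈ degree e c (u.length + n)) : derivsOp e hc u y ∈ degree e c n := by
  induction u generalizing n with
  | nil => simpa [derivsOp] using hy
  | cons p u ih =>
    rw [derivsOp_cons]
    refine deriv_mem e hc p (ih ?_)
    rwa [List.length_cons, add_assoc, add_comm 1] at hy

variable (e) in
/-- The span of the derivatives of an element. -/
def derivSpan (y : Nichols e c) : Submodule k (Nichols e c) :=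
  Submodule.span k (Set.range fun u => derivsOp e hc u y)

theorem derivsOp_mem_derivSpan (u : List ι) (y : Nichols e c) :
    derivsOp e hc u y ∈ derivSpan e hc y := Submodule.subset_span ⟨u, rfl⟩

theorem deriv_mem_derivSpan (p : ι) {y z : Nichols e c} (hz : z ∈ derivSpan e hc y) :
    deriv e hc p z ∈ derivSpan e hc y := by
  induction hz using Submodule.span_induction with
  | mem z hz =>
    obtain ⟨u, rfl⟩ := hz
    simp only [← derivsOp_cons]
    exact derivsOp_mem_derivSpan hc _ y
  | zero => rw [map_zero]; exact zero_mem _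
  | add a b _ _ ha hb => rw [map_add]; exact add_mem ha hb
  | smul s a _ ha => rw [map_smul]; exact Submodule.smul_mem _ _ ha

/-- Rigidity inverts the skew Leibniz rule: left multiplications can be moved to the right of
derivations until they reach y, which they kill. -/
theorem of_mul_mem_derivSpan (hr : IsRigid e c) {y : Nichols e c}
    (hy : ∀ i, of e c (e i) * y = 0) (a : ι) {z : Nichols e c} (hz : z ∈ derivSpan e hc y) :
    of e c (e a) * z ∈ derivSpan e hc y := by
  have key : ∀ (u : List ι) (a : ι),
      of e c (e a) * derivsOp e hc u y ∈ derivSpan e hc y := by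
    intro u
    induction u with
    | nil => intro a; simp [derivsOp, hy]
    | cons l u ih =>
      intro a
      rw [derivsOp_cons]
      set z := derivsOp e hc u y with hz
      obtain ⟨s, hs⟩ := hr.exists_inverse e a l
      -- Contracting the formula for ∂_p(x_i z) with the array `s` isolates the single term x_a
      -- ∂_l(z).
      have h1 : of e c (e a) * deriv e hc l z = ∑ p, ∑ i, s p i •
          (deriv e hc p (of e c (e i) * z) - if p = i then z else 0) := by
        simp only [deriv_mul, add_sub_cancel_left, Finset.smul_sum, smul_smul]
        have h2 : ∀ j q, ∑ p, ∑ i, (s p i * coef e c i j p q) • (of e c (e q) * deriv e hc j z) =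
            if q = a ∧ j = l then of e c (e q) * deriv e hc j z else 0 := fun j q => by
          simp only [← Finset.sum_smul, hs, ite_smul, one_smul, zero_smul]
        rw [sum_comm₄]
        simp only [h2]
        rw [Finset.sum_eq_single l, Finset.sum_eq_single a] <;> simp +contextual
      rw [h1]
      refine Submodule.sum_mem _ fun p _ => Submodule.sum_mem _ fun i _ =>
        Submodule.smul_mem _ _ (sub_mem (deriv_mem_derivSpan hc p (ih i)) ?_)
      split_ifs
      exacts [derivsOp_mem_derivSpan hc u y, zero_mem _]
  induction hz using Submodule.span_induction with
  | mem z hz => obtain ⟨u, rfl⟩ := hz; exact key u a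
  | zero => rw [mul_zero]; exact zero_mem _
  | add a b _ _ ha hb => rw [mul_add]; exact add_mem ha hb
  | smul s a _ ha => rw [mul_smul_comm]; exact Submodule.smul_mem _ _ ha

/-- Some functional is nonzero on y, and it must use n derivations; the corresponding derivative is
a nonzero scalar. So the span contains 1, and it is stable under left multiplication by the
generators. -/
theorem derivSpan_eq_top (hr : IsRigid e c) {n : ℕ} {y : Nichols e c} (hyn : y ∈ degree e c n)
    (hy : ∀ i, of e c (e i) * y = 0) (h0 : y ≠ 0) : derivSpan e hc y = ⊤ := by
  have h1 : (1 : Nichols e c) ∈ derivSpan e hc y := by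
    by_contra h
    refine h0 (eq_zero_of_form hc fun u => ?_)
    by_cases hu : u.length = n
    · have h2 := form_append hc u [] y
      rw [List.append_nil] at h2
      have h3 : derivsOp e hc u.reverse y ∈ degree e c 0 :=
        derivsOp_mem hc _ (by simpa [hu] using hyn)
      rw [degree_zero] at h3
      obtain ⟨s, hs⟩ := Submodule.mem_span_singleton.mp h3
      rw [h2, ← hs]
      by_cases hs0 : s = 0
      · rw [hs0, zero_smul, map_zero]
      · refine absurd ?_ h
        have h4 := Submodule.smul_mem _ s⁻¹ (derivsOp_mem_derivSpan hc u.reverse y)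
        rwa [← hs, smul_smul, inv_mul_cancel₀ hs0, one_smul] at h4
    · exact form_of_mem hc hyn u hu
  refine (Submodule.eq_top_iff').mpr fun z => ?_
  have : (derivSpan e hc y).mkQ = 0 := by
    refine linear_ext_mul (e := e) ?_ fun i z hz => ?_
    · simpa using h1
    · simp only [LinearMap.zero_apply, Submodule.mkQ_apply, Submodule.Quotient.mk_eq_zero] at hz ⊢
      exact of_mul_mem_derivSpan hc hr hy i hz
  have h2 := LinearMap.congr_fun this z
  simpa using h2

-- Every element of B is a combination of derivatives of y. Those by nonempty words are not seen by
-- functionals of length at least n, so for elements of degree at least n only the multiple of y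
-- counts.
include hc in
theorem mem_span_of_killed (hr : IsRigid e c) {n m : ℕ} {y z : Nichols e c}
    (hyn : y ∈ degree e c n) (hy : ∀ i, of e c (e i) * y = 0) (h0 : y ≠ 0) (hnm : n ≤ m)
    (hz : z ∈ degree e c m) : ∃ s : k, z = s • y := by
  have h1 : ∀ z ∈ derivSpan e hc y, ∃ s : k, ∀ u : List ι, n ≤ u.length →
      form e hc u (z - s • y) = 0 := by
    intro z hz
    induction hz using Submodule.span_induction with
    | mem z hz =>
      obtain ⟨u, rfl⟩ := hz
      cases u with
      | nil => exact ⟨1, fun u _ => by simp [derivsOp]⟩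
      | cons p w =>
        refine ⟨0, fun u hu => ?_⟩
        have := form_append hc (p :: w).reverse u y
        rw [List.reverse_reverse] at this
        simp only [zero_smul, sub_zero]
        rw [← this]
        exact form_of_mem hc hyn _ (by simp; omega)
    | zero => exact ⟨0, fun u _ => by simp⟩
    | add a b _ _ ha hb =>
      obtain ⟨s, hs⟩ := ha
      obtain ⟨t, ht⟩ := hb
      refine ⟨s + t, fun u hu => ?_⟩
      rw [add_smul, add_sub_add_comm, map_add, hs u hu, ht u hu, add_zero]
    | smul r a _ ha =>
      obtain ⟨s, hs⟩ := ha
      exact ⟨r * s, fun u hu => by rw [mul_smul, ← smul_sub, map_smul, hs u hu, smul_zero]⟩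
  obtain ⟨s, hs⟩ := h1 z (by rw [derivSpan_eq_top hc hr hyn hy h0]; trivial)
  refine ⟨s, sub_eq_zero.mp (eq_zero_of_form hc fun u => ?_)⟩
  rcases lt_or_ge u.length n with hu | hu
  · rw [map_sub, map_smul, form_of_mem hc hz u (by omega), form_of_mem hc hyn u (by omega),
      smul_zero, sub_zero]
  · exact hs u hu

-- Such an element would be a multiple of y, and the length of a functional separates the two
-- degrees.
include hc in
theorem degree_eq_bot_of_killed (hr : IsRigid e c) {n m : ℕ} {y : Nichols e c}
    (hyn : y ∈ degree e c n) (hy : ∀ i, of e c (e i) * y = 0) (h0 : y ≠ 0) (hnm : n < m) :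
    degree e c m = ⊥ := by
  refine (Submodule.eq_bot_iff _).mpr fun z hz => ?_
  obtain ⟨s, rfl⟩ := mem_span_of_killed hc hr hyn hy h0 hnm.le hz
  refine eq_zero_of_form hc fun u => ?_
  by_cases hu : u.length = m
  · rw [map_smul, form_of_mem hc hyn u (by omega), smul_zero]
  · exact form_of_mem hc hz u hu

end Nichols
end
end NicholsFRT

namespace NicholsFRT

noncomputable section

/-! ### The degree below the top and the existence of a volume element -/

section Act

variable {k : Type*} [Field k] {H : Type*} [Ring H] [Bialgebra k H]

section

variable {M : Type*} [AddCommGroup M] [Module k M] (l : M →ₗ[k] H ⊗[k] M)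

/-- The operator `y ↦ φ(y₋₁) y₀`. -/
def act (φ : Dual k H) : Module.End k M := slice φ ∘ₗ l

theorem slice_sum {κ : Type*} (s : Finset κ) (φ : κ → Dual k H) (X : H ⊗[k] M) :
    slice (∑ i ∈ s, φ i) X = ∑ i ∈ s, slice (φ i) X := by
  induction X with
  | zero => simp
  | add x y hx hy => simp only [map_add, hx, hy, Finset.sum_add_distrib]
  | tmul h m => simp [slice_tmul, Finset.sum_smul]

theorem slice_smul (s : k) (φ : Dual k H) (X : H ⊗[k] M) : slice (s • φ) X = s • slice φ X := by
  induction X with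
  | zero => simp
  | add x y hx hy => simp only [map_add, hx, hy, smul_add]
  | tmul h m => simp [slice_tmul, mul_smul]

theorem act_sum {κ : Type*} (s : Finset κ) (φ : κ → Dual k H) (y : M) :
    act l (∑ i ∈ s, φ i) y = ∑ i ∈ s, act l (φ i) y := slice_sum s φ _

theorem act_smul (s : k) (φ : Dual k H) (y : M) : act l (s • φ) y = s • act l φ y :=
  slice_smul s φ _

variable {l} (hl : IsCoaction l)

include hl in
theorem act_counit (y : M) : act l counit y = y := LinearMap.congr_fun hl.counit y

-- A left comodule is a right module over the dual algebra, hence the reversed order.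
include hl in
theorem act_act (φ ψ : Dual k H) (y : M) :
    act l φ (act l ψ y) = act l (WithConv.toConv ψ * WithConv.toConv φ).ofConv y := by
  have h1 : act l φ (act l ψ y) = slice φ (slice ψ (l.lTensor H (l y))) := by
    rw [slice_lTensor]
    rfl
  have h2 : l.lTensor H (l y) = TensorProduct.assoc k H H M (comul.rTensor M (l y)) :=
    (LinearMap.congr_fun hl.coassoc y).symm
  rw [h1, h2, act, LinearMap.comp_apply]
  generalize l y = X
  induction X with
  | zero => simp
  | add x y hx hy => simp only [map_add, hx, hy]
  | tmul h m =>
    have h3 := convMul_repr (WithConv.toConv ψ) (WithConv.toConv φ) (ℛ k h)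
    rw [slice_tmul, h3, LinearMap.rTensor_tmul, ← (ℛ k h).eq]
    simp [sum_tmul, slice_tmul, Finset.sum_smul, mul_smul]

end

theorem slice_mul {B : Type*} [Ring B] [Algebra k B] {κ : Type*} (s : Finset κ) (φ : Dual k H)
    (α β : κ → Dual k H) (h : ∀ a b, φ (a * b) = ∑ m ∈ s, α m a * β m b) (X Y : H ⊗[k] B) :
    slice φ (X * Y) = ∑ m ∈ s, slice (α m) X * slice (β m) Y := by
  induction X with
  | zero => simp
  | add x y hx hy => simp only [add_mul, map_add, hx, hy, Finset.sum_add_distrib]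
  | tmul a x =>
    induction Y with
    | zero => simp
    | add y z hy hz => simp only [mul_add, map_add, hy, hz, Finset.sum_add_distrib]
    | tmul b y => simp [slice_tmul, h, Finset.sum_smul, smul_smul, mul_comm]

end Act

namespace Nichols

variable {k : Type*} [Field k] {V : Type*} [AddCommGroup V] [Module k V]
  {ι : Type*} [Fintype ι] [DecidableEq ι] {e : Basis ι k V} {c : V ⊗[k] V ≃ₗ[k] V ⊗[k] V}
  (hc : IsBraiding c)

/-- The combination `∑ w_i x_i` of the generators. -/
def lin (e : Basis ι k V) (c : V ⊗[k] V ≃ₗ[k] V ⊗[k] V) (w : ι → k) : Nichols e c :=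
  ∑ i, w i • of e c (e i)

-- Write φ_j^p for the operator of r(t_j^p, -). It satisfies φ_j^p(vy) = ∑_m φ_m^p(v) φ_j^m(y), and
-- the matrix of the φ_j^m has an inverse made of degree-preserving operators ψ_j. Hence φ_l^p(v) y
-- = ∑_j φ_j^p(v ψ_j(y)) = 0, and φ_l^p(v) is the displayed combination of generators.
include hc in
theorem lin_mul_eq_zero {m : ℕ} {w : ι → k} (hw : ∀ y ∈ degree e c m, lin e c w * y = 0) (p l : ι)
    {y : Nichols e c} (hy : y ∈ degree e c m) :
    lin e c (fun q => ∑ i, w i * coef e c i l p q) * y = 0 := by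
  obtain ⟨s, hs⟩ := exists_isInvPairing e hc
  let r := universalForm (coef_braid e hc)
  let L := (coaction e c).toLinearMap
  let φ : ι → ι → Dual k (FRT (coef e c)) := fun j p => curry r (FRT.t (coef e c) j p)
  let ψ : ι → Dual k (FRT (coef e c)) := fun j => (curry s).flip (FRT.t (coef e c) l j)
  have h1 : ∀ j a b, φ j p (a * b) = ∑ m, φ m p a * φ j m b := fun j a b => by
    refine (mul_right_repr (hs.left.mul_right _ a b) (FRT.reprT (coef e c) j p)).trans ?_
    exact Finset.sum_congr rfl fun m _ => mul_comm _ _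
  have h2 : ∀ j, ∑ m, act L (φ m p) (lin e c w) * act L (φ j m) (act L (ψ j) y) = 0 := fun j => by
    have h3 := slice_mul Finset.univ (φ j p) (fun m => φ m p) (fun m => φ j m) (h1 j)
      (L (lin e c w)) (L (act L (ψ j) y))
    refine h3.symm.trans ?_
    have h4 : L (lin e c w) * L (act L (ψ j) y) = L (lin e c w * act L (ψ j) y) :=
      (map_mul (coaction e c) _ _).symm
    have h5 : lin e c w * act L (ψ j) y = 0 := hw _ (slice_coaction_mem e c hy _)
    rw [h4, h5, map_zero, map_zero]
  -- The operators are inverse matrices because r and s are convolution inverse and t_l^m has the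
  -- matrix comultiplication.
  have h3 : ∀ m, ∑ j, act L (φ j m) (act L (ψ j) y) = if l = m then y else 0 := fun m => by
    have h4 : ∑ j, (WithConv.toConv (ψ j) * WithConv.toConv (φ j m)) =
        algebraMap k _ (if l = m then 1 else 0) := by
      have h5 := (conv_eq_one_iff _ _).mp hs.symm.mul_inv (FRT.t (coef e c) l m)
      rw [sandwich_repr _ _ _ (FRT.reprT (coef e c) l m), FRT.counit_t] at h5
      simp only [mul_one] at h5
      exact h5
    have h6 : ∑ j, act L (φ j m) (act L (ψ j) y) =
        act L (∑ j, (WithConv.toConv (ψ j) * WithConv.toConv (φ j m))).ofConv y := by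
      rw [WithConv.ofConv_sum, act_sum]
      exact Finset.sum_congr rfl fun j _ => act_act (isCoaction e c) _ _ y
    rw [h6, h4]
    split_ifs
    · rw [map_one]
      exact act_counit (isCoaction e c) y
    · rw [map_zero]
      exact (congrArg (fun φ => act L φ y) (zero_smul k (0 : Dual k _)).symm).trans
        ((act_smul L 0 0 y).trans (zero_smul _ _))
  have h4 : act L (φ l p) (lin e c w) = lin e c (fun q => ∑ i, w i * coef e c i l p q) := by
    simp only [lin, map_sum, map_smul, act, LinearMap.comp_apply, L, AlgHom.toLinearMap_apply,
      coaction_of, slice_tmul, Finset.smul_sum, smul_smul, Finset.sum_smul]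
    rw [Finset.sum_comm]
    refine Finset.sum_congr rfl fun q _ => Finset.sum_congr rfl fun i _ => ?_
    rw [show φ l p (FRT.t (coef e c) i q) = coef e c i l p q from universalForm_t _ _ _ _ _]
  rw [← h4]
  have h5 : ∑ m, act L (φ m p) (lin e c w) * ∑ j, act L (φ j m) (act L (ψ j) y) = 0 := by
    simp only [Finset.mul_sum]
    rw [Finset.sum_comm]
    exact Finset.sum_eq_zero fun j _ => h2 j
  simpa [h3] using h5

include hc in
/-- A combination of the generators that kills the degree below the top is zero. -/
theorem eq_zero_of_lin_mul_eq_zero {m : ℕ} {w : ι → k}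
    (hw : ∀ y ∈ degree e c m, lin e c w * y = 0) {b : Nichols e c} (hb : b ∈ degree e c (m + 1))
    (hb0 : b ≠ 0) (hb1 : ∀ i, of e c (e i) * b = 0) : w = 0 := by
  funext p
  have h : lin e c w * b = 0 := by
    simp only [lin, Finset.sum_mul, smul_mul_assoc, hb1, smul_zero, Finset.sum_const_zero]
  -- Apart from the leading term, each summand is a combination that kills degree m times ∂_j(b),
  -- which has degree m.
  have h1 : deriv e hc p (lin e c w * b) = w p • b + ∑ j,
      lin e c (fun q => ∑ i, w i * coef e c i j p q) * deriv e hc j b := by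
    simp only [lin, Finset.sum_mul, smul_mul_assoc, map_sum, map_smul, deriv_mul, smul_add,
      Finset.sum_add_distrib, Finset.sum_smul, Finset.smul_sum, smul_smul]
    refine congrArg₂ HAdd.hAdd (by simp) ?_
    rw [Finset.sum_comm]
    exact Finset.sum_congr rfl fun j _ => Finset.sum_comm
  rw [h, map_zero, Finset.sum_eq_zero fun j _ => lin_mul_eq_zero hc hw p j (deriv_mem e hc j hb),
    add_zero] at h1
  exact (smul_eq_zero.mp h1.symm).resolve_right hb0

-- Nonzero elements of distinct degrees are linearly independent, since a functional of length n
-- vanishes on all other degrees. So only finitely many degrees are nonzero, and degree 0 is one of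
-- them because ε(1) = 1.
include hc in
theorem exists_top [Module.Finite k (Nichols e c)] :
    ∃ n, degree e c n ≠ ⊥ ∧ ∀ m, n < m → degree e c m = ⊥ := by
  classical
  let S : Set ℕ := {n | degree e c n ≠ ⊥}
  have h0 : 0 ∈ S := fun h => by
    have h1 : (1 : Nichols e c) ∈ degree e c 0 := by
      rw [degree_zero]
      exact Submodule.mem_span_singleton_self 1
    rw [h, Submodule.mem_bot] at h1
    have h2 := congrArg (counitHom e c) h1
    rw [map_one, map_zero] at h2
    exact one_ne_zero h2
  have hS : ∀ n : S, ∃ y ∈ degree e c n, y ≠ 0 := fun n => Submodule.exists_mem_ne_zero_of_ne_bot n.2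
  choose y hy hy0 using hS
  have hind : LinearIndependent k y := by
    refine linearIndependent_iff'.mpr fun s g hg n hn => ?_
    by_contra hgn
    refine hy0 n (eq_zero_of_form hc fun u => ?_)
    by_cases hu : u.length = n
    · have h1 := congrArg (form e hc u) hg
      rw [map_sum, Finset.sum_eq_single_of_mem n hn fun m _ hm => by
        rw [map_smul, form_of_mem hc (hy m) u fun h => hm (Subtype.ext (h.symm.trans hu)),
          smul_zero], map_smul, map_zero] at h1
      exact (smul_eq_zero.mp h1).resolve_left hgn
    · exact form_of_mem hc (hy n) u hu
  have hfin : S.Finite := Set.finite_coe_iff.mp hind.finite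
  refine ⟨hfin.toFinset.max' ⟨0, hfin.mem_toFinset.mpr h0⟩,
    hfin.mem_toFinset.mp (Finset.max'_mem _ _), fun m hm => ?_⟩
  by_contra h
  exact absurd (Finset.le_max' _ m (hfin.mem_toFinset.mpr h)) (not_le.mpr hm)

include hc in
/-- The dual basis of the degree below the top. -/
theorem exists_dual_basis (hr : IsRigid e c) {m : ℕ} {b : Nichols e c}
    (hb : b ∈ degree e c (m + 1)) (hb0 : b ≠ 0) (hspan : degree e c (m + 1) = Submodule.span k {b})
    (hb1 : ∀ i, of e c (e i) * b = 0) : ∃ ω : ι → Nichols e c,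
      (∀ i j, of e c (e i) * ω j = if i = j then b else 0) ∧
      Submodule.span k (Set.range ω) = degree e c m := by
  have h1 : ∀ (y : degree e c m) (i : ι), ∃ s : k, s • b = of e c (e i) * y := fun y i => by
    have := of_mul_mem y.2 (e i)
    rw [hspan] at this
    exact Submodule.mem_span_singleton.mp this
  choose s hs using h1
  let π : degree e c m →ₗ[k] ι → k :=
    { toFun := s
      map_add' y z := funext fun i => smul_left_injective k hb0 (by
        simp only [hs, Submodule.coe_add, mul_add, Pi.add_apply, add_smul])
      map_smul' t y := funext fun i => smul_left_injective k hb0 (by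
        simp only [hs, Submodule.coe_smul, mul_smul_comm, Pi.smul_apply, smul_assoc,
          RingHom.id_apply]) }
  have hπ : ∀ y i, π y i • b = of e c (e i) * y := hs
  -- A nonzero element of degree m killed by all generators would make degree m + 1 vanish, but that
  -- degree contains b.
  have hinj : ∀ y, π y = 0 → y = 0 := fun y hy => by
    by_contra h0
    have h2 := degree_eq_bot_of_killed hc hr y.2 (fun i => by rw [← hπ, hy]; simp)
      (fun h => h0 (Subtype.ext h)) (Nat.lt_succ_self m)
    rw [h2] at hb
    exact hb0 ((Submodule.mem_bot k).mp hb)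
  -- A linear form that vanishes on the range gives coefficients of a combination of the generators
  -- that kills degree m.
  have hsurj : LinearMap.range π = ⊤ := by
    by_contra h
    obtain ⟨f, hf0, hf⟩ := Submodule.exists_le_ker_of_lt_top _ (lt_top_iff_ne_top.mpr h)
    have hfv : ∀ v, f v = ∑ i, v i * f (Pi.single i 1) := fun v => by
      conv_lhs => rw [pi_eq_sum_univ' v]
      simp only [map_sum, map_smul, smul_eq_mul]
    have hw : (fun i => f (Pi.single i 1)) = 0 := by
      refine eq_zero_of_lin_mul_eq_zero hc (fun y hy => ?_) hb hb0 hb1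
      simp only [lin, Finset.sum_mul, smul_mul_assoc]
      simp only [← hπ ⟨y, hy⟩, smul_smul, ← Finset.sum_smul]
      have h2 : f (π ⟨y, hy⟩) = 0 := hf ⟨_, rfl⟩
      rw [hfv] at h2
      simp only [mul_comm] at h2 ⊢
      rw [h2, zero_smul]
    refine hf0 (LinearMap.ext fun v => ?_)
    rw [hfv]
    exact Finset.sum_eq_zero fun i _ => by rw [congrFun hw i, Pi.zero_apply, mul_zero]
  have h2 : ∀ j, ∃ y, π y = Pi.single j 1 := fun j => by
    have : Pi.single j 1 ∈ LinearMap.range π := hsurj ▸ trivial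
    exact this
  choose ω hω using h2
  refine ⟨fun j => ω j, fun i j => ?_, le_antisymm ?_ fun y hy => ?_⟩
  · rw [← hπ, hω, Pi.single_apply]
    split_ifs <;> simp
  · rw [Submodule.span_le]
    rintro _ ⟨j, rfl⟩
    exact (ω j).2
  · have h3 : (⟨y, hy⟩ : degree e c m) = ∑ j, π ⟨y, hy⟩ j • ω j := by
      refine sub_eq_zero.mp (hinj _ ?_)
      rw [map_sub, map_sum]
      simp only [map_smul, hω]
      funext i
      simp [Pi.single_apply]
    have h4 := congrArg Subtype.val h3
    simp only [AddSubmonoidClass.coe_finsetSum, Submodule.coe_smul] at h4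
    rw [h4]
    exact Submodule.sum_mem _ fun j _ => Submodule.smul_mem _ _ (Submodule.subset_span ⟨j, rfl⟩)

include hc in
theorem nonempty_volumeData (hr : IsRigid e c) [Module.Finite k (Nichols e c)] :
    Nonempty (VolumeData e c) := by
  obtain ⟨top, htop, hbot⟩ := exists_top (e := e) hc
  obtain ⟨b, hb, hb0⟩ := Submodule.exists_mem_ne_zero_of_ne_bot htop
  have hb1 : ∀ i, of e c (e i) * b = 0 := fun i => by
    have := of_mul_mem hb (e i)
    rw [hbot _ (Nat.lt_succ_self _)] at this
    exact (Submodule.mem_bot k).mp this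
  have hspan : degree e c top = Submodule.span k {b} := by
    refine le_antisymm (fun z hz => ?_) ?_
    · obtain ⟨s, rfl⟩ := mem_span_of_killed hc hr hb hb1 hb0 le_rfl hz
      exact Submodule.smul_mem _ _ (Submodule.mem_span_singleton_self b)
    · rw [Submodule.span_le]
      rintro _ rfl
      exact hb
  -- The coaction preserves the top degree, which is a line.
  obtain ⟨D, hD⟩ : ∃ D, coaction e c b = D ⊗ₜ b := by
    obtain ⟨a, ha⟩ := exists_sum_tmul_of_slice (fun _ : Unit => b) (coaction e c b) fun φ => by
      rw [Set.range_const, ← hspan]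
      exact slice_coaction_mem e c hb φ
    exact ⟨a (), by simpa using ha⟩
  obtain ⟨ω, hω, hωspan⟩ : ∃ ω : ι → Nichols e c,
      (∀ i j, of e c (e i) * ω j = if i = j then b else 0) ∧
      Submodule.span k (Set.range ω) = ⨆ (m : ℕ) (_ : m + 1 = top), degree e c m := by
    cases top with
    | zero =>
      -- With top degree 0 all generators vanish in B, whereas ∂_i(x_i) = 1 ≠ 0. So there are none,
      -- and the empty family is a basis of B^{-1} = 0.
      have hι : IsEmpty ι := ⟨fun i => by
        have h1 : of e c (e i) ∈ degree e c 1 := by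
          rw [degree, pow_one]
          exact ⟨_, rfl⟩
        rw [hbot 1 one_pos, Submodule.mem_bot] at h1
        have h2 := deriv_of e hc i i
        rw [h1, map_zero, if_pos rfl] at h2
        have h3 := congrArg (counitHom e c) h2
        rw [map_one, map_zero] at h3
        exact zero_ne_one h3⟩
      exact ⟨fun i => hι.elim i, fun i => hι.elim i, by simp⟩
    | succ m =>
      obtain ⟨ω, h1, h2⟩ := exists_dual_basis hc hr hb hb0 hspan hb1
      refine ⟨ω, h1, h2.trans ?_⟩
      simp
  have hT : ∀ j, ∃ a : ι → FRT (coef e c), coaction e c (ω j) = ∑ i, a i ⊗ₜ ω i := fun j => by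
    obtain ⟨a, ha⟩ := exists_sum_tmul_of_slice ω (coaction e c (ω j)) fun φ => by
      have h1 : ω j ∈ Submodule.span k (Set.range ω) := Submodule.subset_span ⟨j, rfl⟩
      cases top with
      | zero => simp [hωspan] at h1 ⊢; simp [h1]
      | succ m =>
        have h2 : Submodule.span k (Set.range ω) = degree e c m := hωspan.trans (by simp)
        rw [h2] at h1 ⊢
        exact slice_coaction_mem e c h1 φ
    exact ⟨a, ha⟩
  choose T hT using hT
  exact ⟨⟨top, hbot, b, hb0, hspan, D, hD, ω, hωspan, hω, fun i j => T j i, hT⟩⟩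

end Nichols
end
end NicholsFRT

namespace NicholsFRT

noncomputable section

/-! ### The coaction of a bialgebra under A(c) and the operators of its braiding -/

namespace Nichols

variable {k : Type*} [Field k] {V : Type*} [AddCommGroup V] [Module k V]
  {ι : Type*} [Fintype ι] [DecidableEq ι] {e : Basis ι k V} {c : V ⊗[k] V ≃ₗ[k] V ⊗[k] V}
  {H : Type*} [Ring H] [Bialgebra k H] (f : FRT (coef e c) →ₐc[k] H) (r : H ⊗[k] H →ₗ[k] k)

/-- The coaction of a bialgebra under the FRT bialgebra. -/
def coactionMap : Nichols e c →ₐ[k] H ⊗[k] Nichols e c :=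
  (Algebra.TensorProduct.map (f : FRT (coef e c) →ₐ[k] H) (.id k _)).comp (coaction e c)

theorem coactionMap_apply (y : Nichols e c) : coactionMap f y =
    (f : FRT (coef e c) →ₐ[k] H).toLinearMap.rTensor _ (coaction e c y) := rfl

theorem coactionMap_of (i : ι) : coactionMap f (of e c (e i)) =
    ∑ j, f (FRT.t (coef e c) i j) ⊗ₜ[k] of e c (e j) := by
  rw [coactionMap_apply, coaction_of, map_sum]
  rfl

/-- The presentation of the comultiplication of the image of a generator. -/
def reprMap (i j : ι) : Coalgebra.Repr k (f (FRT.t (coef e c) i j)) ι :=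
  (FRT.reprT (coef e c) i j).induced f

theorem isCoaction_coactionMap : IsCoaction (coactionMap f).toLinearMap where
  coassoc := by
    have : (Algebra.TensorProduct.assoc k k k _ _ _).toAlgHom.comp
        ((Algebra.TensorProduct.map (Bialgebra.comulAlgHom k H)
          (.id k (Nichols e c))).comp (coactionMap f)) =
        (Algebra.TensorProduct.map (.id k _) (coactionMap f)).comp (coactionMap f) := by
      refine algHom_ext e c fun i => ?_
      have h : ∀ j, comul (R := k) (f (FRT.t (coef e c) i j)) = ∑ m,
          f (FRT.t (coef e c) i m) ⊗ₜ[k] f (FRT.t (coef e c) m j) :=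
        fun j => (reprMap f i j).eq.symm
      simp only [AlgHom.comp_apply, coactionMap_of, map_sum, Algebra.TensorProduct.map_tmul,
        Bialgebra.comulAlgHom_apply, h, AlgHom.id_apply, TensorProduct.sum_tmul,
        TensorProduct.tmul_sum]
      rw [Finset.sum_comm]
      rfl
    exact congrArg AlgHom.toLinearMap this
  counit := by
    have : (Algebra.TensorProduct.lid k _).toAlgHom.comp
        ((Algebra.TensorProduct.map (Bialgebra.counitAlgHom k H)
          (.id k (Nichols e c))).comp (coactionMap f)) = .id k _ := by
      refine algHom_ext e c fun i => ?_
      simp [coactionMap_of, FRT.counit_t]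
    exact congrArg AlgHom.toLinearMap this

theorem lTensor_counit_coactionMap (y : Nichols e c) :
    (counitHom e c).toLinearMap.lTensor _ (coactionMap f y) = 1 ⊗ₜ counitHom e c y := by
  have : (Algebra.TensorProduct.map (.id k H) (counitHom e c)).comp (coactionMap f) =
      Algebra.TensorProduct.includeRight.comp (counitHom e c) := by
    refine algHom_ext e c fun i => ?_
    simp [coactionMap_of, counitHom_of]
  exact AlgHom.congr_fun this y

theorem lTensor_deriv_coactionMap (hc : IsBraiding c) (q : ι) (y : Nichols e c) :
    (deriv e hc q).lTensor _ (coactionMap f y) =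
      ∑ p, (f (FRT.t (coef e c) p q) ⊗ₜ[k] 1) * coactionMap f (deriv e hc p y) := by
  have h := congrArg ((f : FRT (coef e c) →ₐ[k] H).toLinearMap.rTensor (Nichols e c))
    (lTensor_deriv_coaction e hc q y)
  rw [coactionMap_apply, ← LinearMap.comp_apply, LinearMap.lTensor_comp_rTensor,
    ← LinearMap.rTensor_comp_lTensor, LinearMap.comp_apply, h, map_sum]
  refine Finset.sum_congr rfl fun p _ => ?_
  exact map_mul (Algebra.TensorProduct.map (f : FRT (coef e c) →ₐ[k] H)
    (AlgHom.id k (Nichols e c))) _ _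

theorem act_coactionMap_mem {n : ℕ} {y : Nichols e c} (hy : y ∈ degree e c n) (φ : Dual k H) :
    act (coactionMap f).toLinearMap φ y ∈ degree e c n := by
  have h : ∀ X : FRT (coef e c) ⊗[k] Nichols e c,
      slice φ ((f : FRT (coef e c) →ₐ[k] H).toLinearMap.rTensor _ X) =
        slice (φ ∘ₗ (f : FRT (coef e c) →ₐ[k] H).toLinearMap) X := fun X => by
    induction X with
    | zero => simp
    | add x y hx hy => simp only [map_add, hx, hy]
    | tmul a m => simp [slice_tmul]
  exact (h _).symm ▸ slice_coaction_mem e c hy _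

/-- The operator `L_i^j(y) = r(y₋₁, t_i^j) y₀`, so that the braiding is
`x_i ⊗ y ↦ ∑ L_i^j(y) ⊗ x_j`. -/
def braidOp (i j : ι) : Module.End k (Nichols e c) :=
  act (coactionMap f).toLinearMap ((curry r).flip (f (FRT.t (coef e c) i j)))

theorem braidOp_mem (i j : ι) {n : ℕ} {y : Nichols e c} (hy : y ∈ degree e c n) :
    braidOp f r i j y ∈ degree e c n := act_coactionMap_mem f hy _

variable {r} (hr : IsPairing r)

include hr in
theorem form_mul_t (i j : ι) (a b : H) : r ((a * b) ⊗ₜ f (FRT.t (coef e c) i j)) =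
    ∑ m, r (a ⊗ₜ f (FRT.t (coef e c) i m)) * r (b ⊗ₜ f (FRT.t (coef e c) m j)) :=
  mul_left_repr (hr.mul_left a b _) (reprMap f i j)

include hr in
theorem braidOp_one (i j : ι) : braidOp f r i j 1 = if i = j then 1 else 0 := by
  rw [braidOp, act, LinearMap.comp_apply, AlgHom.toLinearMap_apply, map_one,
    Algebra.TensorProduct.one_def, slice_tmul]
  simp [hr.one_left, FRT.counit_t]

include hr in
theorem braidOp_mul (i j : ι) (y z : Nichols e c) :
    braidOp f r i j (y * z) = ∑ m, braidOp f r i m y * braidOp f r m j z := by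
  rw [braidOp, act, LinearMap.comp_apply, AlgHom.toLinearMap_apply, map_mul]
  exact slice_mul Finset.univ _ _ _ (form_mul_t f hr i j) _ _

include hr in
theorem counitHom_braidOp (i j : ι) (y : Nichols e c) :
    counitHom e c (braidOp f r i j y) = if i = j then counitHom e c y else 0 := by
  have h := congrArg (slice ((curry r).flip (f (FRT.t (coef e c) i j))))
    (lTensor_counit_coactionMap f y)
  rw [slice_lTensor, slice_tmul] at h
  refine h.trans ?_
  simp [hr.one_left, FRT.counit_t]

-- The coefficients are those of the rule for ∂_p(x_i y) without the term δ_{ip} y. They arise from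
-- r(t_j^p, t_i^q) when the coaction is moved past ∂_p.
include hr in
theorem deriv_braidOp (hc : IsBraiding c)
    (hrt : ∀ i p j q, r (f (FRT.t (coef e c) i p) ⊗ₜ f (FRT.t (coef e c) j q)) = coef e c j i p q)
    (p i m : ι) (y : Nichols e c) : deriv e hc p (braidOp f r i m y) =
      ∑ j, ∑ q, coef e c i j p q • braidOp f r q m (deriv e hc j y) := by
  have h := congrArg (slice ((curry r).flip (f (FRT.t (coef e c) i m))))
    (lTensor_deriv_coactionMap f hc p y)
  rw [slice_lTensor, map_sum] at h
  refine h.trans (Finset.sum_congr rfl fun j _ => ?_)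
  rw [slice_tmul_mul, one_mul]
  have h1 : (curry r).flip (f (FRT.t (coef e c) i m)) ∘ₗ
      LinearMap.mulLeft k (f (FRT.t (coef e c) j p)) =
      ∑ q, coef e c i j p q • (curry r).flip (f (FRT.t (coef e c) q m)) :=
    LinearMap.ext fun a => by
      simpa [hrt] using form_mul_t f hr i m (f (FRT.t (coef e c) j p)) a
  rw [h1, slice_sum]
  exact Finset.sum_congr rfl fun q _ => slice_smul _ _ _

/-- The consequence of quasicommutativity for the coaction of `L_i^j(y)`. -/
theorem coactionMap_braidOp (hq : ∀ a b, Quasicommute r (.id k H) (.id k H) a b) (i s : ι)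
    (y : Nichols e c) :
    ∑ m, coactionMap f (braidOp f r i m y) * (f (FRT.t (coef e c) m s) ⊗ₜ 1) =
      ∑ j, (f (FRT.t (coef e c) i j) ⊗ₜ 1) * (braidOp f r j s).lTensor H (coactionMap f y) := by
  let l := (coactionMap f).toLinearMap
  have hl := isCoaction_coactionMap f
  -- By coassociativity both sides depend on the comultiplication of the single component y₋₁, to
  -- which quasicommutativity with t_i^s applies.
  have h2 : l.lTensor H (l y) = TensorProduct.assoc k H H _ (comul.rTensor _ (l y)) :=
    (LinearMap.congr_fun hl.coassoc y).symm
  have h3 : ∀ m, coactionMap f (braidOp f r i m y) =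
      slice ((curry r).flip (f (FRT.t (coef e c) i m)))
        (TensorProduct.assoc k H H _ (comul.rTensor _ (l y))) := fun m => by
    rw [← h2, slice_lTensor]
    rfl
  have h4 : ∀ j, (braidOp f r j s).lTensor H (coactionMap f y) =
      (slice ((curry r).flip (f (FRT.t (coef e c) j s)))).lTensor H
        (TensorProduct.assoc k H H _ (comul.rTensor _ (l y))) := fun j => by
    rw [← h2, ← LinearMap.comp_apply, ← LinearMap.lTensor_comp]
    rfl
  simp only [h3, h4]
  generalize l y = X
  induction X with
  | zero => simp
  | add x y hx hy => simp only [map_add, add_mul, mul_add, Finset.sum_add_distrib, hx, hy]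
  | tmul a y =>
    have h5 := (quasicommute_iff _ _ _ (ℛ k a) (reprMap f i s)).mp
      (hq a (f (FRT.t (coef e c) i s)))
    have h6 := congrArg (· ⊗ₜ[k] y) h5
    simp only [LinearMap.rTensor_tmul, ← (ℛ k a).eq, sum_tmul, map_sum, assoc_tmul, slice_tmul,
      LinearMap.lTensor_tmul, Finset.sum_mul, Finset.mul_sum, smul_mul_assoc,
      Algebra.TensorProduct.tmul_mul_tmul, mul_one, one_mul, tmul_smul, smul_tmul'] at h6 ⊢
    rw [Finset.sum_comm]
    refine Eq.trans ?_ (h6.trans ?_)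
    · rfl
    · rw [Finset.sum_comm]
      exact Finset.sum_congr rfl fun x _ => Finset.sum_congr rfl fun i' _ => by
        rw [mul_smul_comm]
        rfl

end Nichols
end
end NicholsFRT

namespace NicholsFRT

noncomputable section

/-! ### The comultiplication with primitive generators -/

theorem slice_comp_rTensor {k A A' M : Type*} [Field k] [AddCommGroup A] [Module k A]
    [AddCommGroup A'] [Module k A'] [AddCommGroup M] [Module k M] (φ : Dual k A')
    (g : A →ₗ[k] A') (X : A ⊗[k] M) : slice (φ ∘ₗ g) X = slice φ (g.rTensor M X) := by
  rw [slice, LinearMap.rTensor_comp]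
  rfl

namespace Nichols

variable {k : Type*} [Field k] {V : Type*} [AddCommGroup V] [Module k V]
  {ι : Type*} [Fintype ι] [DecidableEq ι] {e : Basis ι k V} {c : V ⊗[k] V ≃ₗ[k] V ⊗[k] V}
  {H : Type*} [Ring H] [Bialgebra k H] (f : FRT (coef e c) →ₐc[k] H) (r : H ⊗[k] H →ₗ[k] k)

/-- The left multiplication by `1 ⊗ x_i` in the braided tensor square of the Nichols algebra. -/
def braidMul (i : ι) : Module.End k (Nichols e c ⊗[k] Nichols e c) :=
  ∑ j, TensorProduct.map (braidOp f r i j) (LinearMap.mulLeft k (of e c (e j)))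

theorem braidMul_tmul (i : ι) (y z : Nichols e c) :
    braidMul f r i (y ⊗ₜ z) = ∑ j, braidOp f r i j y ⊗ₜ (of e c (e j) * z) := by
  simp [braidMul, LinearMap.sum_apply]

/-- The left multiplication by `x_i ⊗ 1 + 1 ⊗ x_i` in the braided tensor square of the Nichols
algebra. -/
def primMul (i : ι) : Module.End k (Nichols e c ⊗[k] Nichols e c) :=
  (LinearMap.mulLeft k (of e c (e i))).rTensor _ + braidMul f r i

theorem primMul_tmul (i : ι) (y z : Nichols e c) : primMul f r i (y ⊗ₜ z) =
    (of e c (e i) * y) ⊗ₜ z + ∑ j, braidOp f r i j y ⊗ₜ (of e c (e j) * z) := by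
  rw [primMul, LinearMap.add_apply, braidMul_tmul]
  rfl

variable {r}

/-- The part x_i ⊗ 1 gives the first term and half of the sum by the rule for ∂_p(x_i y); the part 1
⊗ x_i gives the other half by the commutation rule of ∂_p and L_i^m. Both rules have the same
coefficients. -/
theorem rTensor_deriv_primMul (hr : IsPairing r) (hc : IsBraiding c)
    (hrt : ∀ i p j q, r (f (FRT.t (coef e c) i p) ⊗ₜ f (FRT.t (coef e c) j q)) = coef e c j i p q)
    (p i : ι) (X : Nichols e c ⊗[k] Nichols e c) :
    (deriv e hc p).rTensor _ (primMul f r i X) = (if p = i then X else 0) +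
      ∑ j, ∑ q, coef e c i j p q • primMul f r q ((deriv e hc j).rTensor _ X) := by
  induction X with
  | zero => simp
  | add X Y hX hY =>
    simp only [map_add, hX, hY, smul_add, Finset.sum_add_distrib]
    split_ifs <;> abel
  | tmul y z =>
    simp only [primMul_tmul, map_add, map_sum, LinearMap.rTensor_tmul, deriv_mul,
      deriv_braidOp f hr hc hrt, add_tmul, sum_tmul, smul_add, Finset.sum_add_distrib, add_assoc]
    refine congrArg₂ HAdd.hAdd (by split_ifs <;> simp) (congrArg₂ HAdd.hAdd ?_ ?_)
    · exact Finset.sum_congr rfl fun j _ => Finset.sum_congr rfl fun q _ => (smul_tmul' _ _ _).symm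
    · rw [Finset.sum_comm]
      refine Finset.sum_congr rfl fun j _ => ?_
      rw [Finset.sum_comm]
      refine Finset.sum_congr rfl fun q _ => ?_
      rw [Finset.smul_sum]
      exact Finset.sum_congr rfl fun m _ => (smul_tmul' _ _ _).symm

theorem slice_counit_primMul (hr : IsPairing r) (i : ι) (X : Nichols e c ⊗[k] Nichols e c) :
    slice (counitHom e c).toLinearMap (primMul f r i X) =
      of e c (e i) * slice (counitHom e c).toLinearMap X := by
  induction X with
  | zero => simp
  | add X Y hX hY => simp only [map_add, hX, hY, mul_add]
  | tmul y z =>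
    simp [primMul_tmul, slice_tmul, counitHom_of, counitHom_braidOp f hr]

variable (r)

/-- The comultiplication on the tensor algebra, with values in the square of the Nichols algebra. -/
def freeComul : TensorAlgebra k V →ₗ[k] Nichols e c ⊗[k] Nichols e c :=
  LinearMap.applyₗ (1 ⊗ₜ 1) ∘ₗ
    (TensorAlgebra.lift k (e.constr k fun i => primMul f r i)).toLinearMap

theorem freeComul_one : freeComul f r 1 = 1 ⊗ₜ 1 := by simp [freeComul]

theorem freeComul_mul (i : ι) (y : TensorAlgebra k V) :
    freeComul f r (TensorAlgebra.ι k (e i) * y) = primMul f r i (freeComul f r y) := by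
  simp [freeComul, Module.End.mul_apply]

variable {r} (hr : IsPairing r) (hc : IsBraiding c)
    (hrt : ∀ i p j q, r (f (FRT.t (coef e c) i p) ⊗ₜ f (FRT.t (coef e c) j q)) = coef e c j i p q)

-- Both sides obey the same recursion on words and vanish at 1.
include hr hrt in
theorem rTensor_deriv_freeComul (p : ι) (y : TensorAlgebra k V) :
    (deriv e hc p).rTensor _ (freeComul f r y) =
      freeComul f r (NicholsFRT.deriv e c p y) := by
  have : (deriv e hc p).rTensor _ ∘ₗ freeComul f r = freeComul f r ∘ₗ NicholsFRT.deriv e c p := by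
    refine LinearMap.ext fun y => ?_
    suffices ∀ p, (deriv e hc p).rTensor _ (freeComul f r y) =
      freeComul f r (NicholsFRT.deriv e c p y) from this p
    -- All indices are treated together, since the recursion for one derivation involves all of
    -- them.
    let F : TensorAlgebra k V →ₗ[k] ι → Nichols e c ⊗[k] Nichols e c :=
      LinearMap.pi fun p => (deriv e hc p).rTensor _ ∘ₗ freeComul f r
    let G : TensorAlgebra k V →ₗ[k] ι → Nichols e c ⊗[k] Nichols e c :=
      LinearMap.pi fun p => freeComul f r ∘ₗ NicholsFRT.deriv e c p
    have h : F = G := by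
      refine NicholsFRT.linear_ext_mul e ?_ fun i y hy => ?_
      · funext p
        simp [F, G, freeComul_one, deriv_one, NicholsFRT.deriv_one]
      · funext p
        have hy' : ∀ p, (deriv e hc p).rTensor _ (freeComul f r y) =
          freeComul f r (NicholsFRT.deriv e c p y) := fun p => congrFun hy p
        simp only [F, G, LinearMap.pi_apply, LinearMap.comp_apply, freeComul_mul,
          rTensor_deriv_primMul f hr hc hrt, hy', NicholsFRT.deriv_mul, map_add, map_sum, map_smul,
          apply_ite (freeComul f r), map_zero]
    exact fun p => congrFun (LinearMap.congr_fun h y) p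
  exact LinearMap.congr_fun this y

include hr in
theorem slice_counit_freeComul (y : TensorAlgebra k V) :
    slice (counitHom e c).toLinearMap (freeComul f r y) = mk e c y := by
  have : slice (counitHom e c).toLinearMap ∘ₗ freeComul f r = (mk e c).toLinearMap := by
    refine NicholsFRT.linear_ext_mul e ?_ fun i y hy => ?_
    · simp [freeComul_one, slice_tmul]
    · simp only [LinearMap.comp_apply, AlgHom.toLinearMap_apply] at hy ⊢
      rw [freeComul_mul, slice_counit_primMul f hr, hy, map_mul, mk_ι]
  exact LinearMap.congr_fun this y

-- A functional ε∂⋯∂ applied to the first factor of the coproduct of y gives the image in B of a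
-- derivative of y, by the intertwining rule and the counit law. This vanishes, as derivatives
-- preserve the kernel of TV → B.
include hr hc hrt in
theorem freeComul_eq_zero {y : TensorAlgebra k V} (hy : mk e c y = 0) : freeComul f r y = 0 := by
  refine tensor_eq_zero_of_form hc fun u => ?_
  induction u generalizing y with
  | nil => exact (slice_counit_freeComul f hr y).trans hy
  | cons p u ih =>
    rw [form, slice_comp_rTensor, rTensor_deriv_freeComul f hr hc hrt]
    exact ih (by rw [← deriv_mk e hc, hy, map_zero])

/-- The comultiplication of the Nichols algebra, in which the generators are primitive. -/
def comulMap : Nichols e c →ₗ[k] Nichols e c ⊗[k] Nichols e c :=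
  descend (mk e c).toLinearMap (mk_surjective e c) (freeComul f r)
    fun _ hy => freeComul_eq_zero f hr hc hrt hy

theorem comulMap_mk (y : TensorAlgebra k V) :
    comulMap f hr hc hrt (mk e c y) = freeComul f r y :=
  descend_apply (mk e c).toLinearMap (mk_surjective e c) _ _ y

theorem comulMap_one : comulMap f hr hc hrt 1 = 1 ⊗ₜ 1 := by
  rw [← map_one (mk e c), comulMap_mk, freeComul_one, map_one]

theorem comulMap_mul (i : ι) (y : Nichols e c) :
    comulMap f hr hc hrt (of e c (e i) * y) = primMul f r i (comulMap f hr hc hrt y) := by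
  obtain ⟨y, rfl⟩ := mk_surjective e c y
  rw [← mk_ι, ← map_mul, comulMap_mk, comulMap_mk, freeComul_mul]

theorem comulMap_of (v : V) :
    comulMap f hr hc hrt (of e c v) = of e c v ⊗ₜ 1 + 1 ⊗ₜ of e c v := by
  have : comulMap f hr hc hrt ∘ₗ of e c =
      (TensorProduct.mk k _ _).flip 1 ∘ₗ of e c + TensorProduct.mk k _ _ 1 ∘ₗ of e c := by
    refine e.ext fun i => ?_
    have h := comulMap_mul f hr hc hrt i 1
    rw [mul_one, comulMap_one, primMul_tmul] at h
    simpa [braidOp_one f hr, ite_tmul] using h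
  exact LinearMap.congr_fun this v

theorem rTensor_deriv_comulMap (p : ι) (y : Nichols e c) :
    (deriv e hc p).rTensor _ (comulMap f hr hc hrt y) =
      comulMap f hr hc hrt (deriv e hc p y) := by
  obtain ⟨y, rfl⟩ := mk_surjective e c y
  rw [deriv_mk, comulMap_mk, comulMap_mk, rTensor_deriv_freeComul f hr hc hrt]

theorem slice_counit_comulMap (y : Nichols e c) :
    slice (counitHom e c).toLinearMap (comulMap f hr hc hrt y) = y := by
  obtain ⟨y, rfl⟩ := mk_surjective e c y
  rw [comulMap_mk, slice_counit_freeComul f hr]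

theorem counit_right_comulMap (y : Nichols e c) :
    TensorProduct.rid k _ ((counitHom e c).toLinearMap.lTensor _ (comulMap f hr hc hrt y)) = y := by
  have h1 : ∀ i (X : Nichols e c ⊗[k] Nichols e c),
      TensorProduct.rid k _ ((counitHom e c).toLinearMap.lTensor _ (primMul f r i X)) =
      of e c (e i) * TensorProduct.rid k _ ((counitHom e c).toLinearMap.lTensor _ X) :=
    fun i X => by
      induction X with
      | zero => simp
      | add X Y hX hY => simp only [map_add, hX, hY, mul_add]
      | tmul y z => simp [primMul_tmul, counitHom_of]
  have : (TensorProduct.rid k _).toLinearMap ∘ₗ (counitHom e c).toLinearMap.lTensor _ ∘ₗ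
      comulMap f hr hc hrt = .id := by
    refine linear_ext_mul ?_ fun i y hy => ?_
    · simp [comulMap_one]
    · simp only [LinearMap.comp_apply, LinearEquiv.coe_coe, LinearMap.id_apply] at hy ⊢
      rw [comulMap_mul, h1, hy]
  exact LinearMap.congr_fun this y

/-- This is coassociativity after a functional ε∂⋯∂ on the first factor. As Δ intertwines ∂_p with
∂_p ⊗ id, the derivations can be removed one at a time, and the counit law remains. -/
theorem slice_form_comulMap (u : List ι) (y : Nichols e c) :
    comulMap f hr hc hrt (slice (form e hc u) (comulMap f hr hc hrt y)) =
      (slice (form e hc u) ∘ₗ comulMap f hr hc hrt).rTensor _ (comulMap f hr hc hrt y) := by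
  induction u generalizing y with
  | nil =>
    have : slice (counitHom e c).toLinearMap ∘ₗ comulMap f hr hc hrt = .id :=
      LinearMap.ext (slice_counit_comulMap f hr hc hrt)
    rw [form, slice_counit_comulMap, this, LinearMap.rTensor_id, LinearMap.id_apply]
  | cons p u ih =>
    have h : slice (form e hc (p :: u)) ∘ₗ comulMap f hr hc hrt =
        (slice (form e hc u) ∘ₗ comulMap f hr hc hrt) ∘ₗ deriv e hc p :=
      LinearMap.ext fun y => by
        rw [LinearMap.comp_apply, form, slice_comp_rTensor, rTensor_deriv_comulMap]
        rfl
    rw [h, LinearMap.rTensor_comp, LinearMap.comp_apply, rTensor_deriv_comulMap, ← ih, form,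
      slice_comp_rTensor, rTensor_deriv_comulMap]

/-- The functionals separate points in the first tensor factor. -/
theorem coassoc_comulMap :
    (TensorProduct.assoc k (Nichols e c) (Nichols e c) (Nichols e c)).toLinearMap ∘ₗ
    (comulMap f hr hc hrt).rTensor _ ∘ₗ
    comulMap f hr hc hrt = (comulMap f hr hc hrt).lTensor _ ∘ₗ comulMap f hr hc hrt := by
  refine LinearMap.ext fun y => sub_eq_zero.mp (tensor_eq_zero_of_form hc fun u => ?_)
  have h : ∀ X : (Nichols e c ⊗[k] Nichols e c) ⊗[k] Nichols e c,
      slice (form e hc u) (TensorProduct.assoc k _ _ _ X) = (slice (form e hc u)).rTensor _ X :=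
    fun X => by
      induction X with
      | zero => simp
      | add X Y hX hY => simp only [map_add, hX, hY]
      | tmul X z =>
        induction X with
        | zero => simp
        | add X Y hX hY => simp only [add_tmul, map_add, hX, hY]
        | tmul x y => simp [slice_tmul, smul_tmul']
  simp only [LinearMap.comp_apply, LinearEquiv.coe_coe, map_sub]
  rw [h, slice_lTensor, slice_form_comulMap, LinearMap.rTensor_comp, LinearMap.comp_apply, sub_self]

end Nichols
end
end NicholsFRT

namespace NicholsFRT

noncomputable section

/-! ### Multiplicativity and colinearity of the comultiplication -/

section Braiding

variable {k : Type*} [Field k] {H : Type*} [Ring H] [Bialgebra k H]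

theorem comoduleBraiding_tmul {M N : Type*} [AddCommGroup M] [Module k M] [AddCommGroup N]
    [Module k N] (r : H ⊗[k] H →ₗ[k] k) (l : M →ₗ[k] H ⊗[k] M) (l' : N →ₗ[k] H ⊗[k] N) (m : M)
    (n : N) {κ : Type*} (s : Finset κ) (a : κ → H) (m' : κ → M) (h : l m = ∑ i ∈ s, a i ⊗ₜ m' i) :
    comoduleBraiding r l l' (m ⊗ₜ n) = ∑ i ∈ s, act l' ((curry r).flip (a i)) n ⊗ₜ m' i := by
  simp only [comoduleBraiding, LinearMap.comp_apply, LinearEquiv.coe_coe, comm_tmul, map_tmul, h,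
    tmul_sum, map_sum, act]
  refine Finset.sum_congr rfl fun i _ => ?_
  generalize l' n = X
  induction X with
  | zero => simp
  | add X Y hX hY => simp only [add_tmul, map_add, hX, hY]
  | tmul b z => simp [slice_tmul, smul_tmul']

variable {B : Type*} [Ring B] [Algebra k B]

/-- The product of `B ⊗ B` twisted by a braiding. -/
def twistMul (Ψ : B ⊗[k] B →ₗ[k] B ⊗[k] B) : (B ⊗[k] B) ⊗[k] (B ⊗[k] B) →ₗ[k] B ⊗[k] B :=
  TensorProduct.map (LinearMap.mul' k B) (LinearMap.mul' k B) ∘ₗ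
    (TensorProduct.assoc k (B ⊗[k] B) B B).toLinearMap ∘ₗ
    ((TensorProduct.assoc k B B B).symm.toLinearMap ∘ₗ
      Ψ.lTensor B ∘ₗ (TensorProduct.assoc k B B B).toLinearMap).rTensor B ∘ₗ
    (TensorProduct.assoc k (B ⊗[k] B) B B).symm.toLinearMap

theorem twistMul_tmul (Ψ : B ⊗[k] B →ₗ[k] B ⊗[k] B) (y z y' z' : B) :
    twistMul Ψ ((y ⊗ₜ z) ⊗ₜ (y' ⊗ₜ z')) =
      TensorProduct.map (LinearMap.mulLeft k y) (LinearMap.mulRight k z') (Ψ (z ⊗ₜ y')) := by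
  simp only [twistMul, LinearMap.comp_apply, LinearEquiv.coe_coe, assoc_symm_tmul,
    LinearMap.rTensor_tmul, assoc_tmul, LinearMap.lTensor_tmul]
  generalize Ψ (z ⊗ₜ y') = X
  induction X with
  | zero => simp
  | add X Y hX hY => simp only [tmul_add, add_tmul, map_add, hX, hY]
  | tmul u v => simp

end Braiding

namespace Nichols

variable {k : Type*} [Field k] {V : Type*} [AddCommGroup V] [Module k V]
  {ι : Type*} [Fintype ι] [DecidableEq ι] {e : Basis ι k V} {c : V ⊗[k] V ≃ₗ[k] V ⊗[k] V}
  {H : Type*} [Ring H] [Bialgebra k H] (f : FRT (coef e c) →ₐc[k] H) (r : H ⊗[k] H →ₗ[k] k)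

/-- The braiding of the Nichols algebra with itself. -/
def selfBraiding : Nichols e c ⊗[k] Nichols e c →ₗ[k] Nichols e c ⊗[k] Nichols e c :=
  comoduleBraiding r (coactionMap f).toLinearMap (coactionMap f).toLinearMap

variable {r} (hr : IsPairing r)

include hr in
theorem selfBraiding_one (y : Nichols e c) : selfBraiding f r (1 ⊗ₜ y) = y ⊗ₜ 1 := by
  have h := comoduleBraiding_tmul r (coactionMap f).toLinearMap (coactionMap f).toLinearMap 1 y
    Finset.univ (fun _ : Unit => 1) (fun _ => 1) (by
      rw [AlgHom.toLinearMap_apply, map_one, Algebra.TensorProduct.one_def]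
      simp)
  have h1 : (curry r).flip 1 = counit := LinearMap.ext hr.one_right
  refine h.trans ?_
  simp only [Finset.univ_unique, Finset.sum_const, Finset.card_singleton, one_smul]
  rw [h1, act_counit (isCoaction_coactionMap f)]

-- One hexagon identity of the braiding: the coaction of x_i z is a product, and r(-, ab) splits
-- along the comultiplication of its first argument into two successive actions on y.
include hr in
theorem selfBraiding_mul (i : ι) (z y : Nichols e c) :
    selfBraiding f r ((of e c (e i) * z) ⊗ₜ y) = braidMul f r i (selfBraiding f r (z ⊗ₜ y)) := by
  obtain ⟨S, hS⟩ := TensorProduct.exists_finset (coactionMap f z)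
  have h := comoduleBraiding_tmul r (coactionMap f).toLinearMap (coactionMap f).toLinearMap z y
    S (fun x => x.1) (fun x => x.2) hS
  have h' := comoduleBraiding_tmul r (coactionMap f).toLinearMap (coactionMap f).toLinearMap
    (of e c (e i) * z) y (Finset.univ ×ˢ S) (fun x => f (FRT.t (coef e c) i x.1) * x.2.1)
    (fun x => of e c (e x.1) * x.2.2) (by
      rw [AlgHom.toLinearMap_apply, map_mul, coactionMap_of, hS, Finset.sum_mul_sum,
        Finset.sum_product]
      simp only [Algebra.TensorProduct.tmul_mul_tmul])
  refine h'.trans ((congrArg (braidMul f r i) h).trans ?_).symm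
  rw [map_sum, Finset.sum_product, Finset.sum_comm]
  refine Finset.sum_congr rfl fun x _ => ?_
  rw [braidMul_tmul]
  refine Finset.sum_congr rfl fun j _ => congrArg (· ⊗ₜ _) ?_
  refine (act_act (isCoaction_coactionMap f) _ _ y).trans ?_
  refine congrArg (fun φ => act (coactionMap f).toLinearMap φ y) (LinearMap.ext fun a => ?_)
  exact (hr.mul_right a _ _).symm

-- Associativity of the twisted product when the first factor is x_i ⊗ 1 + 1 ⊗ x_i. For the second
-- summand it comes from the hexagon identity and from the matrix rule for L_i^j on products.
include hr in
theorem twistMul_primMul (i : ι) (X Y : Nichols e c ⊗[k] Nichols e c) :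
    twistMul (selfBraiding f r) (primMul f r i X ⊗ₜ Y) =
      primMul f r i (twistMul (selfBraiding f r) (X ⊗ₜ Y)) := by
  induction X with
  | zero => simp
  | add X X' hX hX' => simp only [add_tmul, map_add, hX, hX']
  | tmul y z =>
    induction Y with
    | zero => simp
    | add Y Y' hY hY' => simp only [tmul_add, map_add, hY, hY']
    | tmul y' z' =>
      rw [primMul_tmul, add_tmul, map_add, sum_tmul, map_sum]
      simp only [twistMul_tmul, selfBraiding_mul f hr]
      generalize selfBraiding f r (z ⊗ₜ y') = P
      induction P with
      | zero => simp
      | add P Q hP hQ =>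
        simp only [map_add, Finset.sum_add_distrib, ← hP, ← hQ]
        abel
      | tmul u v =>
        simp only [braidMul_tmul, map_sum, map_tmul, LinearMap.mulLeft_apply,
          LinearMap.mulRight_apply, primMul_tmul, braidOp_mul f hr, sum_tmul, mul_assoc]
        rw [Finset.sum_comm]

include hr in
theorem twistMul_one (Y : Nichols e c ⊗[k] Nichols e c) :
    twistMul (selfBraiding f r) ((1 ⊗ₜ 1) ⊗ₜ Y) = Y := by
  induction Y with
  | zero => simp
  | add Y Y' hY hY' => simp only [tmul_add, map_add, hY, hY']
  | tmul y z => simp [twistMul_tmul, selfBraiding_one f hr]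

variable (hc : IsBraiding c)
    (hrt : ∀ i p j q, r (f (FRT.t (coef e c) i p) ⊗ₜ f (FRT.t (coef e c) j q)) = coef e c j i p q)

/-- Induction on the left factor: a generator acts on both sides by `primMul`. -/
theorem comulMap_mul_eq_twistMul (y z : Nichols e c) : comulMap f hr hc hrt (y * z) =
    twistMul (selfBraiding f r) (comulMap f hr hc hrt y ⊗ₜ comulMap f hr hc hrt z) := by
  have : comulMap f hr hc hrt ∘ₗ LinearMap.mulRight k z = twistMul (selfBraiding f r) ∘ₗ
      (TensorProduct.mk k _ _).flip (comulMap f hr hc hrt z) ∘ₗ comulMap f hr hc hrt := by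
    refine linear_ext_mul ?_ fun i y hy => ?_
    · simp [comulMap_one, twistMul_one f hr]
    · simp only [LinearMap.comp_apply, LinearMap.mulRight_apply, LinearMap.flip_apply,
        TensorProduct.mk_apply] at hy ⊢
      rw [mul_assoc, comulMap_mul, comulMap_mul, hy, twistMul_primMul f hr]
  exact LinearMap.congr_fun this y

/-- For x_i ⊗ 1 this is multiplicativity of the coaction. For 1 ⊗ x_i the coefficient of the
coaction of the generator stands on the wrong side of the coaction of the first factor, and
quasicommutativity moves it across. -/
theorem tensorCoaction_primMul (hq : ∀ a b, Quasicommute r (.id k H) (.id k H) a b) (i : ι)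
    (X : Nichols e c ⊗[k] Nichols e c) :
    tensorCoaction (coactionMap f).toLinearMap (coactionMap f).toLinearMap (primMul f r i X) =
      ∑ j, TensorProduct.map (LinearMap.mulLeft k (f (FRT.t (coef e c) i j))) (primMul f r j)
        (tensorCoaction (coactionMap f).toLinearMap (coactionMap f).toLinearMap X) := by
  let μ : (H ⊗[k] Nichols e c) ⊗[k] (H ⊗[k] Nichols e c) →ₗ[k]
      H ⊗[k] (Nichols e c ⊗[k] Nichols e c) := (LinearMap.mul' k H).rTensor _ ∘ₗ
    (TensorProduct.tensorTensorTensorComm k H _ H _).toLinearMap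
  have hμ : ∀ y z, tensorCoaction (coactionMap f).toLinearMap (coactionMap f).toLinearMap
    (y ⊗ₜ z) = μ (coactionMap f y ⊗ₜ coactionMap f z) := fun y z => rfl
  have hμt : ∀ a b y z, μ ((a ⊗ₜ y) ⊗ₜ (b ⊗ₜ z)) = (a * b) ⊗ₜ (y ⊗ₜ z) := fun a b y z => by
    simp [μ]
  have h1 : ∀ (a : H) (x : Nichols e c) A C, μ ((a ⊗ₜ x * A) ⊗ₜ C) =
      TensorProduct.map (LinearMap.mulLeft k a) ((LinearMap.mulLeft k x).rTensor _)
        (μ (A ⊗ₜ C)) := fun a x A C => by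
    induction A with
    | zero => simp
    | add A A' h h' => simp only [mul_add, add_tmul, map_add, h, h']
    | tmul b y =>
      induction C with
      | zero => simp
      | add A A' h h' => simp only [tmul_add, map_add, h, h']
      | tmul d z => simp [hμt, mul_assoc]
  have h2 : ∀ (a : H) (x : Nichols e c) A C, μ (A ⊗ₜ (a ⊗ₜ x * C)) =
      (LinearMap.lTensor _ (LinearMap.mulLeft k x)).lTensor H (μ ((A * a ⊗ₜ 1) ⊗ₜ C)) :=
    fun a x A C => by
      induction A with
      | zero => simp
      | add A A' h h' => simp only [add_mul, add_tmul, map_add, h, h']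
      | tmul b y =>
        induction C with
        | zero => simp
        | add A A' h h' => simp only [mul_add, tmul_add, map_add, h, h']
        | tmul d z => simp [hμt, mul_assoc]
  have h3 : ∀ (a : H) (x : Nichols e c) (L : Module.End k (Nichols e c)) A C,
      (LinearMap.lTensor _ (LinearMap.mulLeft k x)).lTensor H
        (μ ((a ⊗ₜ 1 * L.lTensor H A) ⊗ₜ C)) =
      TensorProduct.map (LinearMap.mulLeft k a) (TensorProduct.map L (LinearMap.mulLeft k x))
        (μ (A ⊗ₜ C)) := fun a x L A C => by
    induction A with
    | zero => simp
    | add A A' h h' => simp only [mul_add, add_tmul, map_add, h, h']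
    | tmul b y =>
      induction C with
      | zero => simp
      | add A A' h h' => simp only [tmul_add, map_add, h, h']
      | tmul d z => simp [hμt, mul_assoc]
  induction X with
  | zero => simp
  | add X Y hX hY => simp only [map_add, hX, hY, Finset.sum_add_distrib]
  | tmul y z =>
    rw [primMul_tmul, map_add, map_sum]
    simp only [hμ, map_mul, coactionMap_of, Finset.sum_mul, sum_tmul, tmul_sum, map_sum, h1, h2]
    simp only [primMul, TensorProduct.map_add_right, LinearMap.add_apply, Finset.sum_add_distrib]
    refine congrArg₂ HAdd.hAdd rfl ?_
    rw [Finset.sum_comm]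
    -- The generator that remains in the second factor is x_s; for each s the rule for the coaction
    -- of L_i^m(y) is applied to the sum over m.
    have h4 : ∀ s, ∑ m, (LinearMap.lTensor _ (LinearMap.mulLeft k (of e c (e s)))).lTensor H
        (μ ((coactionMap f (braidOp f r i m y) * f (FRT.t (coef e c) m s) ⊗ₜ 1) ⊗ₜ
          coactionMap f z)) = ∑ j, TensorProduct.map (LinearMap.mulLeft k (f (FRT.t (coef e c) i j)))
        (TensorProduct.map (braidOp f r j s) (LinearMap.mulLeft k (of e c (e s))))
        (μ (coactionMap f y ⊗ₜ coactionMap f z)) := fun s => by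
      rw [← map_sum, ← map_sum, ← sum_tmul, coactionMap_braidOp f hq, sum_tmul, map_sum, map_sum]
      exact Finset.sum_congr rfl fun j _ => h3 _ _ _ _ _
    simp only [h4]
    rw [Finset.sum_comm]
    refine Finset.sum_congr rfl fun j _ => ?_
    have h5 : TensorProduct.map (LinearMap.mulLeft k (f (FRT.t (coef e c) i j)))
        (braidMul f r j) = ∑ s, TensorProduct.map (LinearMap.mulLeft k (f (FRT.t (coef e c) i j)))
        (TensorProduct.map (braidOp f r j s) (LinearMap.mulLeft k (of e c (e s)))) :=
      map_sum (TensorProduct.mapBilinear (.id k) H _ H _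
        (LinearMap.mulLeft k (f (FRT.t (coef e c) i j)))) _ _
    rw [h5, LinearMap.sum_apply]

theorem comulMap_colinear (hq : ∀ a b, Quasicommute r (.id k H) (.id k H) a b) :
    IsColinear (coactionMap f).toLinearMap
      (tensorCoaction (coactionMap f).toLinearMap (coactionMap f).toLinearMap)
      (comulMap f hr hc hrt) := by
  refine linear_ext_mul ?_ fun i y hy => ?_
  · simp [comulMap_one, tensorCoaction, Algebra.TensorProduct.one_def]
  · simp only [LinearMap.comp_apply] at hy ⊢
    rw [comulMap_mul, tensorCoaction_primMul f hq, hy, AlgHom.toLinearMap_apply,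
      AlgHom.toLinearMap_apply, map_mul, coactionMap_of, Finset.sum_mul, map_sum]
    refine Finset.sum_congr rfl fun j _ => ?_
    generalize coactionMap f y = X
    induction X with
    | zero => simp
    | add X Y hX hY => simp only [map_add, mul_add, hX, hY]
    | tmul a y => simp [comulMap_mul]

end Nichols
end
end NicholsFRT

namespace NicholsFRT

noncomputable section

/-! ### Colinearity of the structure maps and the antipode -/

section Colinear

variable {k : Type*} [Field k] {H : Type*} [Ring H] [Bialgebra k H]
  {M M' N N' : Type*} [AddCommGroup M] [Module k M] [AddCommGroup N] [Module k N]
  [AddCommGroup M'] [Module k M'] [AddCommGroup N'] [Module k N']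
  {l : M →ₗ[k] H ⊗[k] M} {l' : M' →ₗ[k] H ⊗[k] M'} {d : N →ₗ[k] H ⊗[k] N}
  {d' : N' →ₗ[k] H ⊗[k] N'}

theorem IsColinear.comp {f : M →ₗ[k] M'} {g : M' →ₗ[k] N} (hg : IsColinear l' d g)
    (hf : IsColinear l l' f) : IsColinear l d (g ∘ₗ f) := by
  rw [IsColinear, ← LinearMap.comp_assoc, hg, LinearMap.comp_assoc, hf, LinearMap.lTensor_comp,
    LinearMap.comp_assoc]

theorem IsColinear.id : IsColinear l l .id := by
  rw [IsColinear, LinearMap.lTensor_id]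
  rfl

theorem IsColinear.sub {f g : M →ₗ[k] M'} (hf : IsColinear l l' f) (hg : IsColinear l l' g) :
    IsColinear l l' (f - g) := by
  rw [IsColinear, LinearMap.comp_sub, hf, hg, LinearMap.lTensor_sub, LinearMap.sub_comp]

theorem IsColinear.sum {κ : Type*} (s : Finset κ) {f : κ → M →ₗ[k] M'}
    (hf : ∀ i ∈ s, IsColinear l l' (f i)) : IsColinear l l' (∑ i ∈ s, f i) := by
  classical
  induction s using Finset.induction_on with
  | empty => simp [IsColinear]
  | insert i s hi ih =>
    rw [Finset.sum_insert hi, IsColinear, LinearMap.comp_add, hf i (Finset.mem_insert_self _ _),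
      ih fun j hj => hf j (Finset.mem_insert_of_mem hj), LinearMap.lTensor_add, LinearMap.add_comp]

theorem IsColinear.map {f : M →ₗ[k] M'} {g : N →ₗ[k] N'} (hf : IsColinear l l' f)
    (hg : IsColinear d d' g) :
    IsColinear (tensorCoaction l d) (tensorCoaction l' d') (TensorProduct.map f g) := by
  refine TensorProduct.ext' fun m n => ?_
  have h1 : l' (f m) = f.lTensor H (l m) := LinearMap.congr_fun hf m
  have h2 : d' (g n) = g.lTensor H (d n) := LinearMap.congr_fun hg n
  simp only [tensorCoaction, LinearMap.comp_apply, map_tmul, h1, h2, LinearEquiv.coe_coe]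
  generalize l m = X, d n = Y
  induction X with
  | zero => simp
  | add X X' h h' => simp only [map_add, add_tmul, h, h']
  | tmul a x =>
    induction Y with
    | zero => simp
    | add Y Y' h h' => simp only [map_add, tmul_add, h, h']
    | tmul b y => simp

end Colinear

namespace Nichols

variable {k : Type*} [Field k] {V : Type*} [AddCommGroup V] [Module k V]
  {ι : Type*} [Fintype ι] [DecidableEq ι] {e : Basis ι k V} {c : V ⊗[k] V ≃ₗ[k] V ⊗[k] V}
  {H : Type*} [Ring H] [Bialgebra k H] (f : FRT (coef e c) →ₐc[k] H) {r : H ⊗[k] H →ₗ[k] k}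

theorem mul_colinear : IsColinear
    (tensorCoaction (coactionMap f).toLinearMap (coactionMap f).toLinearMap)
    (coactionMap f).toLinearMap (LinearMap.mul' k (Nichols e c)) := by
  refine TensorProduct.ext' fun y z => ?_
  simp only [tensorCoaction, LinearMap.comp_apply, map_tmul, LinearMap.mul'_apply,
    AlgHom.toLinearMap_apply, map_mul, LinearEquiv.coe_coe]
  generalize coactionMap f y = X, coactionMap f z = Y
  induction X with
  | zero => simp
  | add X X' h h' => simp only [map_add, add_tmul, add_mul, h, h']
  | tmul a x =>
    induction Y with
    | zero => simp
    | add Y Y' h h' => simp only [map_add, tmul_add, mul_add, h, h']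
    | tmul b y => simp

theorem one_colinear : IsColinear trivialCoaction (coactionMap f).toLinearMap
    (Algebra.linearMap k (Nichols e c)) := by
  refine LinearMap.ext_ring ?_
  simp [trivialCoaction, Algebra.TensorProduct.one_def]

theorem counit_colinear : IsColinear (coactionMap f).toLinearMap trivialCoaction
    (counitHom e c).toLinearMap :=
  LinearMap.ext fun y => (lTensor_counit_coactionMap f y).symm

omit [Fintype ι] [DecidableEq ι] in
theorem linear_ext_degree {M : Type*} [AddCommGroup M] [Module k M] {g h : Nichols e c →ₗ[k] M}
    (H : ∀ n, ∀ y ∈ degree e c n, g y = h y) : g = h := by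
  have h1 : ∀ y, y ∈ ⨆ n, degree e c n := by
    have : (⨆ n, degree e c n).mkQ = 0 := by
      refine linear_ext_mul ?_ fun i y hy => ?_
      · rw [LinearMap.zero_apply, Submodule.mkQ_apply, Submodule.Quotient.mk_eq_zero]
        refine Submodule.mem_iSup_of_mem 0 ?_
        rw [degree_zero]
        exact Submodule.mem_span_singleton_self 1
      · rw [LinearMap.zero_apply, Submodule.mkQ_apply, Submodule.Quotient.mk_eq_zero] at hy ⊢
        refine Submodule.iSup_induction (degree e c)
          (motive := fun y => of e c (e i) * y ∈ ⨆ n, degree e c n) hy (fun n y hy => ?_) ?_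
          fun y z hy hz => ?_
        · exact Submodule.mem_iSup_of_mem (n + 1) (of_mul_mem hy _)
        · rw [mul_zero]
          exact zero_mem _
        · rw [mul_add]
          exact add_mem hy hz
    intro y
    rw [← Submodule.Quotient.mk_eq_zero, ← Submodule.mkQ_apply, this, LinearMap.zero_apply]
  refine LinearMap.ext fun y => ?_
  refine Submodule.iSup_induction (degree e c) (motive := fun y => g y = h y) (h1 y)
    (fun n y hy => H n y hy) ?_ fun y z hy hz => ?_
  · rw [map_zero, map_zero]
  · rw [map_add, map_add, hy, hz]

/-- The elements of degree `n` of the tensor square. -/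
def squareDegree (e : Basis ι k V) (c : V ⊗[k] V ≃ₗ[k] V ⊗[k] V) (n : ℕ) :
    Submodule k (Nichols e c ⊗[k] Nichols e c) :=
  Submodule.span k {X | ∃ i j y z, i + j = n ∧ y ∈ degree e c i ∧ z ∈ degree e c j ∧ X = y ⊗ₜ z}

theorem primMul_mem (i : ι) {n : ℕ} {X : Nichols e c ⊗[k] Nichols e c}
    (hX : X ∈ squareDegree e c n) : primMul f r i X ∈ squareDegree e c (n + 1) := by
  induction hX using Submodule.span_induction with
  | mem X hX =>
    obtain ⟨a, b, y, z, rfl, hy, hz, rfl⟩ := hX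
    rw [primMul_tmul]
    refine add_mem (Submodule.subset_span ⟨a + 1, b, _, _, by omega, of_mul_mem hy _, hz, rfl⟩)
      (sum_mem fun j _ => Submodule.subset_span
        ⟨a, b + 1, _, _, by omega, braidOp_mem f r i j hy, of_mul_mem hz _, rfl⟩)
  | zero => simp
  | add X Y _ _ hX hY => rw [map_add]; exact add_mem hX hY
  | smul s X _ hX => rw [map_smul]; exact Submodule.smul_mem _ _ hX

variable (hr : IsPairing r) (hc : IsBraiding c)
    (hrt : ∀ i p j q, r (f (FRT.t (coef e c) i p) ⊗ₜ f (FRT.t (coef e c) j q)) = coef e c j i p q)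

/-- The comultiplication is graded because its recursion multiplies one factor or the other by a
generator and the operators L_i^j preserve degrees. The nilpotency argument for the antipode relies
on this. -/
theorem comulMap_mem {n : ℕ} {y : Nichols e c} (hy : y ∈ degree e c n) :
    comulMap f hr hc hrt y ∈ squareDegree e c n := by
  induction n generalizing y with
  | zero =>
    rw [degree_zero] at hy
    obtain ⟨s, rfl⟩ := Submodule.mem_span_singleton.mp hy
    have h1 : (1 : Nichols e c) ∈ degree e c 0 := by
      rw [degree_zero]
      exact Submodule.mem_span_singleton_self 1
    rw [map_smul, comulMap_one]
    exact Submodule.smul_mem _ _ (Submodule.subset_span ⟨0, 0, _, _, rfl, h1, h1, rfl⟩)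
  | succ n ih =>
    rw [degree, pow_succ'] at hy
    induction hy using Submodule.mul_induction_on' with
    | mem_mul_mem v hv y hy =>
      obtain ⟨v, rfl⟩ := hv
      rw [← e.sum_repr v]
      simp only [map_sum, map_smul, Finset.sum_mul, smul_mul_assoc, comulMap_mul]
      exact sum_mem fun i _ => Submodule.smul_mem _ _ (primMul_mem f i (ih hy))
    | add y _ z _ hy hz => rw [map_add]; exact add_mem hy hz

/-- The coalgebra structure of the Nichols algebra. -/
@[reducible] def coalgebra : Coalgebra k (Nichols e c) where
  comul := comulMap f hr hc hrt
  counit := (counitHom e c).toLinearMap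
  coassoc := coassoc_comulMap f hr hc hrt
  rTensor_counit_comp_comul := LinearMap.ext fun y =>
    (TensorProduct.lid k _).injective (by
      refine (slice_counit_comulMap f hr hc hrt y).trans ?_
      simp)
  lTensor_counit_comp_comul := LinearMap.ext fun y =>
    (TensorProduct.rid k _).injective (by
      refine (counit_right_comulMap f hr hc hrt y).trans ?_
      simp)

/-- In the convolution algebra the identity is 1 - u with u = ηε - id. Since u kills degree 0, u^n
kills all degrees below n, so u is nilpotent and the geometric series is an inverse. Its terms are
colinear, being convolution products of colinear maps. -/
theorem exists_antipode [Module.Finite k (Nichols e c)]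
    (hq : ∀ a b, Quasicommute r (.id k H) (.id k H) a b) : ∃ S : Nichols e c →ₗ[k] Nichols e c,
      IsColinear (coactionMap f).toLinearMap (coactionMap f).toLinearMap S ∧
      LinearMap.mul' k _ ∘ₗ S.rTensor _ ∘ₗ comulMap f hr hc hrt =
        Algebra.linearMap k _ ∘ₗ (counitHom e c).toLinearMap ∧
      LinearMap.mul' k _ ∘ₗ S.lTensor _ ∘ₗ comulMap f hr hc hrt =
        Algebra.linearMap k _ ∘ₗ (counitHom e c).toLinearMap := by
  let _ := coalgebra f hr hc hrt
  let I : WithConv (Nichols e c →ₗ[k] Nichols e c) := WithConv.toConv .id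
  let u : WithConv (Nichols e c →ₗ[k] Nichols e c) := 1 - I
  have hmul : ∀ (g h : WithConv (Nichols e c →ₗ[k] Nichols e c)) y, (g * h).ofConv y =
      LinearMap.mul' k _ (TensorProduct.map g.ofConv h.ofConv (comulMap f hr hc hrt y)) :=
    fun g h y => rfl
  have hone : ∀ y, (1 : WithConv (Nichols e c →ₗ[k] Nichols e c)).ofConv y =
      algebraMap k _ (counitHom e c y) := fun y => rfl
  have hu0 : ∀ y ∈ degree e c 0, u.ofConv y = 0 := fun y hy => by
    rw [degree_zero] at hy
    obtain ⟨s, rfl⟩ := Submodule.mem_span_singleton.mp hy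
    have : u.ofConv 1 = 0 := by
      change (1 : WithConv (Nichols e c →ₗ[k] Nichols e c)).ofConv 1 - 1 = 0
      rw [hone, map_one, map_one, sub_self]
    rw [map_smul, this, smul_zero]
  have hu : ∀ n m, m < n → ∀ y ∈ degree e c m, (u ^ n).ofConv y = 0 := by
    intro n
    induction n with
    | zero => intro m hm; omega
    | succ n ih =>
      intro m hm y hy
      rw [pow_succ', hmul]
      have h1 := comulMap_mem f hr hc hrt hy
      generalize comulMap f hr hc hrt y = X at h1
      induction h1 using Submodule.span_induction with
      | mem X hX =>
        obtain ⟨i, j, y, z, hij, hy, hz, rfl⟩ := hX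
        rw [map_tmul, LinearMap.mul'_apply]
        -- Either the first factor has degree 0 and is killed by u, or the second has degree below n
        -- and is killed by u^n.
        rcases Nat.eq_zero_or_pos i with rfl | hi
        · rw [hu0 y hy, zero_mul]
        · rw [ih j (by omega) z hz, mul_zero]
      | zero => simp
      | add X Y _ _ hX hY => rw [map_add, map_add, hX, hY, add_zero]
      | smul s X _ hX => rw [map_smul, map_smul, hX, smul_zero]
  obtain ⟨N, _, hN⟩ := exists_top (e := e) hc
  have hnil : u ^ (N + 1) = 0 := by
    -- Degrees above the top contain only 0, and u^(N+1) kills the degrees up to N.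
    refine WithConv.ext (linear_ext_degree fun m y hy => ?_)
    rcases Nat.lt_or_ge N m with h | h
    · rw [hN m h, Submodule.mem_bot] at hy
      rw [hy, map_zero, map_zero]
    · exact hu _ m (by omega) y hy
  let S : WithConv (Nichols e c →ₗ[k] Nichols e c) := ∑ n ∈ Finset.range (N + 1), u ^ n
  have hI : I = 1 - u := (sub_sub_cancel 1 I).symm
  have hSI : S * I = 1 := by rw [hI, geom_sum_mul_neg, hnil, sub_zero]
  have hIS : I * S = 1 := by rw [hI, mul_neg_geom_sum, hnil, sub_zero]
  have h1c : IsColinear (coactionMap f).toLinearMap (coactionMap f).toLinearMap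
      (1 : WithConv (Nichols e c →ₗ[k] Nichols e c)).ofConv :=
    (one_colinear f).comp (counit_colinear f)
  have huc : ∀ n, IsColinear (coactionMap f).toLinearMap (coactionMap f).toLinearMap
      (u ^ n).ofConv := fun n => by
    induction n with
    | zero => exact h1c
    | succ n ih =>
      rw [pow_succ']
      exact (mul_colinear f).comp
        (((h1c.sub IsColinear.id).map ih).comp (comulMap_colinear f hr hc hrt hq))
  refine ⟨S.ofConv, ?_, congrArg WithConv.ofConv hSI, congrArg WithConv.ofConv hIS⟩
  rw [WithConv.ofConv_sum]
  exact IsColinear.sum _ fun n _ => huc n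

include hr hc hrt in
/-- The Nichols algebra is a braided Hopf algebra in the comodules over a bialgebra with a suitable
form. -/
theorem exists_isBraidedHopfAlgebra [Module.Finite k (Nichols e c)]
    (hq : ∀ a b, Quasicommute r (.id k H) (.id k H) a b) :
    ∃ (Δ : Nichols e c →ₗ[k] Nichols e c ⊗[k] Nichols e c) (ε : Nichols e c →ₗ[k] k)
      (S : Nichols e c →ₗ[k] Nichols e c),
      IsBraidedHopfAlgebra r (coactionMap f).toLinearMap Δ ε S ∧
      ∀ v, Δ (of e c v) = of e c v ⊗ₜ 1 + 1 ⊗ₜ of e c v := by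
  obtain ⟨S, hS, hl, hr'⟩ := exists_antipode f hr hc hrt hq
  exact ⟨comulMap f hr hc hrt, (counitHom e c).toLinearMap, S,
    { coaction := isCoaction_coactionMap f
      mul_colinear := mul_colinear f
      one_colinear := one_colinear f
      comul_colinear := comulMap_colinear f hr hc hrt hq
      counit_colinear := counit_colinear f
      antipode_colinear := hS
      coassoc := coassoc_comulMap f hr hc hrt
      counit_left := LinearMap.ext (slice_counit_comulMap f hr hc hrt)
      counit_right := LinearMap.ext (counit_right_comulMap f hr hc hrt)
      comul_one := comulMap_one f hr hc hrt
      counit_one := map_one (counitHom e c)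
      counit_mul := map_mul (counitHom e c)
      comul_mul := TensorProduct.ext' (comulMap_mul_eq_twistMul f hr hc hrt)
      antipode_left := hl
      antipode_right := hr' }, comulMap_of f hr hc hrt⟩

end Nichols

/-! ### Specialization to H(c) and the main theorem -/

namespace VolumeData

variable {k : Type*} [Field k] {V : Type*} [AddCommGroup V] [Module k V]
  {ι : Type*} [Fintype ι] [DecidableEq ι] {e : Basis ι k V} {c : V ⊗[k] V ≃ₗ[k] V ⊗[k] V}

/-- The canonical map `A(c) → H(c)` as a bialgebra map. -/
def toHBialg (F : VolumeData e c) : FRT (coef e c) →ₐc[k] F.H :=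
  .ofAlgHom F.toH (Loc.counitHom_comp F.det) (Loc.comulHom_comp F.det).symm

/-- The construction over a bialgebra under A(c) needs only a pairing with the prescribed values on
generators and quasicommutativity, and a coquasitriangular structure that extends the universal form
has both. -/
theorem exists_isBraidedHopfAlgebra [Module.Finite k (Nichols e c)] (hc : IsBraiding c)
    (F : VolumeData e c) {r : F.H ⊗[k] F.H →ₗ[k] k} (hr : IsCoquasitriangular r)
    (h : ∀ x y, r (F.toH x ⊗ₜ F.toH y) = universalForm (coef_braid e hc) (x ⊗ₜ y)) :
    ∃ (Δ : Nichols e c →ₗ[k] Nichols e c ⊗[k] Nichols e c) (ε : Nichols e c →ₗ[k] k)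
      (S : Nichols e c →ₗ[k] Nichols e c),
      IsBraidedHopfAlgebra r F.coaction Δ ε S ∧
      ∀ v, Δ (Nichols.of e c v) = Nichols.of e c v ⊗ₜ 1 + 1 ⊗ₜ Nichols.of e c v :=
  Nichols.exists_isBraidedHopfAlgebra F.toHBialg hr.isPairing hc
    (fun _ _ _ _ => (h _ _).trans (universalForm_t _ _ _ _ _))
    fun a b => (quasicommute_iff_tensor r a b).mpr (hr.quasicomm a b)

end VolumeData
end
end NicholsFRT

theorem mainTheorem5 {k : Type*} [Field k] {V : Type*} [AddCommGroup V] [Module k V]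
    {ι : Type*} [Fintype ι] [DecidableEq ι] (e : Basis ι k V)
    (c : V ⊗[k] V ≃ₗ[k] V ⊗[k] V) (hc : IsBraiding c) (hrigid : IsRigid e c)
    (hfin : Module.Finite k (Nichols e c)) :
    Nonempty (VolumeData e c) ∧
    ∀ F : VolumeData e c,
      (Function.Injective F.toH ∨
        ∀ i j, ∑ l, hayashi (universalForm (coef_braid e hc)) F.D (F.T i l) *
          FRT.t (coef e c) l j = if i = j then F.D else 0) →
      (∃! r : F.H ⊗[k] F.H →ₗ[k] k, IsCoquasitriangular r ∧
        ∀ x y, r (F.toH x ⊗ₜ F.toH y) = universalForm (coef_braid e hc) (x ⊗ₜ y)) ∧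
      ∀ r : F.H ⊗[k] F.H →ₗ[k] k, IsCoquasitriangular r →
        (∀ x y, r (F.toH x ⊗ₜ F.toH y) = universalForm (coef_braid e hc) (x ⊗ₜ y)) →
        ∃ (Δ : Nichols e c →ₗ[k] Nichols e c ⊗[k] Nichols e c) (ε : Nichols e c →ₗ[k] k)
          (S : Nichols e c →ₗ[k] Nichols e c),
          IsBraidedHopfAlgebra r F.coaction Δ ε S ∧
          ∀ v, Δ (Nichols.of e c v) = Nichols.of e c v ⊗ₜ 1 + 1 ⊗ₜ Nichols.of e c v :=
  ⟨Nichols.nonempty_volumeData hc hrigid, fun F _ =>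
    ⟨F.existsUnique_isCoquasitriangular hc, fun _ hr h => F.exists_isBraidedHopfAlgebra hc hr h⟩⟩
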